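/- **The model.** An N-system has $n=n_1+n_2$ servers: $n_1$ of type $s_1$, which can serve customers of both types $c_1,c_2$, and $n_2$ of type $s_2$, which can serve only type $c_1$. Customers of types $c_1$ and $c_2$ arrive in independent Poisson streams of rates $\lambda_1$ and $\lambda_2$; service times are independent exponentials, of rate $\mu_1$ at an $s_1$ server and $\mu_2$ at an $s_2$ server. The policy is FCFS-ALIS: a server that completes a service takes the longest waiting compatible customer, if there is one, and an arriving customer goes to the longest idle compatible server, if there is one. The state $\mathfrak s$ of the resulting continuous-time Markov chain lists the customers present in order of arrival, each waiting (with its type) or attached to the busy server that serves it, and after them the idle servers by increasing idle time (longest idle last). Each waiting customer is incompatible with all servers that come after it. Reading off the servers gives a permutation $S_1,\dots,S_n$ of the servers. Let $I_1,I_2$ be the numbers of idle servers of types $s_1,s_2$, and let $K$ be the number of $s_2$ servers that follow the last $s_1$ server in $S_1,\dots,S_n$. **Fluid quantities.** For $x_1,x_2,\ell>0$ with $\ell<x_1\mu_1+x_2\mu_2$ let $T=T(x_1,x_2,\ell)$ be the unique positive solution of $\ell=\frac{x_1}{T+1/\mu_1}+\frac{x_2}{T+1/\mu_2}$, that is, $$T=\frac12\left(\frac{x_1+x_2}{\ell}-\frac1{\mu_1}-\frac1{\mu_2}+\sqrt{\Big(\frac{x_1+x_2}{\ell}\Big)^2-2\,\frac{x_1-x_2}{\ell}\Big(\frac1{\mu_1}-\frac1{\mu_2}\Big)+\Big(\frac1{\mu_1}-\frac1{\mu_2}\Big)^2}\right),$$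 and put $M_i(x_1,x_2,\ell)=\dfrac{T x_i}{T+1/\mu_i}$ for $i=1,2$, and $\beta(x_1,x_2,\ell)=\dfrac{x_1}{\ell\,(T+1/\mu_1)}$. **Theorem.** Let $0<\theta<1$, $0<\alpha<1$ and $\mu_1,\mu_2,r>0$. For each $n$ let $n_1=\lceil\theta n\rceil$, $n_2=n-n_1$, $\lambda_1=\alpha\lambda^{(n)}$ and $\lambda_2=(1-\alpha)\lambda^{(n)}$, where the total arrival rates satisfy $\lambda^{(n)}/n\to r$. Assume that $\dfrac{r}{\theta\mu_1+(1-\theta)\mu_2}<1$ and that complete resource pooling holds: $\alpha+\beta(\theta,1-\theta,r)>1$. Put $f_i=M_i(\theta,1-\theta,r)$ and $m_i=m_i^{(n)}=M_i(n_1,n_2,\lambda^{(n)})$ for $i=1,2$, and $$\sigma_1^2=\frac{(\theta-f_1)f_1\big((1-\theta)f_1+f_2^2\big)}{\theta f_2^2+(1-\theta)f_1^2},\qquad \sigma_2^2=\frac{(1-\theta-f_2)f_2\big(\theta f_2+f_1^2\big)}{\theta f_2^2+(1-\theta)f_1^2},$$ $$\rho=\left(\frac{(\theta-f_1)(1-\theta-f_2)f_1f_2}{(\theta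 f_2+f_1^2)\big((1-\theta)f_1+f_2^2\big)}\right)^{1/2},$$ with $\sigma_1,\sigma_2\ge 0$. Then, for all sufficiently large $n$, the Markov chain has a unique stationary distribution, the matrix $\Sigma=\begin{pmatrix}\sigma_1^2&\rho\sigma_1\sigma_2\\ \rho\sigma_1\sigma_2&\sigma_2^2\end{pmatrix}$ is positive definite, and for every fixed integer $k\ge0$ the following holds under the stationary distribution: $P(K=k)>0$ for all sufficiently large $n$, and, as $n\to\infty$, the conditional law given $K=k$ of $$\left(\frac{I_1-m_1}{\sqrt n},\ \frac{I_2-m_2}{\sqrt n}\right)$$ converges weakly to the bivariate normal law $N(0,\Sigma)$. -/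

import Mathlib

open MeasureTheory ProbabilityTheory Filter Topology

namespace NSystem

/-! ### The Markov chain of the N-system under FCFS-ALIS -/

/-- The two customer types. -/
inductive Cust
  | c1
  | c2

/-- The `n₁ + n₂` individual servers; `Sum.inl` is the flexible pool `s₁`, `Sum.inr` the pool `s₂`. -/
abbrev Server (n₁ n₂ : ℕ) : Type := Fin n₁ ⊕ Fin n₂

/-- An `s₁` server can serve both customer types, an `s₂` server only type `c₁`. -/
def compat {n₁ n₂ : ℕ} : Server n₁ n₂ → Cust → Bool
  | Sum.inl _, _ => true
  | Sum.inr _, Cust.c1 => true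
  | Sum.inr _, Cust.c2 => false

/-- A customer present in the system: either attached to the busy server that serves it (the type
of a customer in service plays no role any more), or waiting, with its type. -/
inductive Item (n₁ n₂ : ℕ)
  | busy (v : Server n₁ n₂)
  | waiting (c : Cust)

/-- A configuration: the customers present in order of arrival (oldest first), each waiting or
attached to its server, and the idle servers by increasing idle time (longest idle last). -/
structure Config (n₁ n₂ : ℕ) where
  customers : List (Item n₁ n₂)
  idle : List (Server n₁ n₂)

variable {n₁ n₂ : ℕ}

/-- The busy servers in a list of customers, in order. -/
def busyServers : List (Item n₁ n₂) → List (Server n₁ n₂)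
  | [] => []
  | Item.busy v :: l => v :: busyServers l
  | Item.waiting _ :: l => busyServers l

/-- The sequence `S₁, …, Sₙ` of servers: the busy ones in order of the arrivals of their customers,
then the idle ones by increasing idle time. -/
def Config.servers (s : Config n₁ n₂) : List (Server n₁ n₂) :=
  busyServers s.customers ++ s.idle

/-- `NoSkip x y`: if `x` is a waiting customer and `y` a server, then `y` cannot serve `x`. -/
def NoSkip : Item n₁ n₂ → Item n₁ n₂ → Prop
  | Item.waiting c, Item.busy v => compat v c = false
  | _, _ => True

/-- The configurations that are states of the system: `S₁, …, Sₙ` is a permutation of the servers,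
and every waiting customer has been skipped by (is incompatible with) all the servers that come
after it, busy or idle. -/
structure Config.Valid (s : Config n₁ n₂) : Prop where
  nodup : s.servers.Nodup
  mem_servers : ∀ v : Server n₁ n₂, v ∈ s.servers
  noSkip : (s.customers ++ s.idle.map Item.busy).Pairwise NoSkip

/-- The state space of the system. -/
def State (n₁ n₂ : ℕ) : Type := {s : Config n₁ n₂ // s.Valid}

instance : MeasurableSpace (State n₁ n₂) := ⊤

/-- Arrival of a customer of type `c`: it is assigned to the longest idle compatible server if
there is one (ALIS), and otherwise waits at the end of the line. -/
def Config.arrive (c : Cust) (s : Config n₁ n₂) : Config n₁ n₂ :=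
  match (s.idle.filter (fun v => compat v c)).getLast? with
  | some w => ⟨s.customers ++ [Item.busy w], s.idle.erase w⟩
  | none => ⟨s.customers ++ [Item.waiting c], s.idle⟩

/-- The customer attached to `v` leaves. -/
def removeBusy (v : Server n₁ n₂) : List (Item n₁ n₂) → List (Item n₁ n₂)
  | [] => []
  | Item.busy w :: l => if w = v then l else Item.busy w :: removeBusy v l
  | Item.waiting c :: l => Item.waiting c :: removeBusy v l

/-- Attach `v` to the longest waiting compatible customer; `none` if there is no such customer. -/
def takeFirst (v : Server n₁ n₂) : List (Item n₁ n₂) → Option (List (Item n₁ n₂))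
  | [] => none
  | Item.busy w :: l => (takeFirst v l).map (fun l' => Item.busy w :: l')
  | Item.waiting c :: l =>
      if compat v c then some (Item.busy v :: l)
      else (takeFirst v l).map (fun l' => Item.waiting c :: l')

/-- Service completion at the busy server `v`: its customer leaves, and `v` takes the longest
waiting compatible customer if there is one (FCFS), and otherwise becomes the most recently idle
server. -/
def Config.complete (v : Server n₁ n₂) (s : Config n₁ n₂) : Config n₁ n₂ :=
  match takeFirst v (removeBusy v s.customers) with
  | some l => ⟨l, s.idle⟩
  | none => ⟨removeBusy v s.customers, v :: s.idle⟩

/-- The service rate of a server. -/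
def serviceRate (mu₁ mu₂ : ℝ) : Server n₁ n₂ → ℝ
  | Sum.inl _ => mu₁
  | Sum.inr _ => mu₂

open scoped Classical in
/-- The transition rate from `s` to `s'` of the continuous-time Markov chain: Poisson arrivals of
rates `lam₁`, `lam₂`, and exponential services with server-dependent rates. No event leaves a
configuration unchanged, since each changes the number of customers. -/
noncomputable def rate (lam₁ lam₂ mu₁ mu₂ : ℝ) (s s' : Config n₁ n₂) : ENNReal :=
  (if s.arrive Cust.c1 = s' then ENNReal.ofReal lam₁ else 0)
    + (if s.arrive Cust.c2 = s' then ENNReal.ofReal lam₂ else 0)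
    + ∑ v : Server n₁ n₂, if v ∈ busyServers s.customers ∧ s.complete v = s'
        then ENNReal.ofReal (serviceRate mu₁ mu₂ v) else 0

open scoped Classical in
/-- The total rate out of `s`. -/
noncomputable def exitRate (lam₁ lam₂ mu₁ mu₂ : ℝ) (s : Config n₁ n₂) : ENNReal :=
  ENNReal.ofReal lam₁ + ENNReal.ofReal lam₂
    + ∑ v : Server n₁ n₂, if v ∈ busyServers s.customers
        then ENNReal.ofReal (serviceRate mu₁ mu₂ v) else 0

/-- A probability distribution on the state space is stationary for the chain, whose exit rates are
bounded, if it satisfies the global balance equations. -/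
def IsStationary (lam₁ lam₂ mu₁ mu₂ : ℝ) (p : PMF (State n₁ n₂)) : Prop :=
  ∀ s' : State n₁ n₂,
    ∑' s : State n₁ n₂, p s * rate lam₁ lam₂ mu₁ mu₂ s.1 s'.1
      = p s' * exitRate lam₁ lam₂ mu₁ mu₂ s'.1

/-- `I₁`: the number of idle servers of type `s₁`. -/
def State.I₁ (s : State n₁ n₂) : ℕ := s.1.idle.countP Sum.isLeft

/-- `I₂`: the number of idle servers of type `s₂`. -/
def State.I₂ (s : State n₁ n₂) : ℕ := s.1.idle.countP Sum.isRight

/-- `K`: the number of servers of type `s₂` that follow the last server of type `s₁` in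
`S₁, …, Sₙ`. -/
def State.K (s : State n₁ n₂) : ℕ := (s.1.servers.reverse.takeWhile Sum.isRight).length

/-- The law of `((I₁ - a₁)/√n, (I₂ - a₂)/√n)` under `p`, conditional on `K = k`
(the zero measure if `K = k` has probability zero). -/
noncomputable def scaledIdleLaw (p : PMF (State n₁ n₂)) (k n : ℕ) (a₁ a₂ : ℝ) :
    FiniteMeasure (EuclideanSpace ℝ (Fin 2)) :=
  ⟨(p.toMeasure[|{s | s.K = k}]).map
      (fun s => !₂[((s.I₁ : ℝ) - a₁) / √(n : ℝ), ((s.I₂ : ℝ) - a₂) / √(n : ℝ)]),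
    inferInstance⟩

/-! ### Fluid quantities; `x₁`, `x₂` are the pool sizes and `l` is the total arrival rate -/

/-- The positive solution `T` of `l = x₁ / (1/mu₁ + T) + x₂ / (1/mu₂ + T)`, for
`l < x₁ * mu₁ + x₂ * mu₂`: the fluid length of an idle period. -/
noncomputable def idleTime (x₁ x₂ l mu₁ mu₂ : ℝ) : ℝ :=
  ((x₁ + x₂) / l - 1 / mu₁ - 1 / mu₂
    + √(((x₁ + x₂) / l) ^ 2 - 2 * ((x₁ - x₂) / l) * (1 / mu₁ - 1 / mu₂)
        + (1 / mu₁ - 1 / mu₂) ^ 2)) / 2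

/-- The fluid number of idle servers of type `s₁`. -/
noncomputable def meanIdle₁ (x₁ x₂ l mu₁ mu₂ : ℝ) : ℝ :=
  idleTime x₁ x₂ l mu₁ mu₂ * x₁ / (idleTime x₁ x₂ l mu₁ mu₂ + 1 / mu₁)

/-- The fluid number of idle servers of type `s₂`. -/
noncomputable def meanIdle₂ (x₁ x₂ l mu₁ mu₂ : ℝ) : ℝ :=
  idleTime x₁ x₂ l mu₁ mu₂ * x₂ / (idleTime x₁ x₂ l mu₁ mu₂ + 1 / mu₂)

/-- The fluid fraction `β` of services performed by servers of type `s₁`. -/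
noncomputable def beta (x₁ x₂ l mu₁ mu₂ : ℝ) : ℝ :=
  x₁ / (l * idleTime x₁ x₂ l mu₁ mu₂ + l / mu₁)

/-! ### Parameters of the limit law -/

/-- Standard deviation of the first coordinate. -/
noncomputable def sigma₁ (θ f₁ f₂ : ℝ) : ℝ :=
  √((θ - f₁) * f₁ * ((1 - θ) * f₁ + f₂ ^ 2) / (θ * f₂ ^ 2 + (1 - θ) * f₁ ^ 2))

/-- Standard deviation of the second coordinate. -/
noncomputable def sigma₂ (θ f₁ f₂ : ℝ) : ℝ :=
  √((1 - θ - f₂) * f₂ * (θ * f₂ + f₁ ^ 2) / (θ * f₂ ^ 2 + (1 - θ) * f₁ ^ 2))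

/-- Correlation coefficient. -/
noncomputable def corr (θ f₁ f₂ : ℝ) : ℝ :=
  √((θ - f₁) * (1 - θ - f₂) * f₁ * f₂ / ((θ * f₂ + f₁ ^ 2) * ((1 - θ) * f₁ + f₂ ^ 2)))

/-- Covariance matrix of the limit law. -/
noncomputable def covMatrix (θ f₁ f₂ : ℝ) : Matrix (Fin 2) (Fin 2) ℝ :=
  !![sigma₁ θ f₁ f₂ ^ 2, corr θ f₁ f₂ * sigma₁ θ f₁ f₂ * sigma₂ θ f₁ f₂;
     corr θ f₁ f₂ * sigma₁ θ f₁ f₂ * sigma₂ θ f₁ f₂, sigma₂ θ f₁ f₂ ^ 2]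

/-- The centred bivariate normal law. -/
noncomputable def limitLaw (θ f₁ f₂ : ℝ) : FiniteMeasure (EuclideanSpace ℝ (Fin 2)) :=
  ⟨multivariateGaussian 0 (covMatrix θ f₁ f₂), inferInstance⟩

/-- Size `⌈θ n⌉` of the first pool. -/
noncomputable def pool₁ (θ : ℝ) (n : ℕ) : ℕ := ⌈θ * n⌉₊

/-- Size `n - ⌈θ n⌉` of the second pool. -/
noncomputable def pool₂ (θ : ℝ) (n : ℕ) : ℕ := n - pool₁ θ n

end NSystem

namespace NSystem

/-! The chain has an explicit invariant measure of product form, `weight`. Reading a configuration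
from the oldest customer on, a busy server contributes the inverse of the total service rate of the
servers read so far, itself included. A waiting customer of type `c` contributes `lam c` over the
service rate of the servers before it. An idle server contributes the inverse of the arrival rate of
the customers that it, or a longer idle server, can serve. Invariance (`weight_balance`) splits into
two partial balances: the flow into a state by arrivals equals the flow out of it by service
completions (`inflow_arrive`), and the flow in by completions equals the flow out by arrivals
(`inflow_complete`). Stability makes the total mass finite (`tsum_weight_ne_top`). Uniqueness holds
because the empty system can be reached from every state (`stationary_unique`, `reach_emptyState`).

If some `s₁` server is idle, nobody waits, and the orders of the busy servers sum to the product of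
their inverse rates (`tsum_busy_orders`). On `K = k` the idle list is then a word `l`, the last idle
`s₁` server, and `k` servers of type `s₂`; each letter of `l` has weight its service rate over the
total arrival rate. A set of `m` servers has `m! = ∫ e⁻ᵗ tᵐ dt` orders, so the generating function
of `(I₁, I₂)` is, up to a constant, `z₁ z₂ᵏ ∫ e^(-λu) (1 + u μ₁ z₁)^(n₁-1) (1 + u μ₂ z₂)^(n₂-k) du`
(`sum_idleIndex`). States without an idle `s₁` server add an error of relative size `O(1/n)`,
measured by `defect` (`exists_setIntegral_K`).

The rest is Laplace's method. At `z = 1` the full-power integrand, with exponents `n₁` and `n₂`,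
peaks at the fluid idle time `T`; the missing fixed powers do not matter in the limit. With `u = T +
v/√n` and `zⱼ = exp(i sⱼ/√n)`, the integrand divided by its value at `T` and by a phase converges to
the exponential of a quadratic form in `v` and `s`, and dominated convergence applies
(`tendsto_integral_scaledIntegrand`). Heuristically, given `u` the servers are idle independently, a
server of rate `μ` with probability `u/(u + 1/μ)`; the limiting covariance consists of the two
binomial variances and a rank-one term from the fluctuation of `u` (`covForm`). The integral has
order `n^(-1/2)` times a peak value bounded below, which dominates the `O(1/n)` error. Dividing by
the value at `s = 0` removes all normalizations, and the limit of the characteristic functions gives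
weak convergence. -/

theorem ENNReal_eq_of_le_of_tsum_le {S : Type*} {f g : S → ENNReal} (hfg : ∀ s, f s ≤ g s)
    (h : ∑' s, g s ≤ ∑' s, f s) (hf : ∑' s, f s ≠ ⊤) (s : S) : f s = g s := by
  by_contra hne
  have hlt : f s < g s := lt_of_le_of_ne (hfg s) hne
  exact absurd h (not_le.mpr (ENNReal.tsum_lt_tsum hf hfg hlt))

/-! ### Uniqueness for jump chains with bounded exit rates. -/

section Uniqueness

variable {S : Type*} {q : S → S → ENNReal} {e : S → ENNReal}

/-- The minimum of two invariant finite measures is invariant. -/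
theorem invariant_min (he : ∀ s, ∑' s', q s s' = e s) {C : ENNReal} (hC : C ≠ ⊤)
    (heC : ∀ s, e s ≤ C) {p p' : PMF S} (hp : ∀ s', ∑' s, p s * q s s' = p s' * e s')
    (hp' : ∀ s', ∑' s, p' s * q s s' = p' s' * e s') (s' : S) :
    ∑' s, min (p s) (p' s) * q s s' = min (p s') (p' s') * e s' := by
  -- The inflow of the minimum is at most the minimum of the two inflows. Both sides of this
  -- inequality have the same finite total `∑ min · e`, so it is an equality at every state.
  have hle : ∀ s', ∑' s, min (p s) (p' s) * q s s' ≤ min (p s') (p' s') * e s' := by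
    intro s'
    rw [min_mul_of_nonneg _ _ (zero_le)]
    refine le_min ?_ ?_
    · rw [← hp s']
      exact ENNReal.tsum_le_tsum fun s => mul_le_mul_left (min_le_left _ _) _
    · rw [← hp' s']
      exact ENNReal.tsum_le_tsum fun s => mul_le_mul_left (min_le_right _ _) _
  have hsum : ∑' s', ∑' s, min (p s) (p' s) * q s s' = ∑' s, min (p s) (p' s) * e s := by
    rw [ENNReal.tsum_comm]
    simp_rw [ENNReal.tsum_mul_left, he]
  refine ENNReal_eq_of_le_of_tsum_le hle hsum.ge ?_ s'
  rw [hsum]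
  refine ne_top_of_le_ne_top (b := C) hC ?_
  calc ∑' s, min (p s) (p' s) * e s ≤ ∑' s, p s * C :=
        ENNReal.tsum_le_tsum fun s => mul_le_mul' (min_le_left _ _) (heC s)
    _ = C := by rw [ENNReal.tsum_mul_right, p.tsum_coe, one_mul]

/-- The strict inequality travels along each edge `a → b` of positive rate. If it failed at `b`, the
minimum would agree with `p` there; by invariance of both, every inflow term into `b` would agree
too, in particular the one from `a`, where the minimum is strictly smaller than `p`. -/
theorem lt_of_reachable (he : ∀ s, ∑' s', q s s' = e s) {C : ENNReal} (hC : C ≠ ⊤)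
    (heC : ∀ s, e s ≤ C) {p p' : PMF S} (hp : ∀ s', ∑' s, p s * q s s' = p s' * e s')
    (hp' : ∀ s', ∑' s, p' s * q s s' = p' s' * e s') {s t : S}
    (hst : Relation.ReflTransGen (fun a b => q a b ≠ 0) s t) (hs : p' s < p s) : p' t < p t := by
  induction hst with
  | refl => exact hs
  | @tail a b _ hab ih =>
    by_contra! hba
    have hmb : min (p b) (p' b) = p b := min_eq_left hba
    have h1 := invariant_min he hC heC hp hp' b
    rw [hmb, ← hp b] at h1
    have hfin : ∑' s, min (p s) (p' s) * q s b ≠ ⊤ := by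
      rw [h1, hp b]
      exact ENNReal.mul_ne_top (p.apply_ne_top b) (ne_top_of_le_ne_top hC (heC b))
    have h2 := ENNReal_eq_of_le_of_tsum_le
      (fun s => mul_le_mul_left (min_le_left (p s) (p' s)) (q s b)) h1.ge hfin a
    rw [min_eq_right ih.le] at h2
    have hqa : q a b ≠ ⊤ := ne_top_of_le_ne_top (ne_top_of_le_ne_top hC (heC a))
      (he a ▸ ENNReal.le_tsum b)
    exact ih.ne ((ENNReal.mul_left_inj hab hqa).mp h2)

/-- A jump chain with bounded exit rates, in which some state can be reached from everywhere, has
at most one stationary distribution. -/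
theorem stationary_unique (he : ∀ s, ∑' s', q s s' = e s) {C : ENNReal} (hC : C ≠ ⊤)
    (heC : ∀ s, e s ≤ C) (t : S)
    (ht : ∀ s, Relation.ReflTransGen (fun a b => q a b ≠ 0) s t) {p p' : PMF S}
    (hp : ∀ s', ∑' s, p s * q s s' = p s' * e s')
    (hp' : ∀ s', ∑' s, p' s * q s s' = p' s' * e s') : p = p' := by
  have key : ∀ {p p' : PMF S}, (∀ s, p s ≤ p' s) → p = p' := fun {p p'} h =>
    PMF.ext fun s => ENNReal_eq_of_le_of_tsum_le h (by simp [PMF.tsum_coe])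
      (by simp [PMF.tsum_coe]) s
  by_cases h : ∀ s, p s ≤ p' s
  · exact key h
  by_cases h' : ∀ s, p' s ≤ p s
  · exact (key h').symm
  -- Neither distribution dominates the other, so each is strictly larger somewhere; both strict
  -- inequalities propagate to `t`, where they contradict each other.
  push Not at h h'
  obtain ⟨s, hs⟩ := h
  obtain ⟨s', hs'⟩ := h'
  exact absurd (lt_of_reachable he hC heC hp hp' (ht s) hs)
    (lt_of_reachable he hC heC hp' hp (ht s') hs').le.not_gt

end Uniqueness

end NSystem
namespace NSystem

variable {n₁ n₂ : ℕ}

/-- Erasing a server from the idle list in `Config.arrive` uses Boolean equality, and the lemmas on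
`List.erase` need it to be lawful. -/
instance : LawfulBEq (Server n₁ n₂) where
  eq_of_beq := by
    rintro (a | a) (b | b) h
    · exact congrArg Sum.inl (beq_iff_eq.mp (show (a == b) = true from h))
    · cases h
    · cases h
    · exact congrArg Sum.inr (beq_iff_eq.mp (show (a == b) = true from h))
  rfl := by
    rintro (a | a)
    · exact show (a == a) = true from beq_self_eq_true a
    · exact show (a == a) = true from beq_self_eq_true a

/-! ### Valid configurations and their transitions -/

@[simp] theorem busyServers_append (X X' : List (Item n₁ n₂)) :
    busyServers (X ++ X') = busyServers X ++ busyServers X' := by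
  induction X with
  | nil => rfl
  | cons x X ih => cases x <;> simp [busyServers, ih]

@[simp] theorem busyServers_map_busy (Y : List (Server n₁ n₂)) :
    busyServers (Y.map Item.busy) = Y := by
  induction Y with
  | nil => rfl
  | cons y Y ih => simp [busyServers, ih]

theorem mem_busyServers {v : Server n₁ n₂} {X : List (Item n₁ n₂)} :
    v ∈ busyServers X ↔ Item.busy v ∈ X := by
  induction X with
  | nil => simp [busyServers]
  | cons x X ih => cases x <;> simp [busyServers, ih]

@[simp] theorem busyServers_busy_cons (v : Server n₁ n₂) (X : List (Item n₁ n₂)) :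
    busyServers (Item.busy v :: X) = v :: busyServers X := rfl

@[simp] theorem busyServers_waiting_cons (c : Cust) (X : List (Item n₁ n₂)) :
    busyServers (Item.waiting c :: X) = busyServers X := rfl

@[simp] theorem busyServers_nil : busyServers ([] : List (Item n₁ n₂)) = [] := rfl

@[simp] theorem noSkip_waiting_right (x : Item n₁ n₂) (c : Cust) :
    NoSkip x (Item.waiting c) ↔ True := by
  cases x <;> simp [NoSkip]

@[simp] theorem noSkip_busy_left (v : Server n₁ n₂) (x : Item n₁ n₂) :
    NoSkip (Item.busy v) x ↔ True := by
  simp [NoSkip]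

@[simp] theorem noSkip_waiting_busy (c : Cust) (v : Server n₁ n₂) :
    NoSkip (Item.waiting c) (Item.busy v) ↔ compat v c = false := by
  simp [NoSkip]

theorem forall_item {P : Item n₁ n₂ → Prop} :
    (∀ x, P x) ↔ (∀ v, P (Item.busy v)) ∧ ∀ c, P (Item.waiting c) :=
  ⟨fun h => ⟨fun _ => h _, fun _ => h _⟩, fun h x => by cases x; exacts [h.1 _, h.2 _]⟩

theorem forall_noSkip_busy_iff {X : List (Item n₁ n₂)} {v : Server n₁ n₂} :
    (∀ x ∈ X, NoSkip x (Item.busy v)) ↔ ∀ c, Item.waiting c ∈ X → compat v c = false := by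
  simp [forall_item (P := fun x => x ∈ X → _)]

theorem forall_waiting_noSkip_iff {X : List (Item n₁ n₂)} {c : Cust} :
    (∀ x ∈ X, NoSkip (Item.waiting c) x) ↔ ∀ v, Item.busy v ∈ X → compat v c = false := by
  simp only [forall_item (P := fun x => x ∈ X → _)]
  simp

theorem forall_noSkip_iff {X X' : List (Item n₁ n₂)} :
    (∀ x ∈ X, ∀ x' ∈ X', NoSkip x x') ↔
      ∀ c, Item.waiting c ∈ X → ∀ v, Item.busy v ∈ X' → compat v c = false := by
  simp only [forall_item (P := fun x => x ∈ X → _), forall_item (P := fun x => x ∈ X' → _)]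
  simp

/-- Idle servers impose nothing on each other, so the pairwise condition splits into one among the
customers and one between waiting customers and idle servers. This is the form in which validity is
used. -/
theorem valid_iff (s : Config n₁ n₂) :
    s.Valid ↔ s.servers.Nodup ∧ (∀ v, v ∈ s.servers) ∧ s.customers.Pairwise NoSkip ∧
      ∀ c, Item.waiting c ∈ s.customers → ∀ v ∈ s.idle, compat v c = false := by
  have key : (s.customers ++ s.idle.map Item.busy).Pairwise NoSkip ↔
      s.customers.Pairwise NoSkip ∧
      ∀ c, Item.waiting c ∈ s.customers → ∀ v ∈ s.idle, compat v c = false := by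
    rw [List.pairwise_append]
    have h1 : (s.idle.map Item.busy).Pairwise NoSkip := by
      rw [List.pairwise_map]
      exact List.pairwise_of_forall (by simp)
    simp only [h1, true_and, List.mem_map, forall_exists_index, and_imp,
      forall_apply_eq_imp_iff₂, forall_item (P := fun x => x ∈ s.customers → _)]
    simp
  constructor
  · rintro ⟨h1, h2, h3⟩
    exact ⟨h1, h2, key.1 h3⟩
  · rintro ⟨h1, h2, h3⟩
    exact ⟨h1, h2, key.2 h3⟩

/-- Moving the idle server `v` to the end of the line. -/
theorem valid_arrive_busy_iff (X : List (Item n₁ n₂)) (A B : List (Server n₁ n₂))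
    (v : Server n₁ n₂) :
    (⟨X ++ [Item.busy v], A ++ B⟩ : Config n₁ n₂).Valid ↔
      (⟨X, A ++ v :: B⟩ : Config n₁ n₂).Valid := by
  have hp : (busyServers X ++ [v] ++ (A ++ B)).Perm (busyServers X ++ (A ++ v :: B)) := by
    simpa using (List.perm_middle (a := v) (l₁ := A) (l₂ := B)).symm.append_left (busyServers X)
  simp only [valid_iff, Config.servers, busyServers_append, busyServers_busy_cons,
    busyServers_nil, hp.nodup_iff, hp.mem_iff]
  simp only [List.pairwise_append, List.mem_append, List.mem_cons,
    forall_item (P := fun x => x ∈ X → _)]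
  simp
  grind

theorem valid_arrive_waiting_iff (X : List (Item n₁ n₂)) (Y : List (Server n₁ n₂)) (c : Cust) :
    (⟨X ++ [Item.waiting c], Y⟩ : Config n₁ n₂).Valid ↔
      (⟨X, Y⟩ : Config n₁ n₂).Valid ∧ ∀ v ∈ Y, compat v c = false := by
  simp only [valid_iff, Config.servers, busyServers_append, busyServers_waiting_cons,
    busyServers_nil, List.append_nil]
  simp only [List.pairwise_append, List.mem_append, List.mem_cons,
    forall_item (P := fun x => x ∈ X → _)]
  simp
  grind

/-- Stated as an equivalence because both directions matter: one shows that transitions preserve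
validity, the other that the predecessors listed in the balance equations are states. -/
theorem valid_complete_idle_iff (A B : List (Item n₁ n₂)) (Y : List (Server n₁ n₂))
    (v : Server n₁ n₂) :
    (⟨A ++ B, v :: Y⟩ : Config n₁ n₂).Valid ↔
      (⟨A ++ Item.busy v :: B, Y⟩ : Config n₁ n₂).Valid ∧
        ∀ c, Item.waiting c ∈ B → compat v c = false := by
  have hp : (busyServers A ++ busyServers B ++ v :: Y).Perm
      (busyServers A ++ v :: busyServers B ++ Y) := by
    simpa using (List.perm_middle (a := v) (l₁ := busyServers B) (l₂ := Y)).append_left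
      (busyServers A)
  simp only [valid_iff, Config.servers, busyServers_append, busyServers_busy_cons,
    hp.nodup_iff, hp.mem_iff]
  simp only [List.pairwise_append, List.mem_append, List.mem_cons, List.pairwise_cons,
    forall_item (P := fun x => x ∈ A → _)]
  simp
  grind

/-- The two side conditions mirror each other. Before the completion, `c` waits in front of `B₂` and
the idle servers, so none of them can serve it. After it, `v` stands behind `B₁`, so `v` can serve
nobody who waits there. -/
theorem valid_complete_take_iff (A B₁ B₂ : List (Item n₁ n₂)) (Y : List (Server n₁ n₂))
    (v : Server n₁ n₂) (c : Cust) :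
    ((⟨A ++ B₁ ++ Item.busy v :: B₂, Y⟩ : Config n₁ n₂).Valid ∧
        ∀ w ∈ busyServers B₂ ++ Y, compat w c = false) ↔
      (⟨A ++ Item.busy v :: (B₁ ++ Item.waiting c :: B₂), Y⟩ : Config n₁ n₂).Valid ∧
        ∀ c, Item.waiting c ∈ B₁ → compat v c = false := by
  have hp : (busyServers A ++ busyServers B₁ ++ v :: busyServers B₂ ++ Y).Perm
      (busyServers A ++ v :: (busyServers B₁ ++ busyServers B₂) ++ Y) := by
    simpa using (List.perm_middle (a := v) (l₁ := busyServers B₁)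
      (l₂ := busyServers B₂ ++ Y)).append_left (busyServers A)
  simp only [valid_iff, Config.servers, busyServers_append, busyServers_busy_cons,
    busyServers_waiting_cons, hp.nodup_iff, hp.mem_iff]
  simp only [List.pairwise_append, List.mem_append, List.mem_cons, List.pairwise_cons,
    mem_busyServers]
  generalize (busyServers A ++ v :: (busyServers B₁ ++ busyServers B₂) ++ Y).Nodup = P₁
  generalize (∀ w, w ∈ busyServers A ++ v :: (busyServers B₁ ++ busyServers B₂) ++ Y) = P₂
  clear hp
  simp only [or_imp, forall_and, forall_eq, noSkip_busy_left, noSkip_waiting_right,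
    implies_true, true_and, Item.waiting.injEq, reduceCtorEq, false_imp_iff,
    forall_noSkip_busy_iff, forall_noSkip_iff, forall_waiting_noSkip_iff]
  tauto

theorem Config.Valid.busy_notMem {A B : List (Item n₁ n₂)} {Y : List (Server n₁ n₂)}
    {v : Server n₁ n₂} (h : (⟨A ++ Item.busy v :: B, Y⟩ : Config n₁ n₂).Valid) :
    Item.busy v ∉ A ∧ Item.busy v ∉ B ∧ v ∉ Y := by
  have := h.nodup
  simp only [Config.servers, busyServers_append, busyServers_busy_cons, ← mem_busyServers] at this ⊢
  grind

theorem removeBusy_eq {v : Server n₁ n₂} {A : List (Item n₁ n₂)} (hA : Item.busy v ∉ A)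
    (B : List (Item n₁ n₂)) : removeBusy v (A ++ Item.busy v :: B) = A ++ B := by
  induction A with
  | nil => simp [removeBusy]
  | cons x A ih =>
    cases x with
    | busy w =>
      simp only [List.mem_cons, not_or, Item.busy.injEq] at hA
      simp [removeBusy, ih hA.2, Ne.symm hA.1]
    | waiting c =>
      simp only [List.mem_cons, not_or] at hA
      simp [removeBusy, ih hA.2]

theorem takeFirst_append {v : Server n₁ n₂} {A : List (Item n₁ n₂)}
    (hA : ∀ c, Item.waiting c ∈ A → compat v c = false) (B : List (Item n₁ n₂)) :
    takeFirst v (A ++ B) = (takeFirst v B).map (A ++ ·) := by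
  induction A with
  | nil => simp
  | cons x A ih =>
    have ih' := ih fun c hc => hA c (List.mem_cons_of_mem _ hc)
    cases x with
    | busy w => simp [takeFirst, ih', Function.comp_def]
    | waiting c =>
      simp [takeFirst, ih', hA c (by simp), Function.comp_def]

theorem takeFirst_eq_none {v : Server n₁ n₂} {A : List (Item n₁ n₂)}
    (hA : ∀ c, Item.waiting c ∈ A → compat v c = false) : takeFirst v A = none := by
  simpa [takeFirst] using takeFirst_append hA []

/-- A list of customers either contains nobody that `v` can serve, or a first such customer. -/
theorem exists_first_compat (v : Server n₁ n₂) (B : List (Item n₁ n₂)) :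
    (∀ c, Item.waiting c ∈ B → compat v c = false) ∨
      ∃ B₁ c B₂, B = B₁ ++ Item.waiting c :: B₂ ∧ compat v c = true ∧
        ∀ c, Item.waiting c ∈ B₁ → compat v c = false := by
  induction B with
  | nil => simp
  | cons x B ih =>
    by_cases hx : ∃ c, x = Item.waiting c ∧ compat v c = true
    · obtain ⟨c, rfl, hc⟩ := hx
      exact Or.inr ⟨[], c, B, rfl, hc, by simp⟩
    · push Not at hx
      rcases ih with h | ⟨B₁, c, B₂, rfl, hc, h⟩
      · left
        intro c hc
        rcases List.mem_cons.mp hc with rfl | hc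
        · simpa using hx c rfl
        · exact h c hc
      · refine Or.inr ⟨x :: B₁, c, B₂, rfl, hc, ?_⟩
        intro c hc
        rcases List.mem_cons.mp hc with rfl | hc
        · simpa using hx c rfl
        · exact h c hc

theorem complete_idle {A B : List (Item n₁ n₂)} {Y : List (Server n₁ n₂)} {v : Server n₁ n₂}
    (h : (⟨A ++ Item.busy v :: B, Y⟩ : Config n₁ n₂).Valid)
    (hB : ∀ c, Item.waiting c ∈ B → compat v c = false) :
    (⟨A ++ Item.busy v :: B, Y⟩ : Config n₁ n₂).complete v = ⟨A ++ B, v :: Y⟩ := by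
  -- A customer waiting in front of `v` is incompatible with `v` by validity; only those behind `v`
  -- need the hypothesis.
  have hAB : ∀ c, Item.waiting c ∈ A ++ B → compat v c = false := by
    have := (List.pairwise_append.mp ((valid_iff _).mp h).2.2.1).2.2
    intro c hc
    rcases List.mem_append.mp hc with hc | hc
    · simpa using this _ hc (Item.busy v) (by simp)
    · exact hB c hc
  simp [Config.complete, removeBusy_eq h.busy_notMem.1, takeFirst_eq_none hAB]

theorem complete_take {A B₁ B₂ : List (Item n₁ n₂)} {Y : List (Server n₁ n₂)} {v : Server n₁ n₂}
    {c : Cust} (h : (⟨A ++ Item.busy v :: (B₁ ++ Item.waiting c :: B₂), Y⟩ : Config n₁ n₂).Valid)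
    (hc : compat v c = true) (hB : ∀ c, Item.waiting c ∈ B₁ → compat v c = false) :
    (⟨A ++ Item.busy v :: (B₁ ++ Item.waiting c :: B₂), Y⟩ : Config n₁ n₂).complete v =
      ⟨A ++ B₁ ++ Item.busy v :: B₂, Y⟩ := by
  have hAB : ∀ c, Item.waiting c ∈ A ++ B₁ → compat v c = false := by
    have := (List.pairwise_append.mp ((valid_iff _).mp h).2.2.1).2.2
    intro c hc
    rcases List.mem_append.mp hc with hc | hc
    · simpa using this _ hc (Item.busy v) (by simp)
    · exact hB c hc
  simp [Config.complete, removeBusy_eq h.busy_notMem.1, ← List.append_assoc,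
    takeFirst_append hAB, takeFirst, hc]

theorem arrive_busy {X : List (Item n₁ n₂)} {A B : List (Server n₁ n₂)} {v : Server n₁ n₂}
    {c : Cust} (h : (⟨X, A ++ v :: B⟩ : Config n₁ n₂).Valid) (hv : compat v c = true)
    (hB : ∀ w ∈ B, compat w c = false) :
    (⟨X, A ++ v :: B⟩ : Config n₁ n₂).arrive c = ⟨X ++ [Item.busy v], A ++ B⟩ := by
  have hB' : B.filter (fun v => compat v c) = [] := by simpa using hB
  have hA : v ∉ A := by
    have := h.nodup
    simp only [Config.servers] at this
    grind
  simp [Config.arrive, hv, hB', List.erase_append_right _ hA]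

theorem arrive_waiting {X : List (Item n₁ n₂)} {Y : List (Server n₁ n₂)}
    {c : Cust} (hY : ∀ w ∈ Y, compat w c = false) :
    (⟨X, Y⟩ : Config n₁ n₂).arrive c = ⟨X ++ [Item.waiting c], Y⟩ := by
  have hY' : Y.filter (fun v => compat v c) = [] := by simpa using hY
  simp [Config.arrive, hY']

theorem exists_last_compat (c : Cust) (Y : List (Server n₁ n₂)) :
    (∀ w ∈ Y, compat w c = false) ∨
      ∃ A v B, Y = A ++ v :: B ∧ compat v c = true ∧ ∀ w ∈ B, compat w c = false := by
  induction Y with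
  | nil => simp
  | cons y Y ih =>
    rcases ih with h | ⟨A, v, B, rfl, hv, hB⟩
    · cases hy : compat y c
      · left; simpa [hy] using h
      · exact Or.inr ⟨[], y, Y, rfl, hy, h⟩
    · exact Or.inr ⟨y :: A, v, B, rfl, hv, hB⟩

theorem Config.Valid.arrive {s : Config n₁ n₂} (hs : s.Valid) (c : Cust) : (s.arrive c).Valid := by
  obtain ⟨X, Y⟩ := s
  rcases exists_last_compat c Y with h | ⟨A, v, B, rfl, hv, hB⟩
  · rw [arrive_waiting h]
    exact (valid_arrive_waiting_iff _ _ _).mpr ⟨hs, h⟩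
  · rw [arrive_busy hs hv hB]
    exact (valid_arrive_busy_iff _ _ _ _).mpr hs

theorem Config.Valid.complete {s : Config n₁ n₂} (hs : s.Valid) {v : Server n₁ n₂}
    (hv : v ∈ busyServers s.customers) : (s.complete v).Valid := by
  obtain ⟨X, Y⟩ := s
  obtain ⟨A, B, rfl⟩ := List.append_of_mem (mem_busyServers.mp hv)
  rcases exists_first_compat v B with h | ⟨B₁, c, B₂, rfl, hc, hB⟩
  · rw [complete_idle hs h]
    exact (valid_complete_idle_iff _ _ _ _).mpr ⟨hs, h⟩
  · rw [complete_take hs hc hB]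
    exact ((valid_complete_take_iff _ _ _ _ _ c).mpr ⟨hs, hB⟩).1

end NSystem
namespace NSystem

/-! ### Insertions into a list -/

/-- All the ways of inserting `a` into a list. -/
def inserts {α : Type*} (a : α) : List α → List (List α)
  | [] => [[a]]
  | x :: l => (a :: x :: l) :: (inserts a l).map (x :: ·)

theorem mem_inserts {α : Type*} {a : α} {l m : List α} :
    m ∈ inserts a l ↔ ∃ A B, l = A ++ B ∧ m = A ++ a :: B := by
  induction l generalizing m with
  | nil =>
    simp only [inserts, List.mem_singleton]
    constructor
    · rintro rfl; exact ⟨[], [], rfl, rfl⟩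
    · rintro ⟨A, B, h, rfl⟩
      obtain ⟨rfl, rfl⟩ := List.append_eq_nil_iff.mp h.symm
      rfl
  | cons x l ih =>
    simp only [inserts, List.mem_cons, List.mem_map, ih]
    constructor
    · rintro (rfl | ⟨_, ⟨A, B, rfl, rfl⟩, rfl⟩)
      · exact ⟨[], _, rfl, rfl⟩
      · exact ⟨x :: A, B, rfl, rfl⟩
    · rintro ⟨A, B, h, rfl⟩
      cases A with
      | nil =>
        rw [List.nil_append] at h
        exact Or.inl (by rw [h]; rfl)
      | cons y A =>
        obtain ⟨rfl, rfl⟩ := List.cons_eq_cons.mp h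
        exact Or.inr ⟨_, ⟨A, B, rfl, rfl⟩, rfl⟩

theorem nodup_inserts {α : Type*} {a : α} {l : List α} (h : a ∉ l) : (inserts a l).Nodup := by
  induction l with
  | nil => simp [inserts]
  | cons x l ih =>
    simp only [List.mem_cons, not_or] at h
    simp only [inserts, List.nodup_cons]
    refine ⟨?_, (ih h.2).map fun _ _ h => (List.cons_eq_cons.mp h).2⟩
    simp only [List.mem_map, not_exists, not_and]
    intro m _ hm
    exact h.1 (List.cons_eq_cons.mp hm).1.symm

/-! ### The product form -/

variable {n₁ n₂ : ℕ} (lam : Cust → ℝ) (mu : Server n₁ n₂ → ℝ)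

open scoped Classical in
/-- The arrival rate of the customers that `v` can serve, but no server of `Y`. -/
noncomputable def newRate (v : Server n₁ n₂) (Y : List (Server n₁ n₂)) : ℝ :=
  (if compat v Cust.c1 = true ∧ ∀ w ∈ Y, compat w Cust.c1 = false then lam Cust.c1 else 0)
    + (if compat v Cust.c2 = true ∧ ∀ w ∈ Y, compat w Cust.c2 = false then lam Cust.c2 else 0)

open scoped Classical in
/-- The arrival rate of the customers that some server of `Y` can serve. -/
noncomputable def pooledRate (Y : List (Server n₁ n₂)) : ℝ :=
  (if ∀ w ∈ Y, compat w Cust.c1 = false then 0 else lam Cust.c1)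
    + (if ∀ w ∈ Y, compat w Cust.c2 = false then 0 else lam Cust.c2)

/-- The factor of the idle servers in the product form. -/
noncomputable def idleWeight : List (Server n₁ n₂) → ℝ
  | [] => 1
  | y :: Y => idleWeight Y / pooledRate lam (y :: Y)

/-- The factor of the customers in the product form, when servers of total rate `M` precede. -/
noncomputable def custWeight : ℝ → List (Item n₁ n₂) → ℝ
  | _, [] => 1
  | M, Item.busy v :: X => custWeight (M + mu v) X / (M + mu v)
  | M, Item.waiting c :: X => lam c / M * custWeight M X

/-- The product-form weight of a configuration. -/
noncomputable def weight (s : Config n₁ n₂) : ℝ :=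
  custWeight lam mu 0 s.customers * idleWeight lam s.idle

/-- The total service rate of the busy servers. -/
noncomputable def busyRate (X : List (Item n₁ n₂)) : ℝ := ((busyServers X).map mu).sum

variable {lam mu}

theorem pooledRate_cons (v : Server n₁ n₂) (Y : List (Server n₁ n₂)) :
    pooledRate lam (v :: Y) = newRate lam v Y + pooledRate lam Y := by
  have key : ∀ (b : Bool) (P : Prop) [Decidable P] (x : ℝ), (if b = false ∧ P then 0 else x) =
      (if b = true ∧ P then x else 0) + if P then 0 else x := by
    intro b P _ x
    cases b <;> by_cases hP : P <;> simp [hP]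
  simp only [pooledRate, newRate, List.forall_mem_cons, key]
  ring

theorem pooledRate_congr {Y Y' : List (Server n₁ n₂)} (h : ∀ v, v ∈ Y ↔ v ∈ Y') :
    pooledRate lam Y = pooledRate lam Y' := by
  simp only [pooledRate, h]

@[simp] theorem pooledRate_nil : pooledRate lam ([] : List (Server n₁ n₂)) = 0 := by
  simp [pooledRate]

theorem compat_c1 (v : Server n₁ n₂) : compat v Cust.c1 = true := by
  cases v <;> rfl

theorem pooledRate_cons_pos (hlam : ∀ c, 0 < lam c) (v : Server n₁ n₂)
    (Y : List (Server n₁ n₂)) : 0 < pooledRate lam (v :: Y) := by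
  have h1 := hlam Cust.c1
  have h2 := (hlam Cust.c2).le
  simp only [pooledRate, List.forall_mem_cons, compat_c1, Bool.true_eq_false, false_and, if_false]
  refine add_pos_of_pos_of_nonneg h1 ?_
  split_ifs
  exacts [le_rfl, h2]

theorem idleWeight_pos (hlam : ∀ c, 0 < lam c) (Y : List (Server n₁ n₂)) :
    0 < idleWeight lam Y := by
  induction Y with
  | nil => simp [idleWeight]
  | cons y Y ih => exact div_pos ih (pooledRate_cons_pos hlam y Y)

/-- `v` is the last server in `Y` that can serve `c`. -/
def LastCompat (c : Cust) (v : Server n₁ n₂) (Y : List (Server n₁ n₂)) : Prop :=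
  ∃ A B, Y = A ++ v :: B ∧ compat v c = true ∧ ∀ w ∈ B, compat w c = false

theorem lastCompat_cons_self {c : Cust} {v : Server n₁ n₂} {Y : List (Server n₁ n₂)}
    (hv : v ∉ Y) : LastCompat c v (v :: Y) ↔ compat v c = true ∧ ∀ w ∈ Y, compat w c = false := by
  constructor
  · rintro ⟨A, B, h, h1, h2⟩
    cases A with
    | nil => obtain ⟨-, rfl⟩ := List.cons_eq_cons.mp h; exact ⟨h1, h2⟩
    | cons a A =>
      obtain ⟨-, rfl⟩ := List.cons_eq_cons.mp h
      simp at hv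
  · rintro ⟨h1, h2⟩
    exact ⟨[], Y, rfl, h1, h2⟩

theorem lastCompat_cons {c : Cust} {v y : Server n₁ n₂} {Y : List (Server n₁ n₂)}
    (hy : v ≠ y) : LastCompat c v (y :: Y) ↔ LastCompat c v Y := by
  constructor
  · rintro ⟨A, B, h, h1, h2⟩
    cases A with
    | nil => exact absurd (List.cons_eq_cons.mp h).1.symm hy
    | cons a A =>
      obtain ⟨-, rfl⟩ := List.cons_eq_cons.mp h
      exact ⟨A, B, rfl, h1, h2⟩
  · rintro ⟨A, B, rfl, h1, h2⟩
    exact ⟨y :: A, B, rfl, h1, h2⟩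

open scoped Classical in
/-- The weight of all ways to insert `v` into `Y` so that it is the next server to take `c`. -/
noncomputable def insertWeight (lam : Cust → ℝ) (c : Cust) (v : Server n₁ n₂)
    (Y : List (Server n₁ n₂)) : ℝ :=
  ((inserts v Y).map fun Y' => if LastCompat c v Y' then idleWeight lam Y' else 0).sum

open scoped Classical in
-- Either `v` goes in front of `y`, and is chosen only if nobody in the list can serve `c`; or it
-- goes somewhere behind `y`, and then being chosen does not depend on `y`.
theorem insertWeight_cons (c : Cust) {v y : Server n₁ n₂} {Y : List (Server n₁ n₂)}
    (hv : v ∉ y :: Y) :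
    insertWeight lam c v (y :: Y) =
      (if compat v c = true ∧ ∀ w ∈ y :: Y, compat w c = false then
        idleWeight lam (v :: y :: Y) else 0)
      + insertWeight lam c v Y / pooledRate lam (v :: y :: Y) := by
  have hne : v ≠ y := fun h => hv (h ▸ List.mem_cons_self)
  simp only [insertWeight, inserts, List.map_cons, List.sum_cons, lastCompat_cons_self hv,
    List.map_map, Function.comp_def, lastCompat_cons hne, div_eq_mul_inv]
  rw [← List.sum_map_mul_right]
  congr 2
  refine List.map_congr_left fun Y' hY' => ?_
  obtain ⟨A, B, rfl, rfl⟩ := mem_inserts.mp hY'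
  rw [ite_mul, zero_mul, idleWeight, div_eq_mul_inv]
  congr 3
  -- The pooled rate depends only on the set of servers, hence not on where `v` was inserted.
  apply pooledRate_congr
  intro w
  simp
  tauto

/-- The arrivals that send a customer to `v` balance. -/
theorem sum_insertWeight (hlam : ∀ c, 0 < lam c) {v : Server n₁ n₂} {Y : List (Server n₁ n₂)}
    (hv : v ∉ Y) :
    lam Cust.c1 * insertWeight lam Cust.c1 v Y + lam Cust.c2 * insertWeight lam Cust.c2 v Y
      = idleWeight lam Y := by
  induction Y with
  | nil =>
    have h := pooledRate_cons_pos hlam v []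
    have hp : pooledRate lam [v] = newRate lam v [] := by simp [pooledRate_cons]
    have : ∀ c, insertWeight lam c v [] =
        if compat v c = true then 1 / pooledRate lam [v] else 0 := by
      intro c
      simp [insertWeight, inserts, lastCompat_cons_self, idleWeight]
    rw [this, this, idleWeight, mul_ite, mul_ite]
    have h2 : newRate lam v [] = (if compat v Cust.c1 = true then lam Cust.c1 else 0)
        + (if compat v Cust.c2 = true then lam Cust.c2 else 0) := by simp [newRate]
    rw [hp] at h ⊢
    generalize newRate lam v [] = N at *
    refine Eq.trans ?_ ((congrArg (· / N) h2.symm).trans (div_self h.ne'))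
    split_ifs <;> ring
  | cons y Y ih =>
    have ih := ih fun h => hv (List.mem_cons_of_mem _ h)
    rw [insertWeight_cons _ hv, insertWeight_cons _ hv]
    have h := pooledRate_cons_pos hlam v (y :: Y)
    have h' := pooledRate_cons_pos hlam y Y
    have hc := pooledRate_cons (lam := lam) v (y :: Y)
    -- This is `pooledRate_cons` multiplied by the weight. The `newRate` part accounts for `v` in
    -- front of `y`, the remaining part for the insertions behind `y`.
    have key : idleWeight lam (y :: Y) =
        newRate lam v (y :: Y) * idleWeight lam (v :: y :: Y)
        + idleWeight lam Y / pooledRate lam (v :: y :: Y) := by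
      simp only [idleWeight]
      rw [eq_sub_of_add_eq hc.symm]
      field_simp
      ring
    rw [key, ← ih, newRate]
    split_ifs <;> ring

/-! ### Insertion identities for the customer factor. -/

section Customers

theorem busyRate_append (A B : List (Item n₁ n₂)) :
    busyRate mu (A ++ B) = busyRate mu A + busyRate mu B := by
  simp [busyRate]

@[simp] theorem busyRate_nil : busyRate mu ([] : List (Item n₁ n₂)) = 0 := rfl

@[simp] theorem busyRate_busy_cons (v : Server n₁ n₂) (X : List (Item n₁ n₂)) :
    busyRate mu (Item.busy v :: X) = mu v + busyRate mu X := by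
  simp [busyRate]

@[simp] theorem busyRate_waiting_cons (c : Cust) (X : List (Item n₁ n₂)) :
    busyRate mu (Item.waiting c :: X) = busyRate mu X := by
  simp [busyRate]

theorem custWeight_append (M : ℝ) (A B : List (Item n₁ n₂)) :
    custWeight lam mu M (A ++ B) = custWeight lam mu M A *
      custWeight lam mu (M + busyRate mu A) B := by
  induction A generalizing M with
  | nil => simp [custWeight]
  | cons x A ih =>
    cases x with
    | busy v =>
      simp only [List.cons_append, custWeight, ih, busyRate_busy_cons, add_assoc]
      ring
    | waiting c =>
      simp only [List.cons_append, custWeight, ih, busyRate_waiting_cons]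
      ring

/-- Induction on `X` with the preceding rate `M` free: inserting `v` raises all later partial sums
by `mu v`, and the second term is the remainder, which vanishes at `M = 0`. A leading waiting
customer must be excluded at `M = 0`, since its factor `lam c / 0` is zero by convention and the
identity would fail. -/
theorem sum_custWeight_inserts (hmu : ∀ v, 0 < mu v) (v : Server n₁ n₂) (X : List (Item n₁ n₂))
    {M : ℝ} (hM : 0 ≤ M) (hX : M = 0 → ∀ c X', X ≠ Item.waiting c :: X') :
    mu v * ((inserts (Item.busy v) X).map (custWeight lam mu M)).sum
      + M / (M + mu v) * custWeight lam mu (M + mu v) X = custWeight lam mu M X := by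
  have hv := hmu v
  induction X generalizing M with
  | nil =>
    simp only [inserts, List.map_cons, List.map_nil, List.sum_cons, List.sum_nil, custWeight]
    field_simp
    ring
  | cons x X ih =>
    cases x with
    | busy u =>
      have hu := hmu u
      have ih := ih (M := M + mu u) (by positivity) (fun h => by linarith)
      have : ((inserts (Item.busy v) X).map
          (custWeight lam mu M ∘ fun X => Item.busy u :: X)).sum =
          ((inserts (Item.busy v) X).map (custWeight lam mu (M + mu u))).sum / (M + mu u) := by
        rw [div_eq_mul_inv, ← List.sum_map_mul_right]
        simp only [Function.comp_def, custWeight, div_eq_mul_inv]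
      simp only [inserts, List.map_cons, List.map_map, List.sum_cons, this]
      set s := ((inserts (Item.busy v) X).map (custWeight lam mu (M + mu u))).sum
      simp only [custWeight]
      rw [← ih, show M + mu u + mu v = M + mu v + mu u by ring]
      field_simp
      ring
    | waiting c =>
      have hM : 0 < M := lt_of_le_of_ne hM fun h => hX h.symm c X rfl
      have ih := ih (M := M) hM.le (fun h => by linarith)
      have : ((inserts (Item.busy v) X).map
          (custWeight lam mu M ∘ fun X => Item.waiting c :: X)).sum =
          lam c / M * ((inserts (Item.busy v) X).map (custWeight lam mu M)).sum := by
        rw [← List.sum_map_mul_left]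
        simp only [Function.comp_def, custWeight]
      simp only [inserts, List.map_cons, List.map_map, List.sum_cons, this]
      set s := ((inserts (Item.busy v) X).map (custWeight lam mu M)).sum
      simp only [custWeight]
      rw [← ih]
      field_simp
      ring

theorem sum_custWeight_inserts_zero (hmu : ∀ v, 0 < mu v) (v : Server n₁ n₂)
    (X : List (Item n₁ n₂)) (hX : ∀ c X', X ≠ Item.waiting c :: X') :
    mu v * ((inserts (Item.busy v) X).map (custWeight lam mu 0)).sum = custWeight lam mu 0 X := by
  simpa using sum_custWeight_inserts hmu v X le_rfl fun _ => hX

theorem busyRate_of_mem_inserts {v : Server n₁ n₂} {X X' : List (Item n₁ n₂)}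
    (h : X' ∈ inserts (Item.busy v) X) : busyRate mu X' = busyRate mu X + mu v := by
  obtain ⟨A, B, rfl, rfl⟩ := mem_inserts.mp h
  simp only [busyRate_append, busyRate_busy_cons]
  ring

/-- The sum runs over the places in front of the waiting `c` where `v` may have been before its
completion. The factors behind `X₁` do not depend on this place, so they come out and the insertion
identity applies to `X₁`; the factor of the waiting `c` differs from that of `v` at the same place
by `lam c`. -/
theorem sum_custWeight_take (hmu : ∀ v, 0 < mu v) (v : Server n₁ n₂) (c : Cust)
    (X₁ X₂ : List (Item n₁ n₂)) (hX : ∀ c X', X₁ ≠ Item.waiting c :: X') :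
    mu v * ((inserts (Item.busy v) X₁).map
      fun X' => custWeight lam mu 0 (X' ++ Item.waiting c :: X₂)).sum
      = lam c * custWeight lam mu 0 (X₁ ++ Item.busy v :: X₂) := by
  have h : ((inserts (Item.busy v) X₁).map
      fun X' => custWeight lam mu 0 (X' ++ Item.waiting c :: X₂)).sum =
      ((inserts (Item.busy v) X₁).map (custWeight lam mu 0)).sum *
        (lam c / (busyRate mu X₁ + mu v) * custWeight lam mu (busyRate mu X₁ + mu v) X₂) := by
    rw [← List.sum_map_mul_right]
    refine congrArg _ (List.map_congr_left fun X' hX' => ?_)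
    simp only [custWeight_append, busyRate_of_mem_inserts hX', custWeight, zero_add]
  rw [h, ← mul_assoc, sum_custWeight_inserts_zero hmu v X₁ hX, custWeight_append, custWeight,
    zero_add]
  ring

/-- Telescoping from the back of the list: by `pooledRate_cons`, each server adds the rate of the
types that no later server can serve. -/
theorem sum_newRate (Y : List (Server n₁ n₂)) (F : Server n₁ n₂ → ℝ) (V : List (Server n₁ n₂))
    (hF : ∀ V₁ v V₂, V = V₁ ++ v :: V₂ → F v = newRate lam v (V₂ ++ Y)) :
    (V.map F).sum + pooledRate lam Y = pooledRate lam (V ++ Y) := by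
  induction V with
  | nil => simp
  | cons v V ih =>
    have ih := ih fun V₁ w V₂ h => hF (v :: V₁) w V₂ (by rw [h]; rfl)
    rw [List.map_cons, List.sum_cons, List.cons_append, pooledRate_cons, ← ih, hF [] v V rfl]
    ring

end Customers

end NSystem
namespace NSystem

variable {n₁ n₂ : ℕ}

/-! ### Global balance -/

/-- Replaces the sum over predecessors by a finite one. The list `L` only has to contain all
predecessors; `P` stays on the right because some of its members need not be predecessors. -/
theorem tsum_state_fiber (f : Config n₁ n₂ → ENNReal) (P : Config n₁ n₂ → Prop)
    [DecidablePred P]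
    (L : List (Config n₁ n₂)) (hL : L.Nodup) (hval : ∀ s ∈ L, s.Valid)
    (h : ∀ s : Config n₁ n₂, s.Valid → P s → s ∈ L) :
    ∑' s : State n₁ n₂, (if P s.1 then f s.1 else 0)
      = (L.map fun s => if P s then f s else 0).sum := by
  classical
  have h1 : ∑' s : State n₁ n₂, (if P s.1 then f s.1 else 0) =
      ∑' s : Config n₁ n₂, {s : Config n₁ n₂ | s.Valid}.indicator
        (fun s => if P s then f s else 0) s :=
    tsum_subtype {s : Config n₁ n₂ | s.Valid} fun s => if P s then f s else 0
  rw [h1, tsum_eq_sum (s := L.toFinset), List.sum_toFinset _ hL]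
  · refine congrArg _ (List.map_congr_left fun s hs => ?_)
    exact Set.indicator_of_mem (hval s hs) _
  · intro s hs
    rw [List.mem_toFinset] at hs
    by_cases hv : s.Valid
    · rw [Set.indicator_of_mem (by exact hv), if_neg fun hP => hs (h s hv hP)]
    · exact Set.indicator_of_notMem (by exact hv) _

theorem ofReal_list_sum {α : Type*} (L : List α) (f : α → ℝ) (hf : ∀ a ∈ L, 0 ≤ f a) :
    ENNReal.ofReal (L.map f).sum = (L.map fun a => ENNReal.ofReal (f a)).sum := by
  induction L with
  | nil => simp
  | cons a L ih =>
    simp only [List.map_cons, List.sum_cons]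
    rw [ENNReal.ofReal_add (hf a (by simp))
      (List.sum_nonneg (by simpa using fun b hb => hf b (by simp [hb]))),
      ih fun b hb => hf b (by simp [hb])]

theorem tsum_state_fiber_real (f : Config n₁ n₂ → ℝ) (P : Config n₁ n₂ → Prop)
    [DecidablePred P]
    (L : List (Config n₁ n₂)) (hL : L.Nodup) (hval : ∀ s ∈ L, s.Valid)
    (hf : ∀ s ∈ L, 0 ≤ f s)
    (h : ∀ s : Config n₁ n₂, s.Valid → P s → s ∈ L) :
    ∑' s : State n₁ n₂, (if P s.1 then ENNReal.ofReal (f s.1) else 0)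
      = ENNReal.ofReal (L.map fun s => if P s then f s else 0).sum := by
  rw [tsum_state_fiber (fun s => ENNReal.ofReal (f s)) P L hL hval h, ofReal_list_sum]
  · refine congrArg _ (List.map_congr_left fun s _ => ?_)
    split_ifs <;> simp
  · intro s hs
    split_ifs
    exacts [hf s hs, le_rfl]

/-! ### The two partial balances. -/

section Balance

variable {lam : Cust → ℝ} {mu : Server n₁ n₂ → ℝ}

theorem Config.Valid.inl_busy {X : List (Item n₁ n₂)} {Y : List (Server n₁ n₂)} {c : Cust}
    (h : (⟨X, Y⟩ : Config n₁ n₂).Valid) (hY : ∀ w ∈ Y, compat w c = false) (i : Fin n₁) :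
    Sum.inl i ∈ busyServers X := by
  rcases List.mem_append.mp (h.mem_servers (Sum.inl i)) with h | h
  · exact h
  · exact absurd (hY _ h) (by simp [compat])

/-- An `s₁` server can serve everybody and would stand behind a customer waiting at the head of the
line. This keeps the product form away from division by a zero service rate. -/
theorem Config.Valid.ne_waiting_cons (hn : 0 < n₁) {X : List (Item n₁ n₂)}
    {Y : List (Server n₁ n₂)} (h : (⟨X, Y⟩ : Config n₁ n₂).Valid) (c : Cust)
    (X' : List (Item n₁ n₂)) : X ≠ Item.waiting c :: X' := by
  rintro rfl
  rw [valid_iff] at h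
  have h1 := h.2.1 (Sum.inl ⟨0, hn⟩)
  have h2 := (List.pairwise_cons.mp h.2.2.1).1
  simp only [Config.servers, busyServers_waiting_cons, List.mem_append, mem_busyServers] at h1
  rcases h1 with h1 | h1
  · simpa [compat] using h2 _ h1
  · simpa [compat] using h.2.2.2 c (by simp) _ h1

theorem busyRate_nonneg (hmu : ∀ v, 0 < mu v) (X : List (Item n₁ n₂)) : 0 ≤ busyRate mu X :=
  List.sum_nonneg (List.forall_mem_map.mpr fun v _ => (hmu v).le)

theorem busyRate_pos (hmu : ∀ v, 0 < mu v) {X : List (Item n₁ n₂)} {v : Server n₁ n₂}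
    (hv : v ∈ busyServers X) : 0 < busyRate mu X := by
  refine lt_of_lt_of_le (hmu v) (List.single_le_sum ?_ _ (List.mem_map_of_mem hv))
  exact List.forall_mem_map.mpr fun v _ => (hmu v).le

theorem custWeight_nonneg (hlam : ∀ c, 0 < lam c) (hmu : ∀ v, 0 < mu v) {M : ℝ} (hM : 0 ≤ M)
    (X : List (Item n₁ n₂)) : 0 ≤ custWeight lam mu M X := by
  induction X generalizing M with
  | nil => simp [custWeight]
  | cons x X ih =>
    cases x with
    | busy v =>
      have := hmu v
      exact div_nonneg (ih (by positivity)) (by positivity)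
    | waiting c => exact mul_nonneg (div_nonneg (hlam c).le hM) (ih hM)

theorem weight_nonneg (hlam : ∀ c, 0 < lam c) (hmu : ∀ v, 0 < mu v) (s : Config n₁ n₂) :
    0 ≤ weight lam mu s :=
  mul_nonneg (custWeight_nonneg hlam hmu le_rfl _) (idleWeight_pos hlam _).le

open scoped Classical in
-- The newcomer can only be the last item in the line. If it is being served by `v`, the
-- predecessors are obtained by inserting `v` into the idle list and `sum_insertWeight` adds them
-- up; if it waits, the predecessor is unique. In both cases the last factor of the weight cancels
-- against the busy rate.
theorem inflow_arrive (hn : 0 < n₁) (hlam : ∀ c, 0 < lam c) (hmu : ∀ v, 0 < mu v)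
    {s' : Config n₁ n₂} (hs' : s'.Valid) :
    ENNReal.ofReal (lam Cust.c1) * (∑' s : State n₁ n₂,
        if s.1.arrive Cust.c1 = s' then ENNReal.ofReal (weight lam mu s.1) else 0)
      + ENNReal.ofReal (lam Cust.c2) * (∑' s : State n₁ n₂,
        if s.1.arrive Cust.c2 = s' then ENNReal.ofReal (weight lam mu s.1) else 0)
      = ENNReal.ofReal (weight lam mu s' * busyRate mu s'.customers) := by
  obtain ⟨X', Y⟩ := s'
  have hw := weight_nonneg hlam hmu (n₁ := n₁) (n₂ := n₂)
  have hcomb : ∀ a b : ℝ, 0 ≤ a → 0 ≤ b → ENNReal.ofReal (lam Cust.c1) * ENNReal.ofReal a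
      + ENNReal.ofReal (lam Cust.c2) * ENNReal.ofReal b
      = ENNReal.ofReal (lam Cust.c1 * a + lam Cust.c2 * b) := by
    intro a b ha hb
    have h1 := (hlam Cust.c1).le
    have h2 := (hlam Cust.c2).le
    rw [← ENNReal.ofReal_mul h1, ← ENNReal.ofReal_mul h2, ← ENNReal.ofReal_add] <;> positivity
  rcases List.eq_nil_or_concat X' with rfl | ⟨X, x, rfl⟩
  -- No arrival leads to a state without customers, and such a state has busy rate zero.
  · have h0 : ∀ c (s : Config n₁ n₂), s.arrive c ≠ ⟨[], Y⟩ := by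
      intro c s h
      unfold Config.arrive at h
      split at h <;> simp at h
    simp [h0]
  simp only [List.concat_eq_append] at hs' ⊢
  cases x with
  | busy v =>
    rw [← List.append_nil Y] at hs'
    have hYnd : v ∉ Y := by
      have := hs'.nodup
      simp [Config.servers] at this
      grind
    have key : ∀ c, ∑' s : State n₁ n₂,
        (if s.1.arrive c = ⟨X ++ [Item.busy v], Y⟩ then ENNReal.ofReal (weight lam mu s.1) else 0)
        = ENNReal.ofReal (custWeight lam mu 0 X * insertWeight lam c v Y) := by
      intro c
      have hval : ∀ Y' ∈ inserts v Y, (⟨X, Y'⟩ : Config n₁ n₂).Valid := by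
        intro Y' hY'
        obtain ⟨A, B, rfl, rfl⟩ := mem_inserts.mp hY'
        rw [List.append_nil] at hs'
        exact (valid_arrive_busy_iff _ _ _ _).mp hs'
      rw [tsum_state_fiber_real (weight lam mu) (fun s => s.arrive c = ⟨X ++ [Item.busy v], Y⟩)
        ((inserts v Y).map fun Y' => ⟨X, Y'⟩)]
      · rw [insertWeight, ← List.sum_map_mul_left, List.map_map]
        congr 2
        refine List.map_congr_left fun Y' hY' => ?_
        have hiff : (⟨X, Y'⟩ : Config n₁ n₂).arrive c = ⟨X ++ [Item.busy v], Y⟩ ↔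
            LastCompat c v Y' := by
          rcases exists_last_compat c Y' with h | ⟨A, w, B, rfl, hw, hB⟩
          · rw [arrive_waiting h]
            simp only [Config.mk.injEq, List.append_cancel_left_eq, List.cons.injEq, reduceCtorEq,
              false_and, false_iff]
            rintro ⟨A, B, rfl, hv, -⟩
            simp [h v (by simp)] at hv
          · rw [arrive_busy (hval _ hY') hw hB]
            constructor
            · intro h
              simp only [Config.mk.injEq, List.append_cancel_left_eq, List.cons.injEq,
                Item.busy.injEq, and_true] at h
              obtain ⟨rfl, -⟩ := h
              exact ⟨A, B, rfl, hw, hB⟩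
            · rintro ⟨A', B', h, hv, hB'⟩
              obtain ⟨A₀, B₀, rfl, h0⟩ := mem_inserts.mp hY'
              have e1 := arrive_busy (hval _ hY') hw hB
              rw [← e1, h0, arrive_busy (h0 ▸ hval _ hY') hv]
              have hnd : (A₀ ++ v :: B₀).Nodup := by
                have := (hval _ hY').nodup
                rw [h0] at this
                exact (List.nodup_append.mp this).2.1
              -- The server `v` occurs only once in the list, so the two ways of splitting at `v`
              -- coincide.
              have : A₀ = A' ∧ B₀ = B' := by
                rw [h0] at h
                have hv1 : v ∉ A₀ := by grind
                have hv2 : v ∉ B₀ := by grind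
                have := (List.append_cons_inj_of_notMem hv1 hv2).mp h
                tauto
              rw [this.2]
              exact hB'
        simp only [Function.comp_apply, hiff, weight]
        split_ifs <;> simp
      · exact (nodup_inserts hYnd).map fun _ _ h => by simpa using h
      · simpa using hval
      · exact fun s _ => hw s
      · rintro ⟨X₀, Y₀⟩ hs h
        rcases exists_last_compat c Y₀ with h' | ⟨A, w, B, rfl, hw, hB⟩
        · rw [arrive_waiting h'] at h
          simp at h
        · rw [arrive_busy hs hw hB] at h
          simp only [Config.mk.injEq, List.append_singleton_inj, Item.busy.injEq] at h
          obtain ⟨⟨rfl, rfl⟩, rfl⟩ := h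
          exact List.mem_map_of_mem (mem_inserts.mpr ⟨A, B, rfl, rfl⟩)
    have hX := custWeight_nonneg hlam hmu le_rfl X
    have hI : ∀ c, 0 ≤ insertWeight lam c v Y := by
      intro c
      refine List.sum_nonneg ?_
      simp only [List.mem_map, forall_exists_index, and_imp, forall_apply_eq_imp_iff₂]
      intro Y' _
      split_ifs
      exacts [(idleWeight_pos hlam _).le, le_rfl]
    rw [key, key, hcomb _ _ (mul_nonneg hX (hI _)) (mul_nonneg hX (hI _))]
    congr 1
    have hM : 0 < busyRate mu X + mu v := add_pos_of_nonneg_of_pos (busyRate_nonneg hmu X) (hmu v)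
    simp only [weight, custWeight_append, custWeight, busyRate_append, busyRate_busy_cons,
      busyRate_nil, zero_add, add_zero]
    rw [← sum_insertWeight hlam hYnd]
    field_simp
  | waiting c₀ =>
    obtain ⟨hs, hY⟩ := (valid_arrive_waiting_iff _ _ _).mp hs'
    -- Since a customer waits, no `s₁` server is idle; hence some server is busy and the denominator
    -- of the last factor is positive.
    have hM : 0 < busyRate mu X := busyRate_pos hmu (hs.inl_busy hY ⟨0, hn⟩)
    have key : ∀ c, ∑' s : State n₁ n₂,
        (if s.1.arrive c = ⟨X ++ [Item.waiting c₀], Y⟩ then ENNReal.ofReal (weight lam mu s.1)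
          else 0) = ENNReal.ofReal (if c = c₀ then weight lam mu ⟨X, Y⟩ else 0) := by
      intro c
      rw [tsum_state_fiber_real (weight lam mu)
        (fun s => s.arrive c = ⟨X ++ [Item.waiting c₀], Y⟩) [⟨X, Y⟩]]
      · simp only [List.map_cons, List.map_nil, List.sum_cons, List.sum_nil, add_zero]
        by_cases hc : c = c₀
        · subst hc
          rw [if_pos rfl, if_pos (arrive_waiting hY)]
        · rw [if_neg hc, if_neg]
          intro h
          rcases exists_last_compat c Y with h' | ⟨A, w, B, rfl, hw, hB⟩
          · rw [arrive_waiting h'] at h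
            simp at h
            exact hc h
          · rw [arrive_busy hs hw hB] at h
            simp at h
      · simp
      · simpa using hs
      · exact fun s _ => hw s
      · rintro ⟨X₀, Y₀⟩ hs h
        rcases exists_last_compat c Y₀ with h' | ⟨A, w, B, rfl, hw, hB⟩
        · rw [arrive_waiting h'] at h
          simp only [Config.mk.injEq, List.append_singleton_inj] at h
          simp [h.1.1, h.2]
        · rw [arrive_busy hs hw hB] at h
          simp at h
    have hite : ∀ c, 0 ≤ if c = c₀ then weight lam mu ⟨X, Y⟩ else 0 := by
      intro c
      split_ifs
      exacts [hw _, le_rfl]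
    rw [key, key, hcomb _ _ (hite _) (hite _)]
    congr 1
    have : weight lam mu ⟨X ++ [Item.waiting c₀], Y⟩ * busyRate mu (X ++ [Item.waiting c₀])
        = lam c₀ * weight lam mu ⟨X, Y⟩ := by
      simp only [weight, custWeight_append, custWeight, busyRate_append, busyRate_waiting_cons,
        busyRate_nil, zero_add, add_zero, mul_one]
      field_simp
    rw [this]
    cases c₀ <;> simp


theorem Config.Valid.busy_append_inj {A B X₁ X₂ : List (Item n₁ n₂)} {Y : List (Server n₁ n₂)}
    {v : Server n₁ n₂} (h : (⟨X₁ ++ Item.busy v :: X₂, Y⟩ : Config n₁ n₂).Valid)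
    (heq : A ++ Item.busy v :: B = X₁ ++ Item.busy v :: X₂) : A = X₁ ∧ B = X₂ := by
  have := (List.append_cons_inj_of_notMem h.busy_notMem.1 h.busy_notMem.2.1).mp heq.symm
  exact ⟨this.1.symm, this.2.2.symm⟩

theorem length_of_mem_inserts {α : Type*} {a : α} {l m : List α} (h : m ∈ inserts a l) :
    m.length = l.length + 1 := by
  obtain ⟨A, B, rfl, rfl⟩ := mem_inserts.mp h
  simp
  ring

open scoped Classical in
/-- Completions at a server that is now busy. -/
theorem inflow_complete_busy (hn : 0 < n₁) (hlam : ∀ c, 0 < lam c) (hmu : ∀ v, 0 < mu v)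
    {X₁ X₂ : List (Item n₁ n₂)} {Y : List (Server n₁ n₂)} {v : Server n₁ n₂}
    (hs' : (⟨X₁ ++ Item.busy v :: X₂, Y⟩ : Config n₁ n₂).Valid) :
    ENNReal.ofReal (mu v) * (∑' s : State n₁ n₂,
        if v ∈ busyServers s.1.customers ∧ s.1.complete v = ⟨X₁ ++ Item.busy v :: X₂, Y⟩
          then ENNReal.ofReal (weight lam mu s.1) else 0)
      = ENNReal.ofReal (weight lam mu ⟨X₁ ++ Item.busy v :: X₂, Y⟩ *
          newRate lam v (busyServers X₂ ++ Y)) := by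
  have hw := weight_nonneg hlam hmu (n₁ := n₁) (n₂ := n₂)
  have hX₁ : ∀ c X', X₁ ≠ Item.waiting c :: X' := by
    rintro c X' rfl
    exact hs'.ne_waiting_cons hn c _ rfl
  -- The types that a customer now served by `v` may have had while waiting at this place: `v` can
  -- serve them, no server behind can. Their rates add up to `newRate`.
  let cond : Cust → Prop := fun c => compat v c = true ∧ ∀ w ∈ busyServers X₂ ++ Y,
    compat w c = false
  let L : Cust → List (Config n₁ n₂) := fun c => if cond c then
    (inserts (Item.busy v) X₁).map fun X' => ⟨X' ++ Item.waiting c :: X₂, Y⟩ else []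
  have hL : ∀ c, ∀ s ∈ L c, s.Valid ∧ v ∈ busyServers s.customers ∧
      s.complete v = ⟨X₁ ++ Item.busy v :: X₂, Y⟩ := by
    intro c s hs
    by_cases hc : cond c
    · simp only [L, if_pos hc, List.mem_map] at hs
      obtain ⟨X', hX', rfl⟩ := hs
      obtain ⟨A, B, rfl, rfl⟩ := mem_inserts.mp hX'
      obtain ⟨h1, h2⟩ := (valid_complete_take_iff A B X₂ Y v c).mp ⟨hs', hc.2⟩
      rw [List.append_assoc, List.cons_append]
      exact ⟨h1, by simp, complete_take h1 hc.1 h2⟩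
    · simp [L, if_neg hc] at hs
  have hnd : ∀ c, (L c).Nodup := by
    intro c
    by_cases hc : cond c
    · simp only [L, if_pos hc]
      exact (nodup_inserts hs'.busy_notMem.1).map fun _ _ h => by simpa using h
    · simp [L, if_neg hc]
  have hLc : ∀ c, ∀ s ∈ L c, ∃ X', X'.length = X₁.length + 1 ∧
      s.customers = X' ++ Item.waiting c :: X₂ := by
    intro c s hs
    by_cases hc : cond c
    · simp only [L, if_pos hc, List.mem_map] at hs
      obtain ⟨X', hX', rfl⟩ := hs
      exact ⟨X', length_of_mem_inserts hX', rfl⟩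
    · simp [L, if_neg hc] at hs
  rw [tsum_state_fiber_real (weight lam mu) (fun s => v ∈ busyServers s.customers ∧
    s.complete v = ⟨X₁ ++ Item.busy v :: X₂, Y⟩) (L Cust.c1 ++ L Cust.c2),
    ← ENNReal.ofReal_mul (hmu v).le]
  · congr 1
    have hsum : ∀ c, mu v * ((L c).map fun s => if v ∈ busyServers s.customers ∧
        s.complete v = ⟨X₁ ++ Item.busy v :: X₂, Y⟩ then weight lam mu s else 0).sum =
        weight lam mu ⟨X₁ ++ Item.busy v :: X₂, Y⟩ * (if cond c then lam c else 0) := by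
      intro c
      rw [List.map_congr_left fun s hs => if_pos (hL c s hs).2]
      by_cases hc : cond c
      · simp only [L, if_pos hc, List.map_map, Function.comp_def, weight]
        rw [List.sum_map_mul_right, ← mul_assoc, sum_custWeight_take hmu v c X₁ X₂ hX₁]
        ring
      · simp [L, if_neg hc]
    rw [List.map_append, List.sum_append, mul_add, hsum, hsum, newRate, mul_add]
  -- Predecessors for the two types are different: behind prefixes of equal length they have waiting
  -- customers of different types.
  · refine List.nodup_append.mpr ⟨hnd _, hnd _, ?_⟩
    intro s hs t ht hst
    subst hst
    obtain ⟨X', h1, h2⟩ := hLc _ s hs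
    obtain ⟨X'', h3, h4⟩ := hLc _ s ht
    rw [h2] at h4
    have := List.append_inj_right h4 (h1.trans h3.symm)
    simp at this
  · intro s hs
    rcases List.mem_append.mp hs with hs | hs
    exacts [(hL _ s hs).1, (hL _ s hs).1]
  · exact fun s _ => hw s
  · rintro ⟨X, Y'⟩ hs ⟨hv, h⟩
    obtain ⟨A, B, rfl⟩ := List.append_of_mem (mem_busyServers.mp hv)
    rcases exists_first_compat v B with h' | ⟨B₁, c, B₂, rfl, hc, hB⟩
    · rw [complete_idle hs h'] at h
      simp only [Config.mk.injEq] at h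
      exact absurd (h.2 ▸ List.mem_cons_self) hs'.busy_notMem.2.2
    · rw [complete_take hs hc hB] at h
      simp only [Config.mk.injEq] at h
      obtain ⟨h, rfl⟩ := h
      obtain ⟨rfl, rfl⟩ := hs'.busy_append_inj h
      have hcond : cond c := ⟨hc, ((valid_complete_take_iff _ _ _ _ _ c).mpr ⟨hs, hB⟩).2⟩
      have : (⟨A ++ Item.busy v :: (B₁ ++ Item.waiting c :: B₂), Y'⟩ : Config n₁ n₂) ∈ L c := by
        simp only [L, if_pos hcond, List.mem_map, Config.mk.injEq, and_true]
        exact ⟨A ++ Item.busy v :: B₁, mem_inserts.mpr ⟨A, B₁, rfl, rfl⟩, by simp⟩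
      cases c
      exacts [List.mem_append_left _ this, List.mem_append_right _ this]

open scoped Classical in
/-- Completions at a server that is now idle. -/
theorem inflow_complete_idle (hn : 0 < n₁) (hlam : ∀ c, 0 < lam c) (hmu : ∀ v, 0 < mu v)
    {X : List (Item n₁ n₂)} {Y : List (Server n₁ n₂)} {v : Server n₁ n₂}
    (hs' : (⟨X, Y⟩ : Config n₁ n₂).Valid) (hv : v ∈ Y) :
    ENNReal.ofReal (mu v) * (∑' s : State n₁ n₂,
        if v ∈ busyServers s.1.customers ∧ s.1.complete v = ⟨X, Y⟩
          then ENNReal.ofReal (weight lam mu s.1) else 0)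
      = ENNReal.ofReal (weight lam mu ⟨X, Y⟩ *
          if Y.head? = some v then pooledRate lam Y else 0) := by
  have hw := weight_nonneg hlam hmu (n₁ := n₁) (n₂ := n₂)
  have hpre : ∀ s : Config n₁ n₂, s.Valid → v ∈ busyServers s.customers →
      s.complete v = ⟨X, Y⟩ → ∃ A B, X = A ++ B ∧ Y = v :: s.idle ∧
        s.customers = A ++ Item.busy v :: B := by
    rintro ⟨X₀, Y₀⟩ hs hvX h
    obtain ⟨A, B, rfl⟩ := List.append_of_mem (mem_busyServers.mp hvX)
    rcases exists_first_compat v B with h' | ⟨B₁, c, B₂, rfl, hc, hB⟩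
    · rw [complete_idle hs h'] at h
      simp only [Config.mk.injEq] at h
      exact ⟨A, B, h.1.symm, h.2.symm, rfl⟩
    · rw [complete_take hs hc hB] at h
      simp only [Config.mk.injEq] at h
      obtain ⟨rfl, rfl⟩ := h
      exact absurd hv hs'.busy_notMem.2.2
  -- Only the most recently idle server, the head of the idle list, can have just become idle.
  by_cases hhead : Y.head? = some v
  · obtain ⟨Y', rfl⟩ : ∃ Y', Y = v :: Y' := by
      cases Y with
      | nil => simp at hv
      | cons y Y => simp at hhead; exact ⟨Y, by rw [hhead]⟩
    have hvX : Item.busy v ∉ X := by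
      have := hs'.nodup
      simp only [Config.servers, ← mem_busyServers] at this ⊢
      grind
    have hwait : ∀ c, Item.waiting c ∈ X → compat v c = false := fun c hc =>
      ((valid_iff _).mp hs').2.2.2 c hc v (by simp)
    have hL : ∀ X' ∈ inserts (Item.busy v) X, (⟨X', Y'⟩ : Config n₁ n₂).Valid ∧
        v ∈ busyServers X' ∧ (⟨X', Y'⟩ : Config n₁ n₂).complete v = ⟨X, v :: Y'⟩ := by
      intro X' hX'
      obtain ⟨A, B, rfl, rfl⟩ := mem_inserts.mp hX'
      obtain ⟨h1, h2⟩ := (valid_complete_idle_iff _ _ _ _).mp hs'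
      exact ⟨h1, by simp, complete_idle h1 h2⟩
    rw [tsum_state_fiber_real (weight lam mu) (fun s => v ∈ busyServers s.customers ∧
      s.complete v = ⟨X, v :: Y'⟩) ((inserts (Item.busy v) X).map fun X' => ⟨X', Y'⟩),
      ← ENNReal.ofReal_mul (hmu v).le]
    · congr 1
      have hmap := List.map_congr_left (f := fun X' => if v ∈ busyServers X' ∧
        (⟨X', Y'⟩ : Config n₁ n₂).complete v = ⟨X, v :: Y'⟩ then weight lam mu ⟨X', Y'⟩ else 0)
        fun X' hX' => if_pos (hL X' hX').2
      simp only [List.map_map, Function.comp_def]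
      rw [hmap]
      simp only [weight]
      rw [List.sum_map_mul_right, ← mul_assoc,
        sum_custWeight_inserts_zero hmu v X (hs'.ne_waiting_cons hn), if_pos hhead, idleWeight]
      have := pooledRate_cons_pos hlam v Y'
      field_simp
    · exact (nodup_inserts hvX).map fun _ _ h => by simpa using h
    · simpa using fun X' hX' => (hL X' hX').1
    · exact fun s _ => hw s
    · rintro ⟨X₀, Y₀⟩ hs ⟨hvs, h⟩
      obtain ⟨A, B, rfl, h2, h3⟩ := hpre _ hs hvs h
      simp only at h2 h3
      subst h3
      obtain ⟨-, rfl⟩ := List.cons_eq_cons.mp h2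
      exact List.mem_map_of_mem (mem_inserts.mpr ⟨A, B, rfl, rfl⟩)
  · rw [if_neg hhead, mul_zero, ENNReal.ofReal_zero]
    refine mul_eq_zero_of_right _ (ENNReal.tsum_eq_zero.mpr fun s => if_neg ?_)
    rintro ⟨hvs, h⟩
    obtain ⟨A, B, -, h2, -⟩ := hpre _ s.2 hvs h
    exact hhead (by rw [h2]; rfl)

open scoped Classical in
-- Each busy server contributes the rate of the types that it can serve and no later server can, the
-- first idle server contributes the pooled rate of the idle list, the other idle servers nothing.
-- The sum telescopes to the pooled rate of all servers, which is the total arrival rate because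
-- there is an `s₁` server.
theorem inflow_complete (hn : 0 < n₁) (hlam : ∀ c, 0 < lam c) (hmu : ∀ v, 0 < mu v)
    {s' : Config n₁ n₂} (hs' : s'.Valid) :
    ∑ v, ENNReal.ofReal (mu v) * (∑' s : State n₁ n₂,
        if v ∈ busyServers s.1.customers ∧ s.1.complete v = s'
          then ENNReal.ofReal (weight lam mu s.1) else 0)
      = ENNReal.ofReal (weight lam mu s' * (lam Cust.c1 + lam Cust.c2)) := by
  obtain ⟨X, Y⟩ := s'
  have hw := weight_nonneg hlam hmu (n₁ := n₁) (n₂ := n₂)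
  have hnew : ∀ v (V : List (Server n₁ n₂)), 0 ≤ newRate lam v V := by
    intro v V
    have h1 := (hlam Cust.c1).le
    have h2 := (hlam Cust.c2).le
    unfold newRate
    split_ifs <;> positivity
  have hex : ∀ v : Server n₁ n₂, ∃ r : ℝ, 0 ≤ r ∧
      ENNReal.ofReal (mu v) * (∑' s : State n₁ n₂,
        if v ∈ busyServers s.1.customers ∧ s.1.complete v = ⟨X, Y⟩
          then ENNReal.ofReal (weight lam mu s.1) else 0)
        = ENNReal.ofReal (weight lam mu ⟨X, Y⟩ * r) ∧
      (∀ V₁ V₂, busyServers X = V₁ ++ v :: V₂ → r = newRate lam v (V₂ ++ Y)) ∧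
      (v ∈ Y → r = if Y.head? = some v then pooledRate lam Y else 0) := by
    intro v
    rcases List.mem_append.mp (hs'.mem_servers v) with hv | hv
    · obtain ⟨X₁, X₂, rfl⟩ := List.append_of_mem (mem_busyServers.mp hv)
      refine ⟨_, hnew _ _, inflow_complete_busy hn hlam hmu hs', ?_, fun h =>
        absurd h hs'.busy_notMem.2.2⟩
      intro V₁ V₂ h
      simp only [busyServers_append, busyServers_busy_cons] at h
      have h1 : v ∉ busyServers X₁ := fun h => hs'.busy_notMem.1 (mem_busyServers.mp h)
      have h2 : v ∉ busyServers X₂ := fun h => hs'.busy_notMem.2.1 (mem_busyServers.mp h)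
      rw [((List.append_cons_inj_of_notMem h1 h2).mp h).2.2]
    · refine ⟨_, ?_, inflow_complete_idle hn hlam hmu hs' hv, ?_, fun _ => rfl⟩
      · split_ifs
        · cases Y with
          | nil => simp
          | cons y Y => exact (pooledRate_cons_pos hlam y Y).le
        · exact le_rfl
      · intro V₁ V₂ h
        have h' : v ∈ busyServers X := by simp [h]
        obtain ⟨A, B, rfl⟩ := List.append_of_mem (mem_busyServers.mp h')
        exact absurd hv hs'.busy_notMem.2.2
  choose F hF0 hF1 hF2 hF3 using hex
  have hu : (Finset.univ : Finset (Server n₁ n₂)) =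
      (Config.servers ⟨X, Y⟩ : List (Server n₁ n₂)).toFinset := by
    ext v
    simpa using hs'.mem_servers v
  simp only [hF1]
  rw [← ENNReal.ofReal_sum_of_nonneg fun v _ => mul_nonneg (hw _) (hF0 v), ← Finset.mul_sum, hu,
    List.sum_toFinset _ hs'.nodup]
  congr 2
  have hY : (Y.map F).sum = pooledRate lam Y := by
    cases Y with
    | nil => simp
    | cons y Y =>
      rw [List.map_cons, List.sum_cons, hF3 y (by simp), if_pos (by simp),
        List.sum_eq_zero, add_zero]
      have hnd := (List.nodup_append.mp hs'.nodup).2.1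
      simp only [List.mem_map, forall_exists_index, and_imp, forall_apply_eq_imp_iff₂]
      intro v hv
      rw [hF3 v (by simp [hv]), if_neg]
      simp only [List.head?_cons, Option.some.injEq]
      rintro rfl
      exact (List.nodup_cons.mp hnd).1 hv
  rw [Config.servers, List.map_append, List.sum_append, hY,
    sum_newRate Y F (busyServers X) fun V₁ v V₂ h => hF2 v V₁ V₂ h, pooledRate,
    if_neg, if_neg]
  · intro h
    simpa [compat] using h (Sum.inl ⟨0, hn⟩) (hs'.mem_servers _)
  · intro h
    simpa [compat] using h (Sum.inl ⟨0, hn⟩) (hs'.mem_servers _)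

end Balance

/-- The arrival rate of a customer type. -/
def custRate (lam₁ lam₂ : ℝ) : Cust → ℝ
  | Cust.c1 => lam₁
  | Cust.c2 => lam₂

open scoped Classical in
theorem exitRate_eq {lam₁ lam₂ mu₁ mu₂ : ℝ} (h1 : 0 < lam₁) (h2 : 0 < lam₂) (hmu₁ : 0 < mu₁)
    (hmu₂ : 0 < mu₂) {s : Config n₁ n₂} (hs : s.Valid) :
    exitRate lam₁ lam₂ mu₁ mu₂ s =
      ENNReal.ofReal (lam₁ + lam₂ + busyRate (serviceRate mu₁ mu₂) s.customers) := by
  have hmu : ∀ v : Server n₁ n₂, 0 < serviceRate mu₁ mu₂ v := by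
    rintro (_ | _)
    exacts [hmu₁, hmu₂]
  have hnd := (List.nodup_append.mp hs.nodup).1
  rw [exitRate, ENNReal.ofReal_add (by positivity) (busyRate_nonneg hmu _),
    ENNReal.ofReal_add h1.le h2.le, busyRate, ofReal_list_sum _ _ fun v _ => (hmu v).le,
    ← List.sum_toFinset _ hnd]
  simp only [← List.mem_toFinset]
  rw [Finset.sum_ite_mem, Finset.univ_inter]

open scoped Classical in
theorem tsum_rate {lam₁ lam₂ mu₁ mu₂ : ℝ} (s : State n₁ n₂) :
    ∑' s' : State n₁ n₂, rate lam₁ lam₂ mu₁ mu₂ s.1 s'.1 = exitRate lam₁ lam₂ mu₁ mu₂ s.1 := by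
  have key : ∀ (t : Config n₁ n₂) (r : ENNReal), t.Valid →
      ∑' s' : State n₁ n₂, (if t = s'.1 then r else 0) = r := by
    intro t r ht
    have h := tsum_eq_single (L := SummationFilter.unconditional _) (f := fun s' : State n₁ n₂ => if t = s'.1 then r else 0)
      (show State n₁ n₂ from ⟨t, ht⟩) fun s' hs' => if_neg fun h => hs' (Subtype.ext h.symm)
    exact h.trans (if_pos rfl)
  simp only [rate]
  rw [ENNReal.tsum_add, ENNReal.tsum_add, key _ _ (s.2.arrive _), key _ _ (s.2.arrive _),
    Summable.tsum_finsetSum fun _ _ => ENNReal.summable, exitRate]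
  congr 1
  refine Finset.sum_congr rfl fun v _ => ?_
  by_cases hv : v ∈ busyServers s.1.customers
  · simp only [hv, true_and, if_true]
    exact key _ _ (s.2.complete hv)
  · simp [hv]

open scoped Classical in
/-- The product form satisfies the global balance equations. -/
theorem weight_balance (hn : 0 < n₁) {lam₁ lam₂ mu₁ mu₂ : ℝ} (h1 : 0 < lam₁) (h2 : 0 < lam₂)
    (hmu₁ : 0 < mu₁) (hmu₂ : 0 < mu₂) (s' : State n₁ n₂) :
    ∑' s : State n₁ n₂,
        ENNReal.ofReal (weight (custRate lam₁ lam₂) (serviceRate mu₁ mu₂) s.1) *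
          rate lam₁ lam₂ mu₁ mu₂ s.1 s'.1
      = ENNReal.ofReal (weight (custRate lam₁ lam₂) (serviceRate mu₁ mu₂) s'.1) *
          exitRate lam₁ lam₂ mu₁ mu₂ s'.1 := by
  have hmu : ∀ v : Server n₁ n₂, 0 < serviceRate mu₁ mu₂ v := by
    rintro (_ | _)
    exacts [hmu₁, hmu₂]
  have hlam : ∀ c, 0 < custRate lam₁ lam₂ c := by
    rintro (_ | _)
    exacts [h1, h2]
  have hw := weight_nonneg hlam hmu s'.1
  have hb := busyRate_nonneg hmu s'.1.customers
  rw [exitRate_eq h1 h2 hmu₁ hmu₂ s'.2, ← ENNReal.ofReal_mul hw, mul_add, add_comm,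
    ENNReal.ofReal_add (by positivity) (by positivity),
    ← inflow_arrive hn hlam hmu s'.2,
    show lam₁ + lam₂ = custRate lam₁ lam₂ Cust.c1 + custRate lam₁ lam₂ Cust.c2 from rfl,
    ← inflow_complete hn hlam hmu s'.2]
  simp only [← ENNReal.tsum_mul_left]
  rw [← Summable.tsum_finsetSum fun _ _ => ENNReal.summable, ← ENNReal.tsum_add,
    ← ENNReal.tsum_add]
  refine tsum_congr fun s => ?_
  simp only [rate, mul_comm (ENNReal.ofReal (weight _ _ _)), add_mul, Finset.sum_mul, ite_mul,
    mul_ite, zero_mul, mul_zero]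
  rfl

end NSystem
namespace NSystem

variable {n₁ n₂ : ℕ}

/-! ### Uniqueness of the stationary distribution -/

section Reachability

variable {lam₁ lam₂ mu₁ mu₂ : ℝ}

/-- Reachability for the chain. -/
abbrev Reach (lam₁ lam₂ mu₁ mu₂ : ℝ) : State n₁ n₂ → State n₁ n₂ → Prop :=
  Relation.ReflTransGen fun s s' => rate lam₁ lam₂ mu₁ mu₂ s.1 s'.1 ≠ 0

theorem rate_arrive_ne_zero (h1 : 0 < lam₁) (s : Config n₁ n₂) :
    rate lam₁ lam₂ mu₁ mu₂ s (s.arrive Cust.c1) ≠ 0 := by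
  simp [rate, h1]

theorem rate_complete_ne_zero (hmu₁ : 0 < mu₁) (hmu₂ : 0 < mu₂) {s : Config n₁ n₂}
    {v : Server n₁ n₂} (hv : v ∈ busyServers s.customers) :
    rate lam₁ lam₂ mu₁ mu₂ s (s.complete v) ≠ 0 := by
  classical
  have hpos : 0 < serviceRate mu₁ mu₂ v := by
    cases v
    exacts [hmu₁, hmu₂]
  intro h
  have h3 := (add_eq_zero.mp h).2
  have h4 := Finset.sum_eq_zero_iff.mp h3 v (Finset.mem_univ v)
  rw [if_pos ⟨hv, rfl⟩, ENNReal.ofReal_eq_zero] at h4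
  exact absurd hpos (not_lt.mpr h4)

/-- Every server can serve type `c1`, so each such arrival occupies one more idle server until none
is left. -/
theorem exists_reach_idle_nil (h1 : 0 < lam₁) (s : State n₁ n₂) :
    ∃ t : State n₁ n₂, Reach lam₁ lam₂ mu₁ mu₂ s t ∧ t.1.idle = [] := by
  induction hk : s.1.idle.length generalizing s with
  | zero => exact ⟨s, .refl, List.length_eq_zero_iff.mp hk⟩
  | succ k ih =>
    obtain ⟨⟨X, Y⟩, hs⟩ := s
    simp only at hk
    rcases exists_last_compat Cust.c1 Y with h | ⟨A, v, B, rfl, hv, hB⟩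
    · cases Y with
      | nil => simp at hk
      | cons y Y => simpa [compat_c1] using h y (by simp)
    · have harr := arrive_busy hs hv hB
      obtain ⟨t, ht, ht'⟩ := ih ⟨_, hs.arrive Cust.c1⟩ (by
        simp only [harr]
        simp only [List.length_append, List.length_cons] at hk ⊢
        omega)
      exact ⟨t, .head (rate_arrive_ne_zero h1 _) ht, ht'⟩

/-- Repeated completions at `v`: each one either makes `v` idle or consumes a waiting customer, so
the number of customers decreases. -/
theorem exists_reach_idle_cons (hmu₁ : 0 < mu₁) (hmu₂ : 0 < mu₂) (s : State n₁ n₂)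
    {v : Server n₁ n₂} (hv : v ∈ busyServers s.1.customers) :
    ∃ t : State n₁ n₂, Reach lam₁ lam₂ mu₁ mu₂ s t ∧ t.1.idle = v :: s.1.idle := by
  induction hk : s.1.customers.length generalizing s with
  | zero => simp [List.length_eq_zero_iff.mp hk] at hv
  | succ k ih =>
    obtain ⟨⟨X, Y⟩, hs⟩ := s
    simp only at hk hv
    obtain ⟨A, B, rfl⟩ := List.append_of_mem (mem_busyServers.mp hv)
    have hrate := rate_complete_ne_zero (lam₁ := lam₁) (lam₂ := lam₂) hmu₁ hmu₂
      (s := ⟨A ++ Item.busy v :: B, Y⟩) hv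
    have hval := hs.complete (v := v) hv
    rcases exists_first_compat v B with h | ⟨B₁, c, B₂, rfl, hc, hB⟩
    · refine ⟨⟨_, hval⟩, .single hrate, ?_⟩
      simp only [complete_idle hs h]
    · have hc := complete_take hs hc hB
      obtain ⟨t, ht, ht'⟩ := ih ⟨_, hval⟩ (by simp [hc]) (by
        simp only [hc]
        simp only [List.length_append, List.length_cons] at hk ⊢
        omega)
      refine ⟨t, .head hrate ht, ?_⟩
      rw [ht']
      simp only [hc]

theorem exists_reach_idle_append (hmu₁ : 0 < mu₁) (hmu₂ : 0 < mu₂) (L : List (Server n₁ n₂))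
    (hL : L.Nodup) (s : State n₁ n₂) (hLs : ∀ v ∈ L, v ∉ s.1.idle) :
    ∃ t : State n₁ n₂, Reach lam₁ lam₂ mu₁ mu₂ s t ∧ t.1.idle = L.reverse ++ s.1.idle := by
  induction L generalizing s with
  | nil => exact ⟨s, .refl, rfl⟩
  | cons v L ih =>
    have hv : v ∈ busyServers s.1.customers :=
      (List.mem_append.mp (s.2.mem_servers v)).resolve_right (hLs v (by simp))
    obtain ⟨t, ht, ht'⟩ := exists_reach_idle_cons hmu₁ hmu₂ s hv
    rw [List.nodup_cons] at hL
    obtain ⟨u, hu, hu'⟩ := ih hL.2 t (by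
      intro w hw
      rw [ht', List.mem_cons, not_or]
      exact ⟨fun h => hL.1 (h ▸ hw), hLs w (by simp [hw])⟩)
    exact ⟨u, ht.trans hu, by rw [hu', ht']; simp⟩

/-- The empty system, with the servers in some fixed order. -/
noncomputable def emptyState (n₁ n₂ : ℕ) : State n₁ n₂ :=
  ⟨⟨[], (Finset.univ : Finset (Server n₁ n₂)).toList.reverse⟩, by
    rw [valid_iff]
    simp [Config.servers, Finset.nodup_toList]⟩

/-- All servers are made busy before they are idled in the prescribed order, because the order of
the idle list is part of the state. Once all are idle no customer can be left: the first one would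
wait in front of an `s₁` server or be attached to a server that is also idle. -/
theorem reach_emptyState (hn : 0 < n₁) (h1 : 0 < lam₁) (hmu₁ : 0 < mu₁) (hmu₂ : 0 < mu₂)
    (s : State n₁ n₂) : Reach lam₁ lam₂ mu₁ mu₂ s (emptyState n₁ n₂) := by
  obtain ⟨t, ht, ht'⟩ := exists_reach_idle_nil (lam₂ := lam₂) (mu₁ := mu₁) (mu₂ := mu₂) h1 s
  obtain ⟨u, hu, hu'⟩ := exists_reach_idle_append (lam₁ := lam₁) (lam₂ := lam₂) hmu₁ hmu₂
    (Finset.univ : Finset (Server n₁ n₂)).toList (Finset.nodup_toList _) t (by simp [ht'])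
  have : u = emptyState n₁ n₂ := by
    obtain ⟨⟨X, Y⟩, hval⟩ := u
    rw [ht', List.append_nil] at hu'
    simp only at hu'
    subst hu'
    cases X with
    | nil => rfl
    | cons x X =>
      cases x with
      | waiting c => exact absurd rfl (hval.ne_waiting_cons hn c X)
      | busy v =>
        have hnd := hval.nodup
        simp [Config.servers] at hnd
  rw [← this]
  exact ht.trans hu

theorem isStationary_unique (hn : 0 < n₁) (h1 : 0 < lam₁) (hmu₁ : 0 < mu₁) (hmu₂ : 0 < mu₂)
    {p p' : PMF (State n₁ n₂)} (hp : IsStationary lam₁ lam₂ mu₁ mu₂ p)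
    (hp' : IsStationary lam₁ lam₂ mu₁ mu₂ p') : p = p' := by
  classical
  refine stationary_unique
    (q := fun s s' : State n₁ n₂ => rate lam₁ lam₂ mu₁ mu₂ s.1 s'.1) tsum_rate
    (C := ENNReal.ofReal lam₁ + ENNReal.ofReal lam₂
      + ∑ v : Server n₁ n₂, ENNReal.ofReal (serviceRate mu₁ mu₂ v)) ?_ ?_ (emptyState n₁ n₂)
    (reach_emptyState hn h1 hmu₁ hmu₂) hp hp'
  · simp [ENNReal.sum_eq_top]
  · intro s
    refine add_le_add le_rfl (Finset.sum_le_sum fun v _ => ?_)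
    split_ifs
    exacts [le_rfl, zero_le]

end Reachability

end NSystem
namespace NSystem

variable {n₁ n₂ : ℕ}

/-! ### Total weights -/

theorem tsum_list {α : Type*} (f : List α → ENNReal) :
    ∑' l, f l = f [] + ∑' a, ∑' l, f (a :: l) := by
  let e : Unit ⊕ (α × List α) ≃ List α :=
    { toFun := Sum.elim (fun _ => []) fun x => x.1 :: x.2
      invFun := fun l => match l with
        | [] => Sum.inl ()
        | a :: l => Sum.inr (a, l)
      left_inv := by rintro (_ | ⟨a, l⟩) <;> rfl
      right_inv := by rintro (_ | ⟨a, l⟩) <;> rfl }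
  rw [← e.tsum_eq, ENNReal.summable.tsum_sum ENNReal.summable,
    ← ENNReal.tsum_prod (f := fun a l => f (a :: l)), tsum_fintype]
  simp [e]

theorem tsum_list_concat {α : Type*} (f : List α → ENNReal) :
    ∑' l, f l = f [] + ∑' a, ∑' l, f (l ++ [a]) := by
  let e : List α ≃ List α := ⟨List.reverse, List.reverse, List.reverse_reverse,
    List.reverse_reverse⟩
  rw [← e.tsum_eq, tsum_list]
  congr 1
  refine tsum_congr fun a => ?_
  rw [← e.tsum_eq]
  exact tsum_congr fun l => by simp [e]

theorem tsum_item (f : Item n₁ n₂ → ENNReal) :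
    ∑' x, f x = ∑ v, f (Item.busy v) + (f (Item.waiting Cust.c1) + f (Item.waiting Cust.c2)) := by
  let e : Server n₁ n₂ ⊕ Bool ≃ Item n₁ n₂ :=
    { toFun := Sum.elim Item.busy fun b => Item.waiting (if b then Cust.c1 else Cust.c2)
      invFun := fun x => match x with
        | Item.busy v => Sum.inl v
        | Item.waiting Cust.c1 => Sum.inr true
        | Item.waiting Cust.c2 => Sum.inr false
      left_inv := by rintro (v | _ | _) <;> rfl
      right_inv := by rintro (v | _ | _) <;> rfl }
  rw [← e.tsum_eq, ENNReal.summable.tsum_sum ENNReal.summable, tsum_fintype, tsum_fintype]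
  simp [e]

/-- The number of `s₂` servers that follow the last `s₁` server. -/
def tailLength (R : List (Server n₁ n₂)) : ℕ := (R.reverse.takeWhile Sum.isRight).length

theorem tailLength_cons (v : Server n₁ n₂) (R : List (Server n₁ n₂)) :
    tailLength (v :: R) =
      tailLength R + if ∀ w ∈ v :: R, w.isRight = true then 1 else 0 := by
  rw [tailLength, List.reverse_cons, List.takeWhile_append]
  by_cases h : ∀ w ∈ R, w.isRight = true
  · have h2 : R.reverse.takeWhile Sum.isRight = R.reverse :=
      List.takeWhile_eq_self_iff.mpr (by simpa using h)
    rw [if_pos (by rw [h2])]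
    cases hv : v.isRight
    · simp [hv, tailLength, h2]
    · have : ∀ w ∈ v :: R, w.isRight = true := by simpa [hv] using h
      rw [if_pos this]
      simp [hv, tailLength, h2]
  · rw [if_neg, if_neg, add_zero, tailLength]
    · exact fun h' => h fun w hw => h' w (by simp [hw])
    · intro h'
      apply h
      have := List.takeWhile_eq_self_iff.mp
        (List.IsPrefix.eq_of_length (List.takeWhile_prefix _) h')
      simpa using this

theorem tailLength_le (R : List (Server n₁ n₂)) : tailLength R ≤ R.length := by
  rw [tailLength, ← R.length_reverse]
  exact (List.takeWhile_prefix _).length_le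

/-! ### Mass of the customer lists with a given order of the busy servers. -/

section Mass

variable {lam : Cust → ℝ} {mu : Server n₁ n₂ → ℝ}

open scoped Classical in
/-- The arrival rate of the customers that no server of `R` can serve. -/
noncomputable def unmetRate (lam : Cust → ℝ) (R : List (Server n₁ n₂)) : ℝ :=
  (if ∀ w ∈ R, compat w Cust.c1 = false then lam Cust.c1 else 0)
    + (if ∀ w ∈ R, compat w Cust.c2 = false then lam Cust.c2 else 0)

theorem unmetRate_eq_zero {R : List (Server n₁ n₂)} (h : ¬ ∀ w ∈ R, w.isRight = true) :
    unmetRate lam R = 0 := by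
  push Not at h
  obtain ⟨w, hw, hl⟩ := h
  rw [unmetRate, if_neg, if_neg, add_zero] <;>
  · intro h
    have := h w hw
    cases w <;> simp_all [compat]

/-- The queues behind the busy servers are stable with load at most `ρ`. -/
def LoadLE (lam : Cust → ℝ) (mu : Server n₁ n₂ → ℝ) (ρ : ℝ) : Prop :=
  ∀ R : List (Server n₁ n₂), R.Nodup → (∀ w ∈ R, w.isRight = true) →
    unmetRate lam R ≤ ρ * (∑ v, mu v - (R.map mu).sum)

open scoped Classical in
theorem tsum_custWeight_le_aux (hlam : ∀ c, 0 < lam c) (hmu : ∀ v, 0 < mu v) {ρ κ : ℝ}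
    (hρ : 0 ≤ ρ) (hκ : 1 ≤ κ) (hρκ : 1 + ρ * κ ≤ κ) (hload : LoadLE lam mu ρ)
    (Y : List (Server n₁ n₂)) (N : ℕ) (V : List (Server n₁ n₂)) (hnd : (V ++ Y).Nodup) {M : ℝ}
    (hM : 0 ≤ M) (hMV : M = ∑ v, mu v - ((V ++ Y).map mu).sum) :
    ∑' X : List (Item n₁ n₂), (if X.length ≤ N ∧ busyServers X = V ∧
        (X ++ Y.map Item.busy).Pairwise NoSkip then ENNReal.ofReal (custWeight lam mu M X) else 0)
      ≤ ENNReal.ofReal (custWeight lam mu M (V.map Item.busy) * κ ^ (tailLength (V ++ Y) + 1)) := by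
  have hκ0 : 0 ≤ κ := by linarith
  have hcw : ∀ {M : ℝ}, 0 ≤ M → ∀ X, 0 ≤ custWeight lam mu M X :=
    fun hM X => custWeight_nonneg hlam hmu hM X
  induction N generalizing V M with
  | zero =>
    rw [tsum_eq_single []]
    · by_cases hV : V = []
      · subst hV
        simp only [List.length_nil, busyServers_nil, List.map_nil, custWeight, one_mul]
        refine le_trans ?_ (ENNReal.ofReal_le_ofReal (one_le_pow₀ hκ))
        split_ifs
        exacts [le_rfl, zero_le]
      · rw [if_neg (by simp [Ne.symm hV])]
        exact zero_le
    · intro X hX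
      exact if_neg fun h => hX (List.length_eq_zero_iff.mp (Nat.le_zero.mp h.1))
  | succ N ih =>
    rw [tsum_list, tsum_item]
    have hwait : ∀ c, ∑' X : List (Item n₁ n₂), (if (Item.waiting c :: X).length ≤ N + 1 ∧
        busyServers (Item.waiting c :: X) = V ∧
        (Item.waiting c :: X ++ Y.map Item.busy).Pairwise NoSkip
          then ENNReal.ofReal (custWeight lam mu M (Item.waiting c :: X)) else 0) ≤
        ENNReal.ofReal ((if ∀ w ∈ V ++ Y, compat w c = false then lam c else 0) / M *
          (custWeight lam mu M (V.map Item.busy) * κ ^ (tailLength (V ++ Y) + 1))) := by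
      intro c
      have hnn : 0 ≤ (if ∀ w ∈ V ++ Y, compat w c = false then lam c else 0) / M := by
        have := (hlam c).le
        split_ifs <;> positivity
      rw [ENNReal.ofReal_mul hnn]
      refine le_trans ?_ (mul_le_mul_right (ih V hnd hM hMV) _)
      rw [← ENNReal.tsum_mul_left]
      refine ENNReal.tsum_le_tsum fun X => ?_
      by_cases h : (Item.waiting c :: X).length ≤ N + 1 ∧
        busyServers (Item.waiting c :: X) = V ∧
        (Item.waiting c :: X ++ Y.map Item.busy).Pairwise NoSkip
      · rw [if_pos h]
        obtain ⟨h1, h2, h3⟩ := h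
        rw [List.cons_append, List.pairwise_cons, forall_waiting_noSkip_iff] at h3
        rw [busyServers_waiting_cons] at h2
        have hc : ∀ w ∈ V ++ Y, compat w c = false := by
          intro w hw
          refine h3.1 w ?_
          rw [← mem_busyServers]
          simpa [h2] using hw
        rw [if_pos hc, if_pos ⟨by simpa using h1, h2, h3.2⟩, custWeight, ENNReal.ofReal_mul]
        exact div_nonneg (hlam c).le hM
      · rw [if_neg h]
        exact zero_le
    have hbusy : (if ([] : List (Item n₁ n₂)).length ≤ N + 1 ∧ busyServers [] = V ∧
          ([] ++ Y.map Item.busy).Pairwise NoSkip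
            then ENNReal.ofReal (custWeight lam mu M []) else 0) +
        ∑ v, ∑' X : List (Item n₁ n₂), (if (Item.busy v :: X).length ≤ N + 1 ∧
        busyServers (Item.busy v :: X) = V ∧
        (Item.busy v :: X ++ Y.map Item.busy).Pairwise NoSkip
          then ENNReal.ofReal (custWeight lam mu M (Item.busy v :: X)) else 0) ≤
        ENNReal.ofReal (custWeight lam mu M (V.map Item.busy) *
          κ ^ (tailLength (V ++ Y) + if ∀ w ∈ V ++ Y, w.isRight = true then 0 else 1)) := by
      cases V with
      | nil =>
        rw [Finset.sum_eq_zero, add_zero]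
        · simp only [List.map_nil, custWeight, one_mul, List.nil_append]
          refine le_trans ?_ (ENNReal.ofReal_le_ofReal (one_le_pow₀ hκ))
          split_ifs
          exacts [le_rfl, zero_le]
        · intro v _
          simp
      | cons v V =>
        rw [if_neg (by simp), zero_add, Finset.sum_eq_single v]
        · have hv := hmu v
          have hnd' := (List.nodup_cons.mp (by simpa using hnd : (v :: (V ++ Y)).Nodup)).2
          have ih' := ih V hnd' (M := M + mu v) (by positivity) (by
            rw [hMV]
            simp only [List.cons_append, List.map_cons, List.sum_cons]
            ring)
          have hinv : 0 ≤ (M + mu v)⁻¹ := by positivity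
          have htail : tailLength (v :: V ++ Y) +
              (if ∀ w ∈ v :: V ++ Y, w.isRight = true then 0 else 1)
              = tailLength (V ++ Y) + 1 := by
            rw [List.cons_append, tailLength_cons]
            split_ifs <;> rfl
          rw [htail, List.map_cons, custWeight, div_eq_inv_mul, mul_assoc,
            ENNReal.ofReal_mul hinv]
          refine le_trans ?_ (mul_le_mul_right ih' _)
          rw [← ENNReal.tsum_mul_left]
          refine ENNReal.tsum_le_tsum fun X => ?_
          rw [mul_ite, mul_zero, ← ENNReal.ofReal_mul hinv, custWeight, div_eq_inv_mul]
          simp only [List.length_cons, add_le_add_iff_right, busyServers_busy_cons,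
            List.cons.injEq, true_and, List.cons_append, List.pairwise_cons, noSkip_busy_left,
            implies_true]
          exact le_rfl
        · intro w _ hw
          simp [hw]
        · simp
    rw [← add_assoc]
    refine (add_le_add hbusy (add_le_add (hwait Cust.c1) (hwait Cust.c2))).trans ?_
    have hc := hcw hM (V.map Item.busy)
    have hite : ∀ c, 0 ≤ (if ∀ w ∈ V ++ Y, compat w c = false then lam c else 0) := by
      intro c
      split_ifs
      exacts [(hlam c).le, le_rfl]
    have hp : ∀ j : ℕ, 0 ≤ custWeight lam mu M (V.map Item.busy) * κ ^ j :=
      fun j => by positivity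
    rw [← ENNReal.ofReal_add (mul_nonneg (div_nonneg (hite _) hM) (hp _))
      (mul_nonneg (div_nonneg (hite _) hM) (hp _)), ← ENNReal.ofReal_add (hp _)
      (add_nonneg (mul_nonneg (div_nonneg (hite _) hM) (hp _))
      (mul_nonneg (div_nonneg (hite _) hM) (hp _))), ← add_mul, ← add_div]
    refine ENNReal.ofReal_le_ofReal ?_
    change _ + unmetRate lam (V ++ Y) / M * _ ≤ _
    by_cases hR : ∀ w ∈ V ++ Y, w.isRight = true
    · have hle : unmetRate lam (V ++ Y) / M ≤ ρ := by
        -- At `M = 0`, the head of the line, the convention for division by zero makes the ratio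
        -- vanish.
        rcases hM.eq_or_lt with h | h
        · rw [← h, div_zero]; exact hρ
        · rw [div_le_iff₀ h, hMV]
          exact hload _ hnd hR
      rw [if_pos hR, add_zero, pow_succ]
      set t := custWeight lam mu M (V.map Item.busy) * κ ^ tailLength (V ++ Y) with ht
      have ht0 : 0 ≤ t := hp _
      have hκt : custWeight lam mu M (V.map Item.busy) * (κ ^ tailLength (V ++ Y) * κ) = t * κ := by
        rw [ht]
        ring
      rw [hκt]
      have := mul_le_mul_of_nonneg_right hle (mul_nonneg ht0 hκ0)
      nlinarith
    · rw [unmetRate_eq_zero hR, if_neg hR]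
      simp

open scoped Classical in
-- The truncated bound does not depend on the length, and every finite partial sum involves lists of
-- bounded length.
theorem tsum_custWeight_le (hlam : ∀ c, 0 < lam c) (hmu : ∀ v, 0 < mu v) {ρ κ : ℝ}
    (hρ : 0 ≤ ρ) (hκ : 1 ≤ κ) (hρκ : 1 + ρ * κ ≤ κ) (hload : LoadLE lam mu ρ)
    (Y V : List (Server n₁ n₂)) :
    ∑' X : List (Item n₁ n₂), (if busyServers X = V ∧ (⟨X, Y⟩ : Config n₁ n₂).Valid
        then ENNReal.ofReal (custWeight lam mu 0 X) else 0)
      ≤ if (V ++ Y).Nodup ∧ ∀ v, v ∈ V ++ Y then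
        ENNReal.ofReal (custWeight lam mu 0 (V.map Item.busy) * κ ^ (tailLength (V ++ Y) + 1))
        else 0 := by
  by_cases h : (V ++ Y).Nodup ∧ ∀ v, v ∈ V ++ Y
  · rw [if_pos h, ENNReal.tsum_eq_iSup_sum]
    refine iSup_le fun s => ?_
    have hMV : (0 : ℝ) = ∑ v, mu v - ((V ++ Y).map mu).sum := by
      rw [← List.sum_toFinset _ h.1,
        show (V ++ Y).toFinset = Finset.univ by ext v; simpa using h.2 v, sub_self]
    refine le_trans ?_ (tsum_custWeight_le_aux hlam hmu hρ hκ hρκ hload Y (s.sup List.length) V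
      h.1 le_rfl hMV)
    refine le_trans (Finset.sum_le_sum fun X hX => ?_) (ENNReal.sum_le_tsum s)
    by_cases hX' : busyServers X = V ∧ (⟨X, Y⟩ : Config n₁ n₂).Valid
    · rw [if_pos hX', if_pos ⟨Finset.le_sup (f := List.length) hX, hX'.1, hX'.2.noSkip⟩]
    · rw [if_neg hX']
      exact zero_le
  · rw [if_neg h]
    refine (ENNReal.tsum_eq_zero.mpr fun X => if_neg ?_).le
    rintro ⟨rfl, hv⟩
    exact h ⟨hv.nodup, hv.mem_servers⟩

open scoped Classical in
/-- The orders in which a given set of servers can be busy have total weight `∏ 1 / mu v`. -/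
theorem tsum_busy_orders (hmu : ∀ v, 0 < mu v) (S : Finset (Server n₁ n₂)) :
    ∑' V : List (Server n₁ n₂), (if V.Nodup ∧ V.toFinset = S then
      ENNReal.ofReal (custWeight lam mu 0 (V.map Item.busy)) else 0)
      = ENNReal.ofReal (∏ v ∈ S, (mu v)⁻¹) := by
  induction S using Finset.strongInduction with
  | H S ih =>
    rw [tsum_list_concat]
    rcases S.eq_empty_or_nonempty with rfl | hS
    · simp [custWeight]
    · have hne : ([] : List (Server n₁ n₂)).toFinset ≠ S := by simpa using hS.ne_empty.symm
      rw [if_neg fun h => hne h.2, zero_add, tsum_fintype]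
      have hpos : 0 < ∑ v ∈ S, mu v := Finset.sum_pos (fun v _ => hmu v) hS
      -- The last server in the order contributes the inverse of the total rate of `S`, whatever the
      -- order of the others. So the orders ending in `v` carry the fraction `mu v / ∑ mu` of the
      -- claimed total.
      have hterm : ∀ v, ∑' V : List (Server n₁ n₂), (if (V ++ [v]).Nodup ∧
          (V ++ [v]).toFinset = S then
            ENNReal.ofReal (custWeight lam mu 0 ((V ++ [v]).map Item.busy)) else 0)
          = if v ∈ S then
            ENNReal.ofReal ((∑ v ∈ S, mu v)⁻¹ * (mu v * ∏ v ∈ S, (mu v)⁻¹)) else 0 := by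
        intro v
        by_cases hv : v ∈ S
        · have hprod : mu v * ∏ v ∈ S, (mu v)⁻¹ = ∏ v ∈ S.erase v, (mu v)⁻¹ := by
            rw [← Finset.mul_prod_erase S _ hv, mul_inv_cancel_left₀ (hmu v).ne']
          rw [if_pos hv, hprod, ENNReal.ofReal_mul (by positivity), ← ih _ (Finset.erase_ssubset hv),
            ← ENNReal.tsum_mul_left]
          refine tsum_congr fun V => ?_
          have hiff : ((V ++ [v]).Nodup ∧ (V ++ [v]).toFinset = S) ↔
              (V.Nodup ∧ V.toFinset = S.erase v) := by
            rw [← List.concat_eq_append, List.nodup_concat]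
            constructor
            · rintro ⟨⟨h1, h2⟩, rfl⟩
              refine ⟨h2, ?_⟩
              ext w
              simp only [List.concat_eq_append, List.toFinset_append, Finset.mem_erase,
                Finset.mem_union, List.mem_toFinset, List.mem_singleton]
              grind
            · rintro ⟨h1, h2⟩
              refine ⟨⟨?_, h1⟩, ?_⟩
              · rw [← List.mem_toFinset, h2]
                simp
              · rw [List.concat_eq_append, List.toFinset_append, h2]
                ext w
                simp only [Finset.mem_union, Finset.mem_erase, List.mem_toFinset,
                  List.mem_singleton]
                grind
          by_cases h : (V ++ [v]).Nodup ∧ (V ++ [v]).toFinset = S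
          · rw [if_pos h, if_pos (hiff.mp h), ← ENNReal.ofReal_mul (by positivity),
              List.map_append, custWeight_append]
            have hsum : busyRate mu (V.map Item.busy) + mu v = ∑ v ∈ S, mu v := by
              rw [← h.2, List.sum_toFinset _ h.1]
              simp [busyRate]
            simp only [List.map_cons, List.map_nil, custWeight, zero_add, hsum]
            congr 1
            ring
          · rw [if_neg h, if_neg fun h' => h (hiff.mpr h'), mul_zero]
        · rw [if_neg hv, ENNReal.tsum_eq_zero]
          intro V
          rw [if_neg]
          rintro ⟨-, rfl⟩
          simp at hv
      simp only [hterm]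
      rw [Finset.sum_ite_mem, Finset.univ_inter, ← ENNReal.ofReal_sum_of_nonneg, ← Finset.mul_sum,
        ← Finset.sum_mul, inv_mul_cancel_left₀ hpos.ne']
      intro v _
      have := (hmu v).le
      have : 0 ≤ ∏ v ∈ S, (mu v)⁻¹ := Finset.prod_nonneg fun v _ => inv_nonneg.mpr (hmu v).le
      positivity

end Mass

end NSystem
namespace NSystem

variable {n₁ n₂ : ℕ}

open scoped Classical in
theorem tsum_state (F : Config n₁ n₂ → ENNReal) :
    ∑' s : State n₁ n₂, F s.1 = ∑' (Y : List (Server n₁ n₂)) (X : List (Item n₁ n₂)),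
      if (⟨X, Y⟩ : Config n₁ n₂).Valid then F ⟨X, Y⟩ else 0 := by
  let e : List (Server n₁ n₂) × List (Item n₁ n₂) ≃ Config n₁ n₂ :=
    ⟨fun x => ⟨x.2, x.1⟩, fun s => (s.idle, s.customers), fun _ => rfl, fun _ => rfl⟩
  have h1 : ∑' s : State n₁ n₂, F s.1 =
      ∑' s : Config n₁ n₂, {s : Config n₁ n₂ | s.Valid}.indicator F s :=
    tsum_subtype {s : Config n₁ n₂ | s.Valid} F
  rw [h1, ← e.tsum_eq, ← ENNReal.tsum_prod (f := fun Y X =>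
    if (⟨X, Y⟩ : Config n₁ n₂).Valid then F ⟨X, Y⟩ else 0)]
  refine tsum_congr fun x => ?_
  rw [Set.indicator_apply]
  rfl

open scoped Classical in
theorem tsum_by_fiber {α β : Type*} (g : α → β) (F : α → ENNReal) :
    ∑' a, F a = ∑' b, ∑' a, if g a = b then F a else 0 := by
  rw [ENNReal.tsum_comm]
  refine tsum_congr fun a => ?_
  simp only [@eq_comm _ (g a)]
  exact (tsum_ite_eq (g a) fun _ => F a).symm

theorem nodup_full_iff {V Y : List (Server n₁ n₂)} (hY : Y.Nodup) :
    ((V ++ Y).Nodup ∧ ∀ v, v ∈ V ++ Y) ↔ V.Nodup ∧ V.toFinset = Finset.univ \ Y.toFinset := by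
  rw [List.nodup_append]
  constructor
  · rintro ⟨⟨h1, -, h2⟩, h3⟩
    refine ⟨h1, ?_⟩
    ext v
    have := h3 v
    simp only [List.mem_append] at this
    simp only [List.mem_toFinset, Finset.mem_sdiff, Finset.mem_univ, true_and]
    grind
  · rintro ⟨h1, h2⟩
    have h3 : ∀ v, v ∈ V ↔ v ∉ Y := by
      intro v
      rw [← List.mem_toFinset, h2]
      simp
    refine ⟨⟨h1, hY, ?_⟩, ?_⟩
    · intro a ha b hb hab
      exact (h3 a).mp ha (hab ▸ hb)
    · intro v
      rw [List.mem_append, h3]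
      tauto

theorem length_le_tailLength {Y : List (Server n₁ n₂)} (hY : ∀ w ∈ Y, w.isRight = true)
    (V : List (Server n₁ n₂)) : Y.length ≤ tailLength (V ++ Y) := by
  induction V with
  | nil =>
    rw [List.nil_append, tailLength, List.takeWhile_eq_self_iff.mpr (by simpa using hY),
      List.length_reverse]
  | cons v V ih =>
    rw [List.cons_append, tailLength_cons]
    omega

/-! ### Mass of the states with a given idle list. -/

section Mass

variable {lam : Cust → ℝ} {mu : Server n₁ n₂ → ℝ}

theorem prod_compl (hmu : ∀ v, 0 < mu v) {Y : List (Server n₁ n₂)} (hY : Y.Nodup) :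
    ∏ v ∈ Finset.univ \ Y.toFinset, (mu v)⁻¹ = (∏ v, (mu v)⁻¹) * (Y.map mu).prod := by
  rw [← Finset.prod_sdiff (Finset.subset_univ Y.toFinset), mul_assoc, ← List.prod_toFinset _ hY,
    ← Finset.prod_mul_distrib, Finset.prod_eq_one (s := Y.toFinset), mul_one]
  exact fun v _ => inv_mul_cancel₀ (hmu v).ne'

theorem ofReal_weight (hlam : ∀ c, 0 < lam c) (s : Config n₁ n₂) :
    ENNReal.ofReal (weight lam mu s) = ENNReal.ofReal (idleWeight lam s.idle) *
      ENNReal.ofReal (custWeight lam mu 0 s.customers) := by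
  rw [weight, mul_comm, ENNReal.ofReal_mul (idleWeight_pos hlam _).le]

open scoped Classical in
/-- The total weight of the states with idle list `Y` containing an `s₁` server. -/
theorem tsum_weight_idle (hlam : ∀ c, 0 < lam c) (hmu : ∀ v, 0 < mu v)
    {Y : List (Server n₁ n₂)} (hY : Y.Nodup) {i : Fin n₁} (hi : Sum.inl i ∈ Y) :
    ∑' s : State n₁ n₂, (if s.1.idle = Y then ENNReal.ofReal (weight lam mu s.1) else 0)
      = ENNReal.ofReal ((∏ v, (mu v)⁻¹) * (idleWeight lam Y * (Y.map mu).prod)) := by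
  rw [tsum_state fun s => if s.idle = Y then ENNReal.ofReal (weight lam mu s) else 0,
    tsum_eq_single Y]
  · rw [mul_left_comm, ← prod_compl hmu hY, ENNReal.ofReal_mul (idleWeight_pos hlam Y).le,
      ← tsum_busy_orders (lam := lam) hmu, ← ENNReal.tsum_mul_left, tsum_by_fiber busyServers]
    refine tsum_congr fun V => ?_
    -- An idle `s₁` server could serve any waiting customer, so every customer is in service.
    rw [tsum_eq_single (V.map Item.busy)]
    · rw [busyServers_map_busy, if_pos rfl, if_pos rfl, ofReal_weight hlam, mul_ite, mul_zero]
      refine if_congr ?_ rfl rfl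
      rw [valid_iff, ← nodup_full_iff hY]
      simp only [Config.servers, busyServers_map_busy]
      have h1 : (V.map Item.busy).Pairwise (NoSkip (n₁ := n₁) (n₂ := n₂)) := by
        rw [List.pairwise_map]
        exact List.pairwise_of_forall (by simp)
      simp [h1]
    · intro X hX
      by_cases hXV : busyServers X = V
      · rw [if_pos hXV, if_neg]
        intro hval
        apply hX
        rw [← hXV]
        have hw : ∀ x ∈ X, ∃ v, x = Item.busy v := by
          intro x hx
          cases x with
          | busy v => exact ⟨v, rfl⟩
          | waiting c =>
            have := ((valid_iff _).mp hval).2.2.2 c hx _ hi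
            simp [compat] at this
        clear hX hXV hval
        induction X with
        | nil => rfl
        | cons x X ih =>
          obtain ⟨v, rfl⟩ := hw x (by simp)
          rw [busyServers_busy_cons, List.map_cons, ← ih fun x hx => hw x (by simp [hx])]
      · rw [if_neg hXV]
  · intro Y' hY'
    simp [hY']

open scoped Classical in
/-- A bound for the weight of the states with idle list `Y`. -/
theorem tsum_weight_idle_le (hlam : ∀ c, 0 < lam c) (hmu : ∀ v, 0 < mu v) {ρ κ : ℝ}
    (hρ : 0 ≤ ρ) (hκ : 1 ≤ κ) (hρκ : 1 + ρ * κ ≤ κ) (hload : LoadLE lam mu ρ)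
    (Y : List (Server n₁ n₂)) (k : ℕ) :
    ∑' s : State n₁ n₂, (if s.1.idle = Y ∧ tailLength s.1.servers ≤ k
        then ENNReal.ofReal (weight lam mu s.1) else 0)
      ≤ if Y.Nodup then ENNReal.ofReal (κ ^ (k + 1) *
          ((∏ v, (mu v)⁻¹) * (idleWeight lam Y * (Y.map mu).prod))) else 0 := by
  have hκ0 : 0 ≤ κ := by linarith
  rw [tsum_state fun s => if s.idle = Y ∧ tailLength s.servers ≤ k
        then ENNReal.ofReal (weight lam mu s) else 0, tsum_eq_single Y]
  · by_cases hY : Y.Nodup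
    · have hI := (idleWeight_pos hlam Y).le
      rw [if_pos hY, mul_left_comm (∏ v, _), ← prod_compl hmu hY, mul_left_comm,
        ENNReal.ofReal_mul hI, ENNReal.ofReal_mul (by positivity),
        ← tsum_busy_orders (lam := lam) hmu, ← ENNReal.tsum_mul_left, ← ENNReal.tsum_mul_left,
        tsum_by_fiber busyServers]
      refine ENNReal.tsum_le_tsum fun V => ?_
      by_cases hk : tailLength (V ++ Y) ≤ k
      · have hle := tsum_custWeight_le hlam hmu hρ hκ hρκ hload Y V
        refine le_trans ?_ ((mul_le_mul_right hle (ENNReal.ofReal (idleWeight lam Y))).trans ?_)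
        · rw [← ENNReal.tsum_mul_left]
          refine ENNReal.tsum_le_tsum fun X => ?_
          by_cases hX : busyServers X = V
          · subst hX
            simp only [true_and, if_true, ofReal_weight hlam, mul_ite, mul_zero]
            split_ifs <;> simp
          · simp [hX]
        · refine mul_le_mul_right ?_ _
          simp only [nodup_full_iff hY]
          split_ifs
          · rw [← ENNReal.ofReal_mul (by positivity), mul_comm]
            refine ENNReal.ofReal_le_ofReal (mul_le_mul_of_nonneg_right ?_
              (custWeight_nonneg hlam hmu le_rfl _))
            exact pow_le_pow_right₀ hκ (by omega)
          · exact zero_le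
      · refine le_trans (le_of_eq (ENNReal.tsum_eq_zero.mpr fun X => ?_)) zero_le
        by_cases hX : busyServers X = V
        · subst hX
          simp [Config.servers, hk]
        · simp [hX]
    · rw [if_neg hY]
      refine (ENNReal.tsum_eq_zero.mpr fun X => if_neg fun hval => hY ?_).le
      exact (List.nodup_append.mp hval.nodup).2.1
  · intro Y' hY'
    simp [hY']

/-- There are finitely many idle lists without repetition, each of finite mass. Since `tailLength`
never exceeds the number of servers, the bound with `k = n₁ + n₂` covers all states. -/
theorem tsum_weight_ne_top (hlam : ∀ c, 0 < lam c) (hmu : ∀ v, 0 < mu v) {ρ κ : ℝ}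
    (hρ : 0 ≤ ρ) (hκ : 1 ≤ κ) (hρκ : 1 + ρ * κ ≤ κ) (hload : LoadLE lam mu ρ) :
    ∑' s : State n₁ n₂, ENNReal.ofReal (weight lam mu s.1) ≠ ⊤ := by
  classical
  have hle : ∑' s : State n₁ n₂, ENNReal.ofReal (weight lam mu s.1) ≤
      ∑' Y : List (Server n₁ n₂), if Y.Nodup then ENNReal.ofReal (κ ^ (n₁ + n₂ + 1) *
          ((∏ v, (mu v)⁻¹) * (idleWeight lam Y * (Y.map mu).prod))) else 0 := by
    rw [tsum_by_fiber fun s : State n₁ n₂ => s.1.idle]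
    refine ENNReal.tsum_le_tsum fun Y => ?_
    refine le_trans (le_of_eq (tsum_congr fun s => ?_))
      (tsum_weight_idle_le hlam hmu hρ hκ hρκ hload Y (n₁ + n₂))
    have : tailLength s.1.servers ≤ n₁ + n₂ := by
      refine (tailLength_le _).trans (s.2.nodup.length_le_card.trans ?_)
      simp
    simp [this]
  refine ne_top_of_le_ne_top ?_ hle
  have hfin : {Y : List (Server n₁ n₂) | Y.Nodup}.Finite :=
    (Set.finite_coe_iff (s := {Y : List (Server n₁ n₂) | Y.Nodup})).mp
      (Finite.of_fintype {Y : List (Server n₁ n₂) // Y.Nodup})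
  rw [tsum_eq_sum (s := hfin.toFinset)]
  · refine ENNReal.sum_ne_top.mpr fun Y _ => ?_
    split_ifs <;> simp
  · intro Y hY
    rw [if_neg]
    simpa using hY

theorem idleWeight_of_isRight {Y : List (Server n₁ n₂)} (hY : ∀ w ∈ Y, w.isRight = true) :
    idleWeight lam Y = (lam Cust.c1)⁻¹ ^ Y.length := by
  induction Y with
  | nil => simp [idleWeight]
  | cons y Y ih =>
    have h1 : pooledRate lam (y :: Y) = lam Cust.c1 := by
      have : ∀ w ∈ y :: Y, compat w Cust.c2 = false := by
        intro w hw
        have := hY w hw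
        rcases w with w | w
        · simp at this
        · rfl
      rw [pooledRate, if_pos this, if_neg, add_zero]
      intro h
      simpa [compat_c1] using h y (by simp)
    rw [idleWeight, h1, ih fun w hw => hY w (by simp [hw]), List.length_cons, pow_succ,
      div_eq_mul_inv]

open scoped Classical in
/-- The total weight of the words of length at most `k` in the `s₂` servers. -/
theorem tsum_isRight_words_le (x : ENNReal) (k : ℕ) :
    ∑' Y : List (Server n₁ n₂), (if (∀ w ∈ Y, w.isRight = true) ∧ Y.length ≤ k
        then x ^ Y.length else 0) ≤ (1 + n₂ * x) ^ k := by
  induction k with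
  | zero =>
    rw [tsum_eq_single []]
    · simp
    · intro Y hY
      rw [if_neg]
      rintro ⟨-, h⟩
      exact hY (List.length_eq_zero_iff.mp (Nat.le_zero.mp h))
  | succ k ih =>
    rw [tsum_list, tsum_fintype]
    have hterm : ∀ v : Server n₁ n₂, ∑' Y : List (Server n₁ n₂),
        (if (∀ w ∈ v :: Y, w.isRight = true) ∧ (v :: Y).length ≤ k + 1
          then x ^ (v :: Y).length else 0) ≤ if v.isRight = true then x * (1 + n₂ * x) ^ k else 0 := by
      intro v
      by_cases hv : v.isRight = true
      · rw [if_pos hv]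
        refine le_trans (le_of_eq ?_) (mul_le_mul_right ih x)
        rw [← ENNReal.tsum_mul_left]
        refine tsum_congr fun Y => ?_
        simp only [List.mem_cons, forall_eq_or_imp, hv, true_and, List.length_cons,
          add_le_add_iff_right, mul_ite, mul_zero, pow_succ']
      · rw [if_neg hv]
        refine (ENNReal.tsum_eq_zero.mpr fun Y => if_neg ?_).le
        simp [hv]
    refine (add_le_add le_rfl (Finset.sum_le_sum fun v _ => hterm v)).trans ?_
    have hsum : ∑ v : Server n₁ n₂, (if v.isRight = true then x * (1 + n₂ * x) ^ k else 0)
        = n₂ * (x * (1 + n₂ * x) ^ k) := by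
      rw [Fintype.sum_sum_type]
      simp
    rw [hsum, pow_succ', add_mul, one_mul, mul_assoc]
    refine add_le_add ?_ le_rfl
    simpa using one_le_pow₀ (n := k) (le_self_add : (1 : ENNReal) ≤ 1 + n₂ * x)

open scoped Classical in
/-- A bound for the weight of the states with no idle `s₁` server and `K = k`. -/
theorem tsum_weight_noLeft_le (hlam : ∀ c, 0 < lam c) (hmu : ∀ v, 0 < mu v) {ρ κ m : ℝ}
    (hρ : 0 ≤ ρ) (hκ : 1 ≤ κ) (hρκ : 1 + ρ * κ ≤ κ) (hload : LoadLE lam mu ρ)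
    (hm0 : 0 < m) (hm : ∀ j, mu (Sum.inr j) = m) (k : ℕ) :
    ∑' s : State n₁ n₂, (if (∀ w ∈ s.1.idle, w.isRight = true) ∧ tailLength s.1.servers = k
        then ENNReal.ofReal (weight lam mu s.1) else 0)
      ≤ ENNReal.ofReal (κ ^ (k + 1) * ((∏ v, (mu v)⁻¹) * (1 + n₂ * (m / lam Cust.c1)) ^ k)) := by
  have hκ0 : 0 ≤ κ := by linarith
  have h1 := hlam Cust.c1
  have hC : 0 ≤ ∏ v, (mu v)⁻¹ := Finset.prod_nonneg fun v _ => inv_nonneg.mpr (hmu v).le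
  have hx : (0 : ℝ) ≤ m / lam Cust.c1 := by positivity
  rw [tsum_by_fiber fun s : State n₁ n₂ => s.1.idle, ← mul_assoc, ENNReal.ofReal_mul (by positivity),
    ENNReal.ofReal_pow (by positivity), ENNReal.ofReal_add zero_le_one (by positivity),
    ENNReal.ofReal_one, ENNReal.ofReal_mul (Nat.cast_nonneg _), ENNReal.ofReal_natCast]
  refine le_trans ?_ (mul_le_mul_right (tsum_isRight_words_le (n₁ := n₁) _ k) _)
  rw [← ENNReal.tsum_mul_left]
  refine ENNReal.tsum_le_tsum fun Y => ?_
  by_cases hY : (∀ w ∈ Y, w.isRight = true) ∧ Y.length ≤ k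
  · rw [if_pos hY]
    have hmap : (Y.map mu).prod = m ^ Y.length := by
      have : Y.map mu = Y.map fun _ => m := by
        refine List.map_congr_left fun w hw => ?_
        have := hY.1 w hw
        cases w <;> simp_all
      rw [this, List.map_const', List.prod_replicate]
    refine le_trans (ENNReal.tsum_le_tsum fun s => ?_)
      ((tsum_weight_idle_le hlam hmu hρ hκ hρκ hload Y k).trans ?_)
    · by_cases h1 : s.1.idle = Y
      · by_cases h2 : (∀ w ∈ s.1.idle, w.isRight = true) ∧ tailLength s.1.servers = k
        · rw [if_pos h1, if_pos h2, if_pos ⟨h1, h2.2.le⟩]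
        · rw [if_pos h1, if_neg h2]
          exact zero_le
      · rw [if_neg h1]
        exact zero_le
    · split_ifs
      · rw [idleWeight_of_isRight hY.1, hmap, ← ENNReal.ofReal_pow hx,
          ← ENNReal.ofReal_mul (by positivity)]
        refine ENNReal.ofReal_le_ofReal (le_of_eq ?_)
        rw [div_pow, inv_pow]
        ring
      · exact zero_le
  · refine le_trans (le_of_eq (ENNReal.tsum_eq_zero.mpr fun s => ?_)) zero_le
    by_cases h1 : s.1.idle = Y
    · rw [if_pos h1, if_neg]
      rintro ⟨h2, h3⟩
      -- Without an idle `s₁` server the whole idle list follows the last `s₁` server, so its length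
      -- is at most `k`.
      refine hY ⟨h1 ▸ h2, ?_⟩
      rw [← h3, Config.servers, h1]
      exact length_le_tailLength (h1 ▸ h2) _
    · rw [if_neg h1]

theorem weight_emptyState_pos (hlam : ∀ c, 0 < lam c) (mu : Server n₁ n₂ → ℝ) :
    0 < weight lam mu (emptyState n₁ n₂).1 := by
  simp only [emptyState, weight, custWeight, one_mul]
  exact idleWeight_pos hlam _

end Mass

/-- The product form, normalized. -/
theorem exists_isStationary (hn : 0 < n₁) {lam₁ lam₂ mu₁ mu₂ : ℝ} (h1 : 0 < lam₁) (h2 : 0 < lam₂)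
    (hmu₁ : 0 < mu₁) (hmu₂ : 0 < mu₂) {ρ κ : ℝ} (hρ : 0 ≤ ρ) (hκ : 1 ≤ κ) (hρκ : 1 + ρ * κ ≤ κ)
    (hload : LoadLE (n₁ := n₁) (n₂ := n₂) (custRate lam₁ lam₂) (serviceRate mu₁ mu₂) ρ) :
    ∃ p : PMF (State n₁ n₂), IsStationary lam₁ lam₂ mu₁ mu₂ p ∧ ∃ z : ENNReal, z ≠ 0 ∧ z ≠ ⊤ ∧
      ∀ s, p s = ENNReal.ofReal (weight (custRate lam₁ lam₂) (serviceRate mu₁ mu₂) s.1) * z := by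
  have hmu : ∀ v : Server n₁ n₂, 0 < serviceRate mu₁ mu₂ v := by
    rintro (_ | _)
    exacts [hmu₁, hmu₂]
  have hlam : ∀ c, 0 < custRate lam₁ lam₂ c := by
    rintro (_ | _)
    exacts [h1, h2]
  let f : State n₁ n₂ → ENNReal :=
    fun s => ENNReal.ofReal (weight (custRate lam₁ lam₂) (serviceRate mu₁ mu₂) s.1)
  have hf1 : ∑' s, f s ≠ ⊤ := tsum_weight_ne_top hlam hmu hρ hκ hρκ hload
  have hf0 : ∑' s, f s ≠ 0 := by
    intro h
    have := ENNReal.tsum_eq_zero.mp h (emptyState n₁ n₂)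
    exact absurd (weight_emptyState_pos hlam (serviceRate mu₁ mu₂))
      (not_lt.mpr (ENNReal.ofReal_eq_zero.mp this))
  refine ⟨PMF.normalize f hf0 hf1, ?_, (∑' s, f s)⁻¹, ENNReal.inv_ne_zero.mpr hf1,
    ENNReal.inv_ne_top.mpr hf0, fun s => PMF.normalize_apply hf0 hf1 s⟩
  intro s'
  simp only [PMF.normalize_apply]
  have := weight_balance hn h1 h2 hmu₁ hmu₂ s'
  simp_rw [mul_right_comm _ (∑' s, f s)⁻¹]
  rw [ENNReal.tsum_mul_right, ← this]

end NSystem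
namespace NSystem

variable {n₁ n₂ : ℕ}

/-! ### Sums over words without repetition -/

section Words

variable {α : Type*} [DecidableEq α]

/-- The words without repetition whose set of letters belongs to `𝒞`. -/
noncomputable def words (𝒞 : Finset (Finset α)) : Finset (List α) :=
  𝒞.biUnion fun B => B.toList.permutations.toFinset

theorem mem_permutations_toList {B : Finset α} {l : List α} :
    l ∈ B.toList.permutations.toFinset ↔ l.Nodup ∧ l.toFinset = B := by
  rw [List.mem_toFinset, List.mem_permutations]
  constructor
  · intro h
    refine ⟨h.nodup_iff.mpr B.nodup_toList, ?_⟩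
    rw [List.toFinset_eq_of_perm _ _ h, Finset.toList_toFinset]
  · rintro ⟨h1, rfl⟩
    exact (List.toFinset_toList h1).symm

theorem mem_words {𝒞 : Finset (Finset α)} {l : List α} :
    l ∈ words 𝒞 ↔ l.Nodup ∧ l.toFinset ∈ 𝒞 := by
  simp only [words, Finset.mem_biUnion, mem_permutations_toList]
  constructor
  · rintro ⟨B, hB, h1, rfl⟩
    exact ⟨h1, hB⟩
  · rintro ⟨h1, h2⟩
    exact ⟨_, h2, h1, rfl⟩

theorem card_permutations_toList (B : Finset α) :
    B.toList.permutations.toFinset.card = B.card.factorial := by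
  rw [List.toFinset_card_of_nodup (List.nodup_permutations _ B.nodup_toList),
    List.length_permutations, Finset.length_toList]

theorem sum_words {M : Type*} [AddCommMonoid M] (𝒞 : Finset (Finset α)) (f : List α → M) :
    ∑ l ∈ words 𝒞, f l = ∑ B ∈ 𝒞, ∑ l ∈ B.toList.permutations.toFinset, f l := by
  refine Finset.sum_biUnion fun B _ B' _ hBB' => ?_
  refine Finset.disjoint_left.mpr fun l hl hl' => hBB' ?_
  rw [← (mem_permutations_toList.mp hl).2, ← (mem_permutations_toList.mp hl').2]

theorem card_words_powersetCard (S : Finset α) (k : ℕ) :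
    (words (S.powersetCard k)).card = S.card.descFactorial k := by
  rw [Finset.card_eq_sum_ones, sum_words]
  simp only [Finset.sum_const, smul_eq_mul, mul_one, card_permutations_toList]
  rw [Finset.sum_congr rfl fun B hB => by rw [(Finset.mem_powersetCard.mp hB).2],
    Finset.sum_const, Finset.card_powersetCard, Nat.descFactorial_eq_factorial_mul_choose,
    smul_eq_mul, mul_comm]

theorem integrableOn_exp_neg_mul_pow (m : ℕ) :
    IntegrableOn (fun t : ℝ => Real.exp (-t) * t ^ m) (Set.Ioi 0) := by
  have h := Real.GammaIntegral_convergent (s := m + 1) (by positivity)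
  simpa using h

theorem integral_exp_neg_mul_pow (m : ℕ) :
    ∫ t : ℝ in Set.Ioi 0, Real.exp (-t) * t ^ m = m.factorial := by
  rw [← Real.Gamma_nat_eq_factorial, Real.Gamma_eq_integral (by positivity)]
  simp

/-- A set `B` of letters has `|B|!` words, all with the same product. Writing `|B|!` as `∫ e⁻ᵗ t^|B|
dt`, the sum over the subsets of `S` becomes the expansion of `∏ (1 + t x_v)`. -/
theorem sum_words_powerset (S : Finset α) (x : α → ℂ) :
    ∑ l ∈ words S.powerset, (l.map x).prod
      = ∫ t : ℝ in Set.Ioi 0, (Real.exp (-t) : ℂ) * ∏ v ∈ S, (1 + t * x v) := by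
  have h1 : ∀ t : ℝ, (Real.exp (-t) : ℂ) * ∏ v ∈ S, (1 + t * x v) =
      ∑ B ∈ S.powerset, ((Real.exp (-t) * t ^ B.card : ℝ) : ℂ) * ∏ v ∈ B, x v := by
    intro t
    rw [Finset.prod_one_add, Finset.mul_sum]
    refine Finset.sum_congr rfl fun B _ => ?_
    rw [Finset.prod_mul_distrib, Finset.prod_const]
    push_cast
    ring
  simp only [h1]
  rw [integral_finsetSum, sum_words]
  · refine Finset.sum_congr rfl fun B _ => ?_
    rw [integral_mul_const, integral_complex_ofReal, integral_exp_neg_mul_pow,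
      Finset.sum_congr rfl (g := fun _ => ∏ v ∈ B, x v), Finset.sum_const,
      card_permutations_toList, nsmul_eq_mul]
    · simp
    · intro l hl
      obtain ⟨h2, rfl⟩ := mem_permutations_toList.mp hl
      rw [List.prod_toFinset _ h2]
  · intro B _
    exact ((integrableOn_exp_neg_mul_pow B.card).ofReal).mul_const _

end Words

/-! ### The states with an idle `s₁` server and `K = k` -/

/-- The idle list with last `s₁` server `i`, preceded by `l` and followed by `t`. -/
def idleList (i : Fin n₁) (t l : List (Server n₁ n₂)) : List (Server n₁ n₂) :=
  l ++ Sum.inl i :: t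

/-- The `s₂` servers. -/
def rights (n₁ n₂ : ℕ) : Finset (Server n₁ n₂) := Finset.univ.filter fun v => v.isRight = true

theorem card_rights : (rights n₁ n₂).card = n₂ := by
  rw [rights, Finset.card_filter, Fintype.sum_sum_type]
  simp

/-- The servers that do not occur in `inl i :: t`. -/
def others (i : Fin n₁) (t : List (Server n₁ n₂)) : Finset (Server n₁ n₂) :=
  Finset.univ \ (Sum.inl i :: t).toFinset

/-- The indices of the idle lists with an `s₁` server and `K = k`. -/
noncomputable def idleIndex (n₁ n₂ k : ℕ) :
    Finset ((_ : Fin n₁ × List (Server n₁ n₂)) × List (Server n₁ n₂)) :=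
  (Finset.univ ×ˢ words ((rights n₁ n₂).powersetCard k)).sigma
    fun d => words (others d.1 d.2).powerset

theorem mem_idleIndex {k : ℕ} {i : Fin n₁} {t l : List (Server n₁ n₂)} :
    (⟨(i, t), l⟩ : (_ : Fin n₁ × List (Server n₁ n₂)) × List (Server n₁ n₂)) ∈ idleIndex n₁ n₂ k ↔
      (idleList i t l).Nodup ∧ (∀ w ∈ t, w.isRight = true) ∧ t.length = k := by
  simp only [idleIndex, Finset.mem_sigma, Finset.mem_product, Finset.mem_univ, true_and, mem_words,
    Finset.mem_powersetCard, Finset.mem_powerset, idleList, List.nodup_append, List.nodup_cons]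
  constructor
  · rintro ⟨⟨h1, h2, h3⟩, h4, h5⟩
    have ht : ∀ w ∈ t, w.isRight = true := fun w hw => by
      simpa [rights] using h2 (List.mem_toFinset.mpr hw)
    refine ⟨⟨h4, ⟨fun h => by simpa using ht _ h, h1⟩, ?_⟩, ht, ?_⟩
    · intro a ha b hb hab
      have := h5 (List.mem_toFinset.mpr ha)
      rw [others, Finset.mem_sdiff, List.mem_toFinset] at this
      exact this.2 (hab ▸ hb)
    · rw [← h3, List.toFinset_card_of_nodup h1]
  · rintro ⟨⟨h1, ⟨h2, h3⟩, h4⟩, h5, h6⟩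
    refine ⟨⟨h3, ?_, ?_⟩, h1, ?_⟩
    · intro w hw
      simpa [rights] using h5 w (List.mem_toFinset.mp hw)
    · rw [List.toFinset_card_of_nodup h3, h6]
    · intro w hw
      rw [others, Finset.mem_sdiff, List.mem_toFinset]
      exact ⟨Finset.mem_univ _, fun h => h4 w (List.mem_toFinset.mp hw) w h rfl⟩

theorem tailLength_append_cons_inl {t : List (Server n₁ n₂)} (ht : ∀ w ∈ t, w.isRight = true)
    (l : List (Server n₁ n₂)) (i : Fin n₁) :
    tailLength (l ++ Sum.inl i :: t) = t.length := by
  have h : ∀ w ∈ t.reverse, w.isRight = true := by simpa using ht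
  rw [tailLength, List.reverse_append, List.reverse_cons, List.append_assoc,
    List.takeWhile_append_of_pos h]
  simp

theorem exists_last_inl (Y : List (Server n₁ n₂)) :
    (∀ w ∈ Y, w.isRight = true) ∨
      ∃ l i t, Y = l ++ Sum.inl i :: t ∧ ∀ w ∈ t, w.isRight = true := by
  induction Y with
  | nil => simp
  | cons y Y ih =>
    rcases ih with h | ⟨l, i, t, rfl, ht⟩
    · rcases y with i | j
      · exact Or.inr ⟨[], i, Y, rfl, h⟩
      · left
        intro w hw
        rcases List.mem_cons.mp hw with rfl | hw
        exacts [rfl, h w hw]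
    · exact Or.inr ⟨y :: l, i, t, rfl, ht⟩

theorem State.K_eq (s : State n₁ n₂) : s.K = tailLength s.1.servers := rfl

/-- If an `s₁` server is idle, then `K` can be read off the idle list, and the mass is known
exactly; the remaining states are only bounded. -/
theorem setOf_K_eq (k : ℕ) :
    {s : State n₁ n₂ | s.K = k} =
      (⋃ x ∈ idleIndex n₁ n₂ k, {s | s.1.idle = idleList x.1.1 x.1.2 x.2}) ∪
        {s | (∀ w ∈ s.1.idle, w.isRight = true) ∧ tailLength s.1.servers = k} := by
  ext s
  simp only [Set.mem_ofPred_eq, Set.mem_union, Set.mem_iUnion, State.K_eq]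
  constructor
  · intro hk
    rcases exists_last_inl s.1.idle with h | ⟨l, i, t, h, ht⟩
    · exact Or.inr ⟨h, hk⟩
    · refine Or.inl ⟨⟨(i, t), l⟩, mem_idleIndex.mpr ⟨?_, ht, ?_⟩, h⟩
      · rw [idleList, ← h]
        exact (List.nodup_append.mp s.2.nodup).2.1
      · rw [← hk, Config.servers, h, ← List.append_assoc, tailLength_append_cons_inl ht]
  · rintro (⟨⟨⟨i, t⟩, l⟩, hx, h⟩ | h)
    · obtain ⟨-, ht, rfl⟩ := mem_idleIndex.mp hx
      rw [Config.servers, h, idleList, ← List.append_assoc, tailLength_append_cons_inl ht]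
    · exact h.2

theorem idleList_injOn (k : ℕ) :
    Set.InjOn (fun x : (_ : Fin n₁ × List (Server n₁ n₂)) × List (Server n₁ n₂) =>
      idleList x.1.1 x.1.2 x.2) (idleIndex n₁ n₂ k) := by
  rintro ⟨⟨i, t⟩, l⟩ hx ⟨⟨i', t'⟩, l'⟩ hx' h
  have h1 := (mem_idleIndex.mp hx).2.2
  have h2 := (mem_idleIndex.mp hx').2.2
  obtain ⟨rfl, h3⟩ := List.append_inj' h (by simp [h1, h2])
  simp only [List.cons.injEq, Sum.inl.injEq] at h3
  obtain ⟨rfl, rfl⟩ := h3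
  rfl

section Sum

variable {lam₁ lam₂ mu₁ mu₂ : ℝ}

/-- Each server up to the last idle `s₁` server has an `s₁` server at or behind it, so its pooled
rate is the total arrival rate; those behind see only type `c1`. -/
theorem idleWeight_idleList {i : Fin n₁} {t : List (Server n₁ n₂)}
    (ht : ∀ w ∈ t, w.isRight = true) (l : List (Server n₁ n₂)) :
    idleWeight (custRate lam₁ lam₂) (idleList i t l) =
      (lam₁ + lam₂)⁻¹ ^ (l.length + 1) * lam₁⁻¹ ^ t.length := by
  have hp : ∀ l : List (Server n₁ n₂), pooledRate (custRate lam₁ lam₂) (l ++ Sum.inl i :: t)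
      = lam₁ + lam₂ := by
    intro l
    rw [pooledRate, if_neg, if_neg]
    · rfl
    all_goals
      intro h
      simpa [compat] using h (Sum.inl i) (by simp)
  induction l with
  | nil =>
    have := hp []
    simp only [List.nil_append] at this
    rw [idleList, List.nil_append, idleWeight, this, idleWeight_of_isRight ht, custRate]
    simp only [List.length_nil, zero_add, pow_one]
    ring
  | cons v l ih =>
    have := hp (v :: l)
    rw [List.cons_append] at this
    rw [idleList, List.cons_append, idleWeight, this,
      show l ++ Sum.inl i :: t = idleList i t l from rfl, ih, List.length_cons]
    ring

/-- The variable `z₁` or `z₂` of a server. -/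
def serverVar (z₁ z₂ : ℂ) : Server n₁ n₂ → ℂ
  | Sum.inl _ => z₁
  | Sum.inr _ => z₂

theorem prod_map_serverVar (z₁ z₂ : ℂ) (Y : List (Server n₁ n₂)) :
    (Y.map (serverVar z₁ z₂)).prod = z₁ ^ Y.countP Sum.isLeft * z₂ ^ Y.countP Sum.isRight := by
  induction Y with
  | nil => simp
  | cons y Y ih =>
    rw [List.map_cons, List.prod_cons, ih]
    rcases y with i | j
    · simp [serverVar, List.countP_cons, pow_succ]
      ring
    · simp [serverVar, List.countP_cons, pow_succ]
      ring

theorem prod_others (z₁ z₂ : ℂ) {i : Fin n₁} {t : List (Server n₁ n₂)} (htn : t.Nodup)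
    (ht : ∀ w ∈ t, w.isRight = true) (f : ℂ → ℂ) :
    ∏ v ∈ others i t, f (serverVar z₁ z₂ v) = f z₁ ^ (n₁ - 1) * f z₂ ^ (n₂ - t.length) := by
  have h1 : ∀ v ∈ others i t, f (serverVar z₁ z₂ v) =
      if v.isRight = true then f z₂ else f z₁ := by
    rintro (v | v) _ <;> simp [serverVar]
  have hR : (others i t).filter (fun v => v.isRight = true) = rights n₁ n₂ \ t.toFinset := by
    ext v
    rcases v with v | v <;> simp [others, rights]
  have hL : (others i t).filter (fun v => ¬ v.isRight = true) =
      (Finset.univ.erase i).map ⟨Sum.inl, Sum.inl_injective⟩ := by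
    ext v
    rcases v with v | v
    · have : (Sum.inl v : Server n₁ n₂) ∉ t := fun h => by simpa using ht _ h
      simp [others, this]
    · simp [others]
  have hsub : t.toFinset ⊆ rights n₁ n₂ := fun w hw => by
    simpa [rights] using ht w (List.mem_toFinset.mp hw)
  rw [Finset.prod_congr rfl h1, Finset.prod_ite, Finset.prod_const, Finset.prod_const, hR, hL,
    Finset.card_sdiff_of_subset hsub, List.toFinset_card_of_nodup htn, card_rights,
    Finset.card_map, Finset.card_erase_of_mem (Finset.mem_univ _), Finset.card_fin, mul_comm]

/-- The Laplace-type integral that generates the numbers of idle servers. -/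
noncomputable def idleIntegral (l mu₁ mu₂ : ℝ) (a b : ℕ) (z₁ z₂ : ℂ) : ℂ :=
  ∫ u : ℝ in Set.Ioi 0, (Real.exp (-(l * u)) : ℂ) * ((1 + u * mu₁ * z₁) ^ a * (1 + u * mu₂ * z₂) ^ b)

/-- The sum over `l` is the same for all `n₁` choices of the last idle `s₁` server and all
`n₂.descFactorial k` choices of the servers behind it. The substitution `t = (lam₁ + lam₂) u` brings
it to the form `idleIntegral`. -/
theorem sum_idleIndex (h1 : 0 < lam₁) (h2 : 0 < lam₂) (k : ℕ) (z₁ z₂ : ℂ) :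
    ∑ x ∈ idleIndex n₁ n₂ k,
      ((idleWeight (custRate lam₁ lam₂) (idleList x.1.1 x.1.2 x.2) *
        ((idleList x.1.1 x.1.2 x.2).map (serviceRate mu₁ mu₂)).prod : ℝ) : ℂ) *
        ((idleList x.1.1 x.1.2 x.2).map (serverVar z₁ z₂)).prod
      = ((n₁ * n₂.descFactorial k * (mu₁ * (mu₂ / lam₁) ^ k) : ℝ) : ℂ) *
        (z₁ * z₂ ^ k * idleIntegral (lam₁ + lam₂) mu₁ mu₂ (n₁ - 1) (n₂ - k) z₁ z₂) := by
  have hl : 0 < lam₁ + lam₂ := by positivity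
  have hlC : ((lam₁ : ℂ) + lam₂) ≠ 0 := by exact_mod_cast hl.ne'
  rw [idleIndex, Finset.sum_sigma]
  have hterm : ∀ d ∈ (Finset.univ : Finset (Fin n₁)) ×ˢ words ((rights n₁ n₂).powersetCard k),
      ∑ l ∈ words (others d.1 d.2).powerset,
        ((idleWeight (custRate lam₁ lam₂) (idleList d.1 d.2 l) *
        ((idleList d.1 d.2 l).map (serviceRate mu₁ mu₂)).prod : ℝ) : ℂ) *
        ((idleList d.1 d.2 l).map (serverVar z₁ z₂)).prod =
      ((mu₁ * (mu₂ / lam₁) ^ k : ℝ) : ℂ) *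
        (z₁ * z₂ ^ k * idleIntegral (lam₁ + lam₂) mu₁ mu₂ (n₁ - 1) (n₂ - k) z₁ z₂) := by
    rintro ⟨i, t⟩ hd
    obtain ⟨htn, htr, htk⟩ : t.Nodup ∧ (∀ w ∈ t, w.isRight = true) ∧ t.length = k := by
      simp only [Finset.mem_product, Finset.mem_univ, true_and, mem_words,
        Finset.mem_powersetCard] at hd
      refine ⟨hd.1, fun w hw => ?_, ?_⟩
      · simpa [rights] using hd.2.1 (List.mem_toFinset.mpr hw)
      · rw [← List.toFinset_card_of_nodup hd.1, hd.2.2]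
    subst htk
    have hmu : (t.map (serviceRate mu₁ mu₂)).prod = mu₂ ^ t.length := by
      have : t.map (serviceRate mu₁ mu₂) = t.map fun _ => mu₂ :=
        List.map_congr_left fun w hw => by
          rcases w with w | w
          · simpa using htr _ hw
          · rfl
      rw [this, List.map_const', List.prod_replicate]
    have hz : (t.map (serverVar z₁ z₂)).prod = z₂ ^ t.length := by
      have : t.map (serverVar z₁ z₂) = t.map fun _ => z₂ :=
        List.map_congr_left fun w hw => by
          rcases w with w | w
          · simpa using htr _ hw
          · rfl
      rw [this, List.map_const', List.prod_replicate]
    have hsum := sum_words_powerset (others i t)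
      (fun v => serverVar (mu₁ * z₁ / (lam₁ + lam₂)) (mu₂ * z₂ / (lam₁ + lam₂)) v)
    have hword : ∀ l : List (Server n₁ n₂),
        (l.map fun v => serverVar (mu₁ * z₁ / (lam₁ + lam₂) : ℂ) (mu₂ * z₂ / (lam₁ + lam₂)) v).prod
        = ((lam₁ + lam₂ : ℝ) : ℂ)⁻¹ ^ l.length * ((l.map (serviceRate mu₁ mu₂)).prod : ℝ) *
          (l.map (serverVar z₁ z₂)).prod := by
      intro l
      induction l with
      | nil => simp
      | cons v l ih =>
        simp only [List.map_cons, List.prod_cons, ih, List.length_cons]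
        rcases v with v | v <;> simp [serverVar, serviceRate, pow_succ] <;> ring
    have hint : ∫ u : ℝ in Set.Ioi 0, (Real.exp (-u) : ℂ) * ∏ v ∈ others i t,
        (1 + u * serverVar (mu₁ * z₁ / (lam₁ + lam₂) : ℂ) (mu₂ * z₂ / (lam₁ + lam₂)) v) =
        (lam₁ + lam₂ : ℝ) * idleIntegral (lam₁ + lam₂) mu₁ mu₂ (n₁ - 1) (n₂ - t.length) z₁ z₂ := by
      have hcv := integral_comp_mul_left_Ioi (fun u : ℝ => (Real.exp (-u) : ℂ) * ∏ v ∈ others i t,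
        (1 + u * serverVar (mu₁ * z₁ / (lam₁ + lam₂) : ℂ) (mu₂ * z₂ / (lam₁ + lam₂)) v)) 0 hl
      rw [mul_zero, eq_inv_smul_iff₀ hl.ne'] at hcv
      rw [← hcv, Complex.real_smul, idleIntegral]
      congr 2
      funext u
      rw [prod_others _ _ htn htr fun x => 1 + ((lam₁ + lam₂) * u : ℝ) * x]
      push_cast
      congr 4
      · field_simp
      · field_simp
    calc _ = ∑ l ∈ words (others i t).powerset, ((mu₁ * (mu₂ / lam₁) ^ t.length : ℝ) : ℂ) *
          (z₁ * z₂ ^ t.length) * ((lam₁ + lam₂ : ℝ) : ℂ)⁻¹ *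
          (l.map fun v => serverVar (mu₁ * z₁ / (lam₁ + lam₂) : ℂ)
            (mu₂ * z₂ / (lam₁ + lam₂)) v).prod := by
          refine Finset.sum_congr rfl fun l _ => ?_
          rw [hword, idleWeight_idleList htr]
          simp only [idleList, List.map_append, List.map_cons, List.prod_append, List.prod_cons,
            hmu, hz, serverVar, serviceRate]
          push_cast
          rw [div_eq_mul_inv, mul_pow]
          ring
      _ = _ := by
          rw [← Finset.mul_sum, hsum, hint]
          push_cast
          field_simp
  rw [Finset.sum_congr rfl hterm, Finset.sum_const, Finset.card_product, card_words_powersetCard,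
    card_rights, Finset.card_fin, nsmul_eq_mul]
  push_cast
  ring

end Sum

end NSystem
namespace NSystem

variable {n₁ n₂ : ℕ}

instance : DiscreteMeasurableSpace (State n₁ n₂) := ⟨fun _ => trivial⟩

/-! ### The generating function of the numbers of idle servers on `K = k` -/

section Generating

variable {lam₁ lam₂ mu₁ mu₂ : ℝ} {p : PMF (State n₁ n₂)} {z : ENNReal}

theorem toMeasure_idle_eq (h1 : 0 < lam₁) (h2 : 0 < lam₂) (hmu₁ : 0 < mu₁) (hmu₂ : 0 < mu₂)
    (hp : ∀ s, p s = ENNReal.ofReal (weight (custRate lam₁ lam₂) (serviceRate mu₁ mu₂) s.1) * z)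
    {Y : List (Server n₁ n₂)} (hY : Y.Nodup) {i : Fin n₁} (hi : Sum.inl i ∈ Y) :
    p.toMeasure.real {s | s.1.idle = Y} =
      (z.toReal * ∏ v : Server n₁ n₂, (serviceRate mu₁ mu₂ v)⁻¹) *
        (idleWeight (custRate lam₁ lam₂) Y * (Y.map (serviceRate mu₁ mu₂)).prod) := by
  classical
  have hmu : ∀ v : Server n₁ n₂, 0 < serviceRate mu₁ mu₂ v := by
    rintro (_ | _)
    exacts [hmu₁, hmu₂]
  have hlam : ∀ c, 0 < custRate lam₁ lam₂ c := by
    rintro (_ | _)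
    exacts [h1, h2]
  have h3 : p.toMeasure {s | s.1.idle = Y} =
      (∑' s : State n₁ n₂, (if s.1.idle = Y then
        ENNReal.ofReal (weight (custRate lam₁ lam₂) (serviceRate mu₁ mu₂) s.1) else 0)) * z := by
    rw [PMF.toMeasure_apply_eq_tsum, ← ENNReal.tsum_mul_right]
    refine tsum_congr fun s => ?_
    by_cases h : s.1.idle = Y <;> simp [Set.indicator, h, hp]
  have h4 := tsum_weight_idle hlam hmu hY hi
  have h5 : 0 ≤ (∏ v : Server n₁ n₂, (serviceRate mu₁ mu₂ v)⁻¹) *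
        (idleWeight (custRate lam₁ lam₂) Y * (Y.map (serviceRate mu₁ mu₂)).prod) := by
    refine mul_nonneg (Finset.prod_nonneg fun v _ => (inv_pos.mpr (hmu v)).le)
      (mul_nonneg (idleWeight_pos hlam _).le (List.prod_nonneg fun a ha => ?_))
    obtain ⟨v, -, rfl⟩ := List.mem_map.mp ha
    exact (hmu v).le
  rw [Measure.real, h3]
  convert congrArg (fun x : ENNReal => (x * z).toReal) h4 using 1
  rw [ENNReal.toReal_mul, ENNReal.toReal_ofReal h5]
  ring

theorem toMeasure_noLeft_le (h1 : 0 < lam₁) (h2 : 0 < lam₂) (hmu₁ : 0 < mu₁) (hmu₂ : 0 < mu₂)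
    {ρ κ : ℝ} (hρ : 0 ≤ ρ) (hκ : 1 ≤ κ) (hρκ : 1 + ρ * κ ≤ κ)
    (hload : LoadLE (n₁ := n₁) (n₂ := n₂) (custRate lam₁ lam₂) (serviceRate mu₁ mu₂) ρ)
    (hz : z ≠ ⊤)
    (hp : ∀ s, p s = ENNReal.ofReal (weight (custRate lam₁ lam₂) (serviceRate mu₁ mu₂) s.1) * z)
    (k : ℕ) :
    p.toMeasure.real {s | (∀ w ∈ s.1.idle, w.isRight = true) ∧ tailLength s.1.servers = k} ≤
      (z.toReal * ∏ v : Server n₁ n₂, (serviceRate mu₁ mu₂ v)⁻¹) *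
        (κ ^ (k + 1) * (1 + n₂ * (mu₂ / lam₁)) ^ k) := by
  classical
  have hmu : ∀ v : Server n₁ n₂, 0 < serviceRate mu₁ mu₂ v := by
    rintro (_ | _)
    exacts [hmu₁, hmu₂]
  have hlam : ∀ c, 0 < custRate lam₁ lam₂ c := by
    rintro (_ | _)
    exacts [h1, h2]
  have h3 : p.toMeasure {s : State n₁ n₂ |
        (∀ w ∈ s.1.idle, w.isRight = true) ∧ tailLength s.1.servers = k} =
      (∑' s : State n₁ n₂,
        (if (∀ w ∈ s.1.idle, w.isRight = true) ∧ tailLength s.1.servers = k then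
        ENNReal.ofReal (weight (custRate lam₁ lam₂) (serviceRate mu₁ mu₂) s.1) else 0)) * z := by
    rw [PMF.toMeasure_apply_eq_tsum, ← ENNReal.tsum_mul_right]
    refine tsum_congr fun s => ?_
    rw [Set.indicator_apply, ite_mul, zero_mul, hp]
    rfl
  have h4 := tsum_weight_noLeft_le hlam hmu hρ hκ hρκ hload hmu₂ (fun _ => rfl) k
  have hC : 0 ≤ ∏ v : Server n₁ n₂, (serviceRate mu₁ mu₂ v)⁻¹ :=
    Finset.prod_nonneg fun v _ => (inv_pos.mpr (hmu v)).le
  rw [Measure.real, h3]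
  have h5 := ENNReal.toReal_mono (ENNReal.mul_ne_top ENNReal.ofReal_ne_top hz)
    (mul_le_mul_left h4 z)
  rw [ENNReal.toReal_mul (a := ENNReal.ofReal _), ENNReal.toReal_ofReal (by positivity)] at h5
  convert h5 using 1
  simp only [custRate]
  ring

/-- The relative size of the contribution of the states without idle `s₁` server. -/
noncomputable def defect (n₁ n₂ k : ℕ) (lam₁ mu₁ mu₂ κ : ℝ) : ℝ :=
  κ ^ (k + 1) * (1 + n₂ * (mu₂ / lam₁)) ^ k /
    (n₁ * n₂.descFactorial k * (mu₁ * (mu₂ / lam₁) ^ k))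

/-- The factor `D` collects the normalization of the stationary distribution and the combinatorial
constants. It does not depend on `z₁`, `z₂`, so it disappears in quotients. On the unit circle the
states without an idle `s₁` server contribute at most their probability. -/
theorem exists_setIntegral_K (hn : 0 < n₁) (h1 : 0 < lam₁) (h2 : 0 < lam₂) (hmu₁ : 0 < mu₁)
    (hmu₂ : 0 < mu₂) {ρ κ : ℝ} (hρ : 0 ≤ ρ) (hκ : 1 ≤ κ) (hρκ : 1 + ρ * κ ≤ κ)
    (hload : LoadLE (n₁ := n₁) (n₂ := n₂) (custRate lam₁ lam₂) (serviceRate mu₁ mu₂) ρ)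
    (hz0 : z ≠ 0) (hz : z ≠ ⊤)
    (hp : ∀ s, p s = ENNReal.ofReal (weight (custRate lam₁ lam₂) (serviceRate mu₁ mu₂) s.1) * z)
    {k : ℕ} (hk : k ≤ n₂) :
    ∃ D : ℝ, 0 < D ∧ ∀ z₁ z₂ : ℂ, ‖z₁‖ = 1 → ‖z₂‖ = 1 →
      ‖∫ s in {s : State n₁ n₂ | s.K = k}, z₁ ^ s.I₁ * z₂ ^ s.I₂ ∂p.toMeasure -
        D * (z₁ * z₂ ^ k * idleIntegral (lam₁ + lam₂) mu₁ mu₂ (n₁ - 1) (n₂ - k) z₁ z₂)‖ ≤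
          D * defect n₁ n₂ k lam₁ mu₁ mu₂ κ := by
  have hmu : ∀ v : Server n₁ n₂, 0 < serviceRate mu₁ mu₂ v := by
    rintro (_ | _)
    exacts [hmu₁, hmu₂]
  set C : ℝ := z.toReal * ∏ v : Server n₁ n₂, (serviceRate mu₁ mu₂ v)⁻¹ with hCdef
  have hC : 0 < C := mul_pos (ENNReal.toReal_pos hz0 hz)
    (Finset.prod_pos fun v _ => inv_pos.mpr (hmu v))
  set B : ℝ := n₁ * n₂.descFactorial k * (mu₁ * (mu₂ / lam₁) ^ k) with hBdef
  have hB : 0 < B := by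
    have : 0 < n₂.descFactorial k := Nat.pos_of_ne_zero fun h => by
      rw [Nat.descFactorial_eq_zero_iff_lt] at h
      omega
    positivity
  refine ⟨C * B, by positivity, fun z₁ z₂ hz₁ hz₂ => ?_⟩
  have hnorm : ∀ s : State n₁ n₂, ‖z₁ ^ s.I₁ * z₂ ^ s.I₂‖ = 1 := fun s => by simp [hz₁, hz₂]
  have hint : Integrable (fun s : State n₁ n₂ => z₁ ^ s.I₁ * z₂ ^ s.I₂) p.toMeasure :=
    Integrable.of_bound (C := 1) Measurable.of_discrete.aestronglyMeasurable
      (ae_of_all _ fun s => (hnorm s).le)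
  have hdisj : Disjoint (⋃ x ∈ idleIndex n₁ n₂ k, {s : State n₁ n₂ |
        s.1.idle = idleList x.1.1 x.1.2 x.2})
      {s | (∀ w ∈ s.1.idle, w.isRight = true) ∧ tailLength s.1.servers = k} := by
    rw [Set.disjoint_left]
    intro s hs hs'
    simp only [Set.mem_iUnion] at hs
    obtain ⟨x, -, hx⟩ := hs
    have := hs'.1 (Sum.inl x.1.1)
    rw [show s.1.idle = _ from hx] at this
    simp [idleList] at this
  have hpair : Set.Pairwise (SetLike.coe (idleIndex n₁ n₂ k))
      (Function.onFun Disjoint fun x => {s : State n₁ n₂ | s.1.idle = idleList x.1.1 x.1.2 x.2}) := by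
    intro x hx y hy hxy
    refine Set.disjoint_left.mpr fun s hs hs' => hxy ?_
    exact idleList_injOn k hx hy ((show s.1.idle = _ from hs).symm.trans hs')
  have hterm : ∀ x ∈ idleIndex n₁ n₂ k,
      ∫ s in {s : State n₁ n₂ | s.1.idle = idleList x.1.1 x.1.2 x.2},
        z₁ ^ s.I₁ * z₂ ^ s.I₂ ∂p.toMeasure =
      C * (((idleWeight (custRate lam₁ lam₂) (idleList x.1.1 x.1.2 x.2) *
        ((idleList x.1.1 x.1.2 x.2).map (serviceRate mu₁ mu₂)).prod : ℝ) : ℂ) *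
        ((idleList x.1.1 x.1.2 x.2).map (serverVar z₁ z₂)).prod) := by
    rintro ⟨⟨i, t⟩, l⟩ hx
    have hconst : Set.EqOn (fun s : State n₁ n₂ => z₁ ^ s.I₁ * z₂ ^ s.I₂)
        (fun _ => ((idleList i t l).map (serverVar z₁ z₂)).prod)
        {s | s.1.idle = idleList i t l} := by
      intro s hs
      simp only [prod_map_serverVar, State.I₁, State.I₂, show s.1.idle = _ from hs]
    rw [setIntegral_congr_fun (MeasurableSet.of_discrete) hconst, setIntegral_const,
      toMeasure_idle_eq h1 h2 hmu₁ hmu₂ hp (mem_idleIndex.mp hx).1 (i := i) (by simp [idleList]),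
      ← hCdef, Complex.real_smul]
    push_cast
    ring
  rw [setOf_K_eq, setIntegral_union hdisj MeasurableSet.of_discrete hint.integrableOn
    hint.integrableOn, integral_biUnion_finset _ (fun _ _ => MeasurableSet.of_discrete) hpair
    (fun _ _ => hint.integrableOn), Finset.sum_congr rfl hterm, ← Finset.mul_sum,
    sum_idleIndex h1 h2]
  have hrw : ∀ a b : ℂ, (C : ℂ) * ((B : ℂ) * a) + b - ((C * B : ℝ) : ℂ) * a = b := by
    intro a b
    push_cast
    ring
  rw [hrw]
  refine (norm_setIntegral_le_of_norm_le_const (measure_lt_top _ _)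
    (fun s _ => (hnorm s).le)).trans ?_
  rw [one_mul]
  refine (toMeasure_noLeft_le h1 h2 hmu₁ hmu₂ hρ hκ hρκ hload hz hp k).trans (le_of_eq ?_)
  rw [defect, ← hBdef, ← hCdef]
  field_simp

end Generating

end NSystem
namespace NSystem

/-! ### Asymptotics of the normalized integrand -/

section Factor

open Complex (I)

/-- The factor of one server in the integrand, divided by its value at the maximum and by its
linear part; `q` is the idle probability and `x` the relative deviation of the idle time. -/
noncomputable def idleFactor (q x σ : ℝ) : ℂ :=
  ((1 - q) + (q + x) * Complex.exp (σ * I)) * Complex.exp (-(q * σ * I)) * Complex.exp (-x)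

theorem tendsto_zero_of_tendsto_sqrt_mul {x : ℕ → ℂ} {ξ : ℂ}
    (h : Tendsto (fun n : ℕ => (√(n : ℝ) : ℂ) * x n) atTop (𝓝 ξ)) : Tendsto x atTop (𝓝 0) := by
  have h1 : Tendsto (fun n : ℕ => ((√(n : ℝ))⁻¹ : ℝ)) atTop (𝓝 0) :=
    (Real.tendsto_sqrt_atTop.comp tendsto_natCast_atTop_atTop).inv_tendsto_atTop
  have h2 := ((Complex.continuous_ofReal.tendsto 0).comp h1).mul h
  rw [Complex.ofReal_zero, zero_mul] at h2
  refine h2.congr' ?_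
  filter_upwards [eventually_gt_atTop 0] with n hn
  have : (√(n : ℝ) : ℂ) ≠ 0 := by
    have : 0 < √(n : ℝ) := Real.sqrt_pos.mpr (by exact_mod_cast hn)
    exact_mod_cast this.ne'
  simp only [Function.comp, Complex.ofReal_inv]
  field_simp

theorem tendsto_mul_exp_sub_one_sub {y : ℕ → ℂ} {η : ℂ}
    (h : Tendsto (fun n : ℕ => (√(n : ℝ) : ℂ) * y n) atTop (𝓝 η)) :
    Tendsto (fun n : ℕ => (n : ℂ) * (Complex.exp (y n) - 1 - y n)) atTop (𝓝 (η ^ 2 / 2)) := by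
  have h0 := tendsto_zero_of_tendsto_sqrt_mul h
  have hsq : ∀ n : ℕ, (√(n : ℝ) : ℂ) ^ 2 = n := fun n => by
    rw [← Complex.ofReal_pow, Real.sq_sqrt (Nat.cast_nonneg n), Complex.ofReal_natCast]
  have h1 : Tendsto (fun n : ℕ => ((√(n : ℝ) : ℂ) * y n) ^ 2 / 2) atTop (𝓝 (η ^ 2 / 2)) :=
    (h.pow 2).div_const 2
  have h2 : Tendsto (fun n : ℕ => ‖(√(n : ℝ) : ℂ) * y n‖ ^ 2 * (‖y n‖ * Real.exp ‖y n‖)) atTop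
      (𝓝 0) := by
    have := (h.norm.pow 2).mul (h0.norm.mul ((Real.continuous_exp.tendsto _).comp h0.norm))
    simpa using this
  have h3 : Tendsto (fun n : ℕ => (n : ℂ) * (Complex.exp (y n) - 1 - y n) -
      ((√(n : ℝ) : ℂ) * y n) ^ 2 / 2) atTop (𝓝 0) := by
    refine squeeze_zero_norm (fun n => ?_) h2
    have h4 := Complex.norm_exp_sub_sum_le_norm_mul_exp (y n) 3
    have h5 : (n : ℂ) * (Complex.exp (y n) - 1 - y n) - ((√(n : ℝ) : ℂ) * y n) ^ 2 / 2 =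
        n * (Complex.exp (y n) - ∑ m ∈ Finset.range 3, y n ^ m / m.factorial) := by
      rw [mul_pow, hsq]
      simp [Finset.sum_range_succ]
      ring
    have h6 : ‖(√(n : ℝ) : ℂ) * y n‖ ^ 2 = n * ‖y n‖ ^ 2 := by
      rw [norm_mul, mul_pow, ← norm_pow, hsq, Complex.norm_natCast]
    rw [h5, norm_mul, h6, Complex.norm_natCast, mul_assoc]
    refine mul_le_mul_of_nonneg_left (h4.trans (le_of_eq ?_)) (Nat.cast_nonneg n)
    ring
  simpa using h3.add h1

/-- Both `x` and `σ` are of order `n^(-1/2)`, and the two exponentials in `idleFactor` are chosen to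
cancel the first-order terms. At second order there remain a Bernoulli variance, a cross term, and
the curvature in `x`. -/
theorem tendsto_mul_idleFactor_sub_one {q x σ : ℕ → ℝ} {q₀ ξ s : ℝ}
    (hq : Tendsto q atTop (𝓝 q₀))
    (hx : Tendsto (fun n : ℕ => √(n : ℝ) * x n) atTop (𝓝 ξ))
    (hσ : Tendsto (fun n : ℕ => √(n : ℝ) * σ n) atTop (𝓝 s)) :
    Tendsto (fun n : ℕ => (n : ℂ) * (idleFactor (q n) (x n) (σ n) - 1)) atTop
      (𝓝 (-(q₀ * (1 - q₀) * s ^ 2 / 2) + I * s * ξ * (1 - q₀) - ξ ^ 2 / 2)) := by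
  have hqC : Tendsto (fun n => (q n : ℂ)) atTop (𝓝 q₀) := (Complex.continuous_ofReal.tendsto _).comp hq
  have hxC : Tendsto (fun n : ℕ => (√(n : ℝ) : ℂ) * x n) atTop (𝓝 ξ) := by
    simpa [Function.comp_def] using (Complex.continuous_ofReal.tendsto _).comp hx
  have hσC : Tendsto (fun n : ℕ => (√(n : ℝ) : ℂ) * σ n) atTop (𝓝 s) := by
    simpa [Function.comp_def] using (Complex.continuous_ofReal.tendsto _).comp hσ
  have hx0 := tendsto_zero_of_tendsto_sqrt_mul hxC
  have hσ0 := tendsto_zero_of_tendsto_sqrt_mul hσC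
  have hA := tendsto_mul_exp_sub_one_sub (y := fun n => -(x n : ℂ)) (η := -ξ)
    (by simpa using hxC.neg)
  have hB := tendsto_mul_exp_sub_one_sub (y := fun n => -(q n * σ n * I : ℂ)) (η := -(q₀ * s * I))
    (((hqC.mul hσC).mul_const I).neg.congr fun n => by ring)
  have hC := tendsto_mul_exp_sub_one_sub (y := fun n => ((1 - q n) * σ n * I : ℂ))
    (η := (1 - q₀) * s * I)
    ((((tendsto_const_nhds.sub hqC).mul hσC).mul_const I).congr fun n => by ring)
  set A : ℕ → ℂ := fun n => Complex.exp (-(x n : ℂ)) - 1 - -(x n : ℂ) with hAdef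
  set B : ℕ → ℂ := fun n => Complex.exp (-(q n * σ n * I : ℂ)) - 1 - -(q n * σ n * I : ℂ) with hBdef
  set C : ℕ → ℂ := fun n => Complex.exp ((1 - q n) * σ n * I : ℂ) - 1 - ((1 - q n) * σ n * I : ℂ)
    with hCdef
  have hD : Tendsto (fun n : ℕ => (1 - q n : ℂ) * (n * B n) + q n * (n * C n) +
      I * ((√(n : ℝ) : ℂ) * x n) * (1 - q n) * ((√(n : ℝ) : ℂ) * σ n) + x n * (n * C n)) atTop
      (𝓝 ((1 - q₀) * ((-(q₀ * s * I)) ^ 2 / 2) + q₀ * (((1 - q₀) * s * I) ^ 2 / 2) +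
        I * ξ * (1 - q₀) * s + 0 * (((1 - q₀) * s * I) ^ 2 / 2))) :=
    ((((tendsto_const_nhds.sub hqC).mul hB).add (hqC.mul hC)).add
      (((tendsto_const_nhds.mul hxC).mul (tendsto_const_nhds.sub hqC)).mul hσC)).add (hx0.mul hC)
  have hA0 : Tendsto A atTop (𝓝 0) := by
    have h1 : Tendsto (fun n => Complex.exp (-(x n : ℂ)) - 1 - -(x n : ℂ)) atTop
        (𝓝 (Complex.exp (-0) - 1 - -0)) :=
      (((Complex.continuous_exp.tendsto _).comp hx0.neg).sub_const 1).sub hx0.neg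
    simpa [hAdef] using h1
  have hsum : Tendsto (fun n : ℕ => -((√(n : ℝ) : ℂ) * x n) ^ 2 + n * A n + (n * A n) * x n +
      (1 - x n + A n) * ((1 - q n : ℂ) * (n * B n) + q n * (n * C n) +
      I * ((√(n : ℝ) : ℂ) * x n) * (1 - q n) * ((√(n : ℝ) : ℂ) * σ n) + x n * (n * C n))) atTop
      (𝓝 (-(ξ : ℂ) ^ 2 + (-(ξ : ℂ)) ^ 2 / 2 + ((-(ξ : ℂ)) ^ 2 / 2) * 0 + (1 - 0 + 0) *
        ((1 - q₀) * ((-(q₀ * s * I)) ^ 2 / 2) + q₀ * (((1 - q₀) * s * I) ^ 2 / 2) +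
        I * ξ * (1 - q₀) * s + 0 * (((1 - q₀) * s * I) ^ 2 / 2)))) :=
    (((hxC.pow 2).neg.add hA).add (hA.mul hx0)).add
      (((tendsto_const_nhds.sub hx0).add hA0).mul hD)
  have hlim : (-(ξ : ℂ) ^ 2 + (-(ξ : ℂ)) ^ 2 / 2 + ((-(ξ : ℂ)) ^ 2 / 2) * 0 + (1 - 0 + 0) *
        ((1 - q₀) * ((-(q₀ * s * I)) ^ 2 / 2) + q₀ * (((1 - q₀) * s * I) ^ 2 / 2) +
        I * ξ * (1 - q₀) * s + 0 * (((1 - q₀) * s * I) ^ 2 / 2))) =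
      -(q₀ * (1 - q₀) * s ^ 2 / 2) + I * s * ξ * (1 - q₀) - ξ ^ 2 / 2 := by
    ring_nf
    rw [Complex.I_sq]
    ring
  rw [hlim] at hsum
  -- The bracket is `1 + x` plus second-order terms and `exp (-x)` is `1 - x + A`, so with the
  -- remainders `A`, `B`, `C` kept the limit above is an exact expansion of the product.
  refine hsum.congr fun n => ?_
  have hsq : (√(n : ℝ) : ℂ) ^ 2 = n := by
    rw [← Complex.ofReal_pow, Real.sq_sqrt (Nat.cast_nonneg n), Complex.ofReal_natCast]
  have hsplit : idleFactor (q n) (x n) (σ n) =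
      ((1 - q n) * Complex.exp (-(q n * σ n * I : ℂ)) +
        (q n + x n) * Complex.exp ((1 - q n) * σ n * I : ℂ)) * Complex.exp (-(x n : ℂ)) := by
    rw [idleFactor, show ((1 - q n) * σ n * I : ℂ) = σ n * I + -(q n * σ n * I) by ring,
      Complex.exp_add]
    ring
  have eA : Complex.exp (-(x n : ℂ)) = 1 - x n + A n := by simp only [hAdef]; ring
  have eB : Complex.exp (-(q n * σ n * I : ℂ)) = 1 - q n * σ n * I + B n := by
    simp only [hBdef]; ring
  have eC : Complex.exp ((1 - q n) * σ n * I : ℂ) = 1 + (1 - q n) * σ n * I + C n := by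
    simp only [hCdef]; ring
  rw [hsplit, eA, eB, eC, ← hsq]
  ring

theorem tendsto_idleFactor_pow {q x σ : ℕ → ℝ} {q₀ ξ s θ : ℝ} {a : ℕ → ℕ}
    (hq : Tendsto q atTop (𝓝 q₀))
    (hx : Tendsto (fun n : ℕ => √(n : ℝ) * x n) atTop (𝓝 ξ))
    (hσ : Tendsto (fun n : ℕ => √(n : ℝ) * σ n) atTop (𝓝 s))
    (ha : Tendsto (fun n : ℕ => (a n : ℝ) / n) atTop (𝓝 θ)) :
    Tendsto (fun n : ℕ => idleFactor (q n) (x n) (σ n) ^ a n) atTop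
      (𝓝 (Complex.exp (θ * (-(q₀ * (1 - q₀) * s ^ 2 / 2) + I * s * ξ * (1 - q₀) - ξ ^ 2 / 2)))) := by
  have h1 := tendsto_mul_idleFactor_sub_one hq hx hσ
  have h2 := Complex.tendsto_nat_mul_log_one_add_of_tendsto h1
  have haC : Tendsto (fun n : ℕ => (((a n : ℝ) / n : ℝ) : ℂ)) atTop (𝓝 θ) :=
    (Complex.continuous_ofReal.tendsto _).comp ha
  refine ((Complex.continuous_exp.tendsto _).comp (haC.mul h2)).congr' ?_
  have h0 : Tendsto (fun n : ℕ => idleFactor (q n) (x n) (σ n) - 1) atTop (𝓝 0) := by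
    have := (tendsto_inv_atTop_nhds_zero_nat (𝕜 := ℂ)).mul h1
    rw [zero_mul] at this
    refine this.congr' ?_
    filter_upwards [eventually_gt_atTop 0] with n hn
    have : (n : ℂ) ≠ 0 := by exact_mod_cast hn.ne'
    field_simp
  filter_upwards [eventually_gt_atTop 0, h0.eventually_ne (show (0 : ℂ) ≠ -1 by simp)] with n hn h3
  have hn' : (n : ℂ) ≠ 0 := by exact_mod_cast hn.ne'
  have h4 : idleFactor (q n) (x n) (σ n) ≠ 0 := fun h => h3 (by rw [h]; ring)
  simp only [Function.comp]
  rw [add_sub_cancel, ← mul_assoc, Complex.ofReal_div, Complex.ofReal_natCast, Complex.ofReal_natCast,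
    div_mul_cancel₀ _ hn', Complex.exp_nat_mul, Complex.exp_log h4]

theorem norm_idleFactor_le {q x σ : ℝ} (hq : q ≤ 1) (hx : 0 ≤ q + x) :
    ‖idleFactor q x σ‖ ≤ (1 + x) * Real.exp (-x) := by
  rw [idleFactor, norm_mul, norm_mul, show (-(q * σ * I) : ℂ) = ((-(q * σ) : ℝ) : ℂ) * I by
    push_cast; ring, Complex.norm_exp_ofReal_mul_I, mul_one, ← Complex.ofReal_neg,
    Complex.norm_exp_ofReal]
  refine mul_le_mul_of_nonneg_right ?_ (Real.exp_pos _).le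
  refine (norm_add_le _ _).trans ?_
  rw [norm_mul, Complex.norm_exp_ofReal_mul_I, mul_one, ← Complex.ofReal_one, ← Complex.ofReal_sub,
    ← Complex.ofReal_add, Complex.norm_real, Complex.norm_real, Real.norm_of_nonneg hx,
    Real.norm_of_nonneg (by linarith)]
  linarith

/-- With `y = √(1 + x)`, the bound `log (1 + x) = 2 log y ≤ 2 (y - 1)` turns the exponent into at
most `-(y - 1)²`, and `x = (y - 1)(y + 1)` with `(y + 1)² ≤ 2 (2 + |x|)`. The resulting decay is
quadratic near zero and linear at infinity. -/
theorem one_add_mul_exp_neg_le {x : ℝ} (hx : -1 ≤ x) :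
    (1 + x) * Real.exp (-x) ≤ Real.exp (-(x ^ 2 / (2 * (2 + |x|)))) := by
  rcases hx.eq_or_lt with rfl | hx
  · simp [(Real.exp_pos _).le]
  have h1 : 0 < 1 + x := by linarith
  set y := √(1 + x) with hy
  have hy0 : 0 < y := Real.sqrt_pos.mpr h1
  have hy2 : y ^ 2 = 1 + x := Real.sq_sqrt h1.le
  have h2 : Real.log (1 + x) ≤ 2 * (y - 1) := by
    rw [← hy2, Real.log_pow]
    push_cast
    linarith [Real.log_le_sub_one_of_pos hy0]
  rw [← Real.exp_log h1, ← Real.exp_add]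
  refine Real.exp_le_exp.mpr ?_
  have h3 : x ^ 2 / (2 * (2 + |x|)) ≤ (y - 1) ^ 2 := by
    rw [div_le_iff₀ (by positivity)]
    have hx' : x = (y - 1) * (y + 1) := by nlinarith
    have h4 : (y + 1) ^ 2 ≤ 2 * (2 + |x|) := by
      nlinarith [le_abs_self x, sq_nonneg (y - 1)]
    calc x ^ 2 = (y - 1) ^ 2 * (y + 1) ^ 2 := by rw [← mul_pow, ← hx']
      _ ≤ _ := mul_le_mul_of_nonneg_left h4 (sq_nonneg _)
  nlinarith

theorem norm_idleFactor_le_one {q x σ : ℝ} (hq : q ≤ 1) (hx : 0 ≤ q + x) :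
    ‖idleFactor q x σ‖ ≤ 1 := by
  refine (norm_idleFactor_le hq hx).trans ((one_add_mul_exp_neg_le (by linarith)).trans ?_)
  rw [Real.exp_le_one_iff, neg_nonpos]
  positivity

/-- A bound that is integrable in `y`, uniformly in the number of servers. -/
theorem norm_idleFactor_pow_le {q x σ c y : ℝ} {n a : ℕ} (hn : 0 < n) (hc : 0 ≤ c)
    (hq : q ≤ 1) (hx : 0 ≤ q + x) (ha : c * n ≤ a) (hy : y = √(n : ℝ) * x) :
    ‖idleFactor q x σ ^ a‖ ≤ Real.exp (c - c / 2 * |y|) := by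
  have hn1 : (1 : ℝ) ≤ n := by exact_mod_cast hn
  have hs : 1 ≤ √(n : ℝ) := Real.one_le_sqrt.mpr hn1
  have hxy : |x| ≤ |y| := by
    rw [hy, abs_mul, abs_of_nonneg (Real.sqrt_nonneg _)]
    exact le_mul_of_one_le_left (abs_nonneg x) hs
  rw [norm_pow]
  refine (pow_le_pow_left₀ (norm_nonneg _) ((norm_idleFactor_le hq hx).trans
    (one_add_mul_exp_neg_le (by linarith))) a).trans ?_
  rw [← Real.exp_nat_mul]
  refine Real.exp_le_exp.mpr ?_
  -- Here `n x² = y²`, and enlarging `|x|` to `|y|` in the denominator removes the dependence on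
  -- `n`.
  have h1 : c * (y ^ 2 / (2 * (2 + |y|))) ≤ a * (x ^ 2 / (2 * (2 + |x|))) := by
    calc c * (y ^ 2 / (2 * (2 + |y|))) = c * n * (x ^ 2 / (2 * (2 + |y|))) := by
          rw [hy, mul_pow, Real.sq_sqrt (Nat.cast_nonneg n)]
          ring
      _ ≤ a * (x ^ 2 / (2 * (2 + |x|))) := by gcongr
  have h2 : |y| / 2 - 1 ≤ y ^ 2 / (2 * (2 + |y|)) := by
    rw [le_div_iff₀ (by positivity), ← sq_abs y]
    nlinarith [abs_nonneg y]
  have h3 := mul_le_mul_of_nonneg_left h2 hc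
  nlinarith

theorem integrable_exp_neg_mul_abs {c : ℝ} (hc : 0 < c) :
    Integrable fun y : ℝ => Real.exp (-(c * |y|)) := by
  rw [← integrableOn_univ, ← Set.Iic_union_Ioi (a := (0 : ℝ))]
  refine IntegrableOn.union ?_ ?_
  · refine (integrableOn_exp_mul_Iic hc 0).congr_fun (fun y hy => ?_) measurableSet_Iic
    simp only [abs_of_nonpos (Set.mem_Iic.mp hy)]
    ring_nf
  · refine (integrableOn_exp_mul_Ioi (neg_lt_zero.mpr hc) 0).congr_fun (fun y hy => ?_)
      measurableSet_Ioi
    simp only [abs_of_pos (Set.mem_Ioi.mp hy)]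
    ring_nf

end Factor

end NSystem
namespace NSystem

/-! ### Laplace asymptotics of the generating function -/

section Laplace

open Complex (I)

/-- With `q = T / (T + 1/mu)` one has `1 + T mu = 1 / (1 - q)`, so after division by its value at `u
= T`, `σ = 0` the factor of a server is `(1 - q) + (q + x) e^{iσ}`. The mean phase and the linear
growth `e^x` are split off. -/
theorem one_add_mul_eq_idleFactor {T mu : ℝ} (hT : 0 < T) (hmu : 0 < mu) (w σ : ℝ) :
    (1 + ((w + T : ℝ) : ℂ) * mu * Complex.exp (σ * I)) =
      (1 + T * mu : ℝ) * idleFactor (T / (T + 1 / mu)) (w / (T + 1 / mu)) σ *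
        Complex.exp ((T / (T + 1 / mu) * σ : ℝ) * I) *
        Complex.exp ((w / (T + 1 / mu) : ℝ) : ℂ) := by
  have h1 : (T + 1 / mu : ℝ) ≠ 0 := by positivity
  have h2 : ((T : ℂ) + 1 / mu) ≠ 0 := by exact_mod_cast h1
  have h3 : (mu : ℂ) ≠ 0 := by exact_mod_cast hmu.ne'
  set q : ℝ := T / (T + 1 / mu)
  set x : ℝ := w / (T + 1 / mu)
  have h4 : Complex.exp (-(q * σ * I)) * Complex.exp ((q * σ : ℝ) * I) = 1 := by
    rw [← Complex.exp_add, Complex.ofReal_mul, neg_add_cancel, Complex.exp_zero]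
  have h5 : Complex.exp (-(x : ℂ)) * Complex.exp (x : ℂ) = 1 := by
    rw [← Complex.exp_add, neg_add_cancel, Complex.exp_zero]
  have h6 : (1 + T * mu : ℝ) * (1 - q) = 1 := by
    simp only [q]
    field_simp
    ring
  have h7 : (1 + T * mu : ℝ) * (q + x) = (w + T) * mu := by
    simp only [q, x]
    field_simp
    ring
  have h6' : ((1 + T * mu : ℝ) : ℂ) * (1 - q) = 1 := by exact_mod_cast h6
  have h7' : ((1 + T * mu : ℝ) : ℂ) * (q + x) = ((w + T : ℝ) : ℂ) * mu := by exact_mod_cast h7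
  rw [idleFactor]
  linear_combination (-1 : ℂ) * h6' - Complex.exp (σ * I) * h7' -
    (1 + T * mu : ℝ) * ((1 - q) + (q + x) * Complex.exp (σ * I)) *
      (h4 * (Complex.exp (-(x : ℂ)) * Complex.exp (x : ℂ)) + h5)

variable {mu₁ mu₂ : ℝ}

/-- The integrand of `idleIntegral`, normalized and recentred at its maximum `T`. -/
noncomputable def scaledIntegrand (mu₁ mu₂ T : ℝ) (a b k : ℕ) (σ₁ σ₂ c v : ℝ) : ℂ :=
  if 0 < v / c + T then
    idleFactor (T / (T + 1 / mu₁)) (v / c / (T + 1 / mu₁)) σ₁ ^ (a - 1) *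
      idleFactor (T / (T + 1 / mu₂)) (v / c / (T + 1 / mu₂)) σ₂ ^ (b - k) *
      Complex.exp ((-(v / c / (T + 1 / mu₁) + k * (v / c / (T + 1 / mu₂))) : ℝ) : ℂ)
  else 0

/-- The value of the integrand at its maximum. -/
noncomputable def peak (mu₁ mu₂ T l : ℝ) (a b k : ℕ) : ℝ :=
  Real.exp (-(l * T)) * (1 + T * mu₁) ^ (a - 1) * (1 + T * mu₂) ^ (b - k)

/-- After `u = T + v/c` the equation for `l` makes the linear part of `e^{-lu}` cancel the factors
`e^x` of `a` and `b` servers. The powers are only `a - 1` and `b - k`, which leaves the last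
exponential in `scaledIntegrand`. -/
theorem idleIntegral_eq (hmu₁ : 0 < mu₁) (hmu₂ : 0 < mu₂) {T l c : ℝ} (hT : 0 < T) (hc : 0 < c)
    {a b k : ℕ} (ha : 1 ≤ a) (hb : k ≤ b)
    (hl : l = a / (T + 1 / mu₁) + b / (T + 1 / mu₂)) (σ₁ σ₂ : ℝ) :
    idleIntegral l mu₁ mu₂ (a - 1) (b - k) (Complex.exp (σ₁ * I)) (Complex.exp (σ₂ * I)) =
      peak mu₁ mu₂ T l a b k *
        Complex.exp (((a - 1) * (T / (T + 1 / mu₁) * σ₁) +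
          (b - k) * (T / (T + 1 / mu₂) * σ₂) : ℝ) * I) *
        ((c⁻¹ : ℝ) * ∫ v : ℝ, scaledIntegrand mu₁ mu₂ T a b k σ₁ σ₂ c v) := by
  set g : ℝ → ℂ := fun u => (Real.exp (-(l * u)) : ℂ) *
    ((1 + u * mu₁ * Complex.exp (σ₁ * I)) ^ (a - 1) *
      (1 + u * mu₂ * Complex.exp (σ₂ * I)) ^ (b - k)) with hg
  have h1 : ∫ v : ℝ, (Set.Ioi 0).indicator g (v / c + T) =
      c * idleIntegral l mu₁ mu₂ (a - 1) (b - k) (Complex.exp (σ₁ * I)) (Complex.exp (σ₂ * I)) := by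
    rw [Measure.integral_comp_div (fun w => (Set.Ioi 0).indicator g (w + T)) c,
      integral_add_right_eq_self, integral_indicator measurableSet_Ioi, abs_of_pos hc,
      Complex.real_smul]
    rfl
  have h2 : ∀ v : ℝ, (Set.Ioi 0).indicator g (v / c + T) = (peak mu₁ mu₂ T l a b k *
        Complex.exp (((a - 1) * (T / (T + 1 / mu₁) * σ₁) +
          (b - k) * (T / (T + 1 / mu₂) * σ₂) : ℝ) * I)) *
        scaledIntegrand mu₁ mu₂ T a b k σ₁ σ₂ c v := by
    intro v
    rw [scaledIntegrand, Set.indicator_apply]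
    simp only [Set.mem_Ioi]
    split_ifs with h
    swap
    · rw [mul_zero]
    simp only [hg]
    rw [one_add_mul_eq_idleFactor hT hmu₁, one_add_mul_eq_idleFactor hT hmu₂, peak]
    set x₁ := v / c / (T + 1 / mu₁) with hx₁
    set x₂ := v / c / (T + 1 / mu₂) with hx₂
    have hexp : l * (v / c) = a * x₁ + b * x₂ := by
      rw [hl, hx₁, hx₂]
      ring
    have e1 : (Real.exp (-(l * (v / c + T))) : ℂ) * Complex.exp (x₁ : ℂ) ^ (a - 1) *
        Complex.exp (x₂ : ℂ) ^ (b - k) =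
        Real.exp (-(l * T)) * Complex.exp ((-(x₁ + k * x₂) : ℝ) : ℂ) := by
      rw [← Complex.exp_nat_mul, ← Complex.exp_nat_mul, Complex.ofReal_exp, Complex.ofReal_exp,
        ← Complex.exp_add, ← Complex.exp_add, ← Complex.exp_add]
      congr 1
      rw [Nat.cast_sub ha, Nat.cast_sub hb]
      have hexp' : (l : ℂ) * (v / c) = a * x₁ + b * x₂ := by exact_mod_cast hexp
      push_cast
      linear_combination (-1 : ℂ) * hexp'
    have e2 : Complex.exp ((T / (T + 1 / mu₁) * σ₁ : ℝ) * I) ^ (a - 1) *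
        Complex.exp ((T / (T + 1 / mu₂) * σ₂ : ℝ) * I) ^ (b - k) =
        Complex.exp (((a - 1) * (T / (T + 1 / mu₁) * σ₁) +
          (b - k) * (T / (T + 1 / mu₂) * σ₂) : ℝ) * I) := by
      rw [← Complex.exp_nat_mul, ← Complex.exp_nat_mul, ← Complex.exp_add]
      congr 1
      rw [Nat.cast_sub ha, Nat.cast_sub hb]
      push_cast
      ring
    rw [← e2]
    simp only [mul_pow]
    push_cast
    push_cast at e1
    linear_combination ((1 + T * mu₁ : ℂ) ^ (a - 1) * (1 + T * mu₂ : ℂ) ^ (b - k) *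
      idleFactor (T / (T + 1 / mu₁)) x₁ σ₁ ^ (a - 1) *
      idleFactor (T / (T + 1 / mu₂)) x₂ σ₂ ^ (b - k) *
      Complex.exp ((T / (T + 1 / mu₁) * σ₁) * I) ^ (a - 1) *
        Complex.exp ((T / (T + 1 / mu₂) * σ₂) * I) ^ (b - k)) * e1
  have hc' : (c : ℂ) ≠ 0 := by exact_mod_cast hc.ne'
  simp only [h2] at h1
  rw [integral_const_mul] at h1
  rw [mul_left_comm, h1, Complex.ofReal_inv, ← mul_assoc, inv_mul_cancel₀ hc', one_mul]

/-- From `log (1 + T mu) ≥ 1 - 1/(1 + T mu) = T / (T + 1/mu)`, the peak with full powers `a` and `b`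
is at least `1`; the missing powers give the denominator. For fixed `k` and bounded `T` this bounds
the peak away from zero, which is all that the comparison with `defect` needs. -/
theorem peak_ge (hmu₁ : 0 < mu₁) (hmu₂ : 0 < mu₂) {T l : ℝ} (hT : 0 < T)
    {a b k : ℕ} (ha : 1 ≤ a) (hb : k ≤ b)
    (hl : l = a / (T + 1 / mu₁) + b / (T + 1 / mu₂)) :
    ((1 + T * mu₁) * (1 + T * mu₂) ^ k)⁻¹ ≤ peak mu₁ mu₂ T l a b k := by
  have h1 : ∀ (mu : ℝ) (_ : 0 < mu) (m : ℕ),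
      Real.exp (m / (T + 1 / mu) * T) ≤ (1 + T * mu) ^ m := by
    intro mu hmu m
    have h2 : 0 < 1 + T * mu := by positivity
    have h3 := Real.one_sub_inv_le_log_of_pos h2
    have h4 : 1 / (T + 1 / mu) * T = 1 - (1 + T * mu)⁻¹ := by
      field_simp
      ring
    calc Real.exp (m / (T + 1 / mu) * T) = Real.exp (m * (1 / (T + 1 / mu) * T)) := by
          congr 1
          ring
      _ ≤ Real.exp (m * Real.log (1 + T * mu)) := by
          rw [h4]
          gcongr
      _ = (1 + T * mu) ^ m := by rw [Real.exp_nat_mul, Real.exp_log h2]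
  have hp : 1 ≤ Real.exp (-(l * T)) * ((1 + T * mu₁) ^ a * (1 + T * mu₂) ^ b) := by
    rw [Real.exp_neg, ← div_eq_inv_mul, le_div_iff₀ (Real.exp_pos _), one_mul, hl, add_mul,
      Real.exp_add]
    exact mul_le_mul (h1 _ hmu₁ a) (h1 _ hmu₂ b) (Real.exp_pos _).le (by positivity)
  rw [inv_le_iff_one_le_mul₀ (by positivity)]
  refine hp.trans (le_of_eq ?_)
  rw [peak]
  obtain ⟨a, rfl⟩ : ∃ a', a = a' + 1 := ⟨a - 1, by omega⟩
  obtain ⟨b, rfl⟩ : ∃ b', b = b' + k := ⟨b - k, by omega⟩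
  rw [Nat.add_sub_cancel, Nat.add_sub_cancel, pow_succ, pow_add]
  ring

theorem tendsto_natCast_sub_div {a : ℕ → ℕ} {θ : ℝ}
    (ha : Tendsto (fun n : ℕ => (a n : ℝ) / n) atTop (𝓝 θ)) (k : ℕ) :
    Tendsto (fun n : ℕ => ((a n - k : ℕ) : ℝ) / n) atTop (𝓝 θ) := by
  have h1 : Tendsto (fun n : ℕ => (a n : ℝ) / n - k / n) atTop (𝓝 θ) := by
    simpa using ha.sub (tendsto_const_div_atTop_nhds_zero_nat (k : ℝ))
  refine tendsto_of_tendsto_of_tendsto_of_le_of_le h1 ha (fun n => ?_) (fun n => ?_)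
  · show (a n : ℝ) / n - k / n ≤ ((a n - k : ℕ) : ℝ) / n
    rw [← sub_div]
    gcongr
    have : a n ≤ (a n - k) + k := by omega
    have : (a n : ℝ) ≤ ((a n - k : ℕ) : ℝ) + k := by exact_mod_cast this
    linarith
  · show ((a n - k : ℕ) : ℝ) / n ≤ (a n : ℝ) / n
    gcongr
    omega

/-- The quadratic form of the limiting covariance matrix. -/
noncomputable def covForm (θ₁ θ₂ T mu₁ mu₂ s₁ s₂ : ℝ) : ℝ :=
  θ₁ * (T / (T + 1 / mu₁) * (1 - T / (T + 1 / mu₁))) * s₁ ^ 2 +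
    θ₂ * (T / (T + 1 / mu₂) * (1 - T / (T + 1 / mu₂))) * s₂ ^ 2 +
    (θ₁ * (1 - T / (T + 1 / mu₁)) / (T + 1 / mu₁) * s₁ +
      θ₂ * (1 - T / (T + 1 / mu₂)) / (T + 1 / mu₂) * s₂) ^ 2 /
      (θ₁ / (T + 1 / mu₁) ^ 2 + θ₂ / (T + 1 / mu₂) ^ 2)

theorem measurable_scaledIntegrand (T : ℝ) (a b k : ℕ) (σ₁ σ₂ c : ℝ) :
    Measurable (scaledIntegrand mu₁ mu₂ T a b k σ₁ σ₂ c) := by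
  unfold scaledIntegrand idleFactor
  refine Measurable.ite (measurableSet_lt (by fun_prop) (by fun_prop)) ?_ measurable_const
  fun_prop

/-- The pointwise limit is `exp (-A v²/2 + i B v - Q/2)`, where `B` and `Q` are linear and quadratic
in `s`. Its integral is a constant `C` times `exp (-(Q + B²/A)/2)`, and `Q + B²/A` is `covForm`. -/
theorem tendsto_integral_scaledIntegrand (hmu₁ : 0 < mu₁) (hmu₂ : 0 < mu₂) {T : ℕ → ℝ} {T₀ : ℝ}
    (hT₀ : 0 < T₀) (hT : Tendsto T atTop (𝓝 T₀)) {a b : ℕ → ℕ} {θ₁ θ₂ : ℝ} (hθ₁ : 0 < θ₁)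
    (hθ₂ : 0 < θ₂) (ha : Tendsto (fun n : ℕ => (a n : ℝ) / n) atTop (𝓝 θ₁))
    (hb : Tendsto (fun n : ℕ => (b n : ℝ) / n) atTop (𝓝 θ₂)) (k : ℕ) :
    ∃ C : ℂ, C ≠ 0 ∧ ∀ s₁ s₂ : ℝ, Tendsto (fun n : ℕ => ∫ v : ℝ,
      scaledIntegrand mu₁ mu₂ (T n) (a n) (b n) k (s₁ / √(n : ℝ)) (s₂ / √(n : ℝ)) (√(n : ℝ)) v) atTop
      (𝓝 (C * Complex.exp ((-(covForm θ₁ θ₂ T₀ mu₁ mu₂ s₁ s₂ / 2) : ℝ) : ℂ))) := by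
  have ht₁ : 0 < T₀ + 1 / mu₁ := by positivity
  have ht₂ : 0 < T₀ + 1 / mu₂ := by positivity
  set A : ℝ := θ₁ / (T₀ + 1 / mu₁) ^ 2 + θ₂ / (T₀ + 1 / mu₂) ^ 2 with hA
  have hA0 : 0 < A := by positivity
  have hb0 : ((-(A / 2) : ℝ) : ℂ).re < 0 := by
    rw [Complex.ofReal_re]
    linarith
  refine ⟨(Real.pi / -((-(A / 2) : ℝ) : ℂ)) ^ (1 / 2 : ℂ), ?_, fun s₁ s₂ => ?_⟩
  · rw [Complex.cpow_ne_zero_iff_of_exponent_ne_zero (by norm_num)]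
    refine div_ne_zero (by exact_mod_cast Real.pi_ne_zero) ?_
    rw [← Complex.ofReal_neg, neg_neg]
    exact_mod_cast (by positivity : A / 2 ≠ 0)
  set B : ℝ := θ₁ * (1 - T₀ / (T₀ + 1 / mu₁)) / (T₀ + 1 / mu₁) * s₁ +
      θ₂ * (1 - T₀ / (T₀ + 1 / mu₂)) / (T₀ + 1 / mu₂) * s₂ with hB
  set Q : ℝ := θ₁ * (T₀ / (T₀ + 1 / mu₁) * (1 - T₀ / (T₀ + 1 / mu₁))) * s₁ ^ 2 +
    θ₂ * (T₀ / (T₀ + 1 / mu₂) * (1 - T₀ / (T₀ + 1 / mu₂))) * s₂ ^ 2 with hQ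
  have hgauss := integral_cexp_quadratic hb0 (I * B) ((-(Q / 2) : ℝ) : ℂ)
  have hval : ((-(Q / 2) : ℝ) : ℂ) - (I * B) ^ 2 / (4 * ((-(A / 2) : ℝ) : ℂ)) =
      ((-(covForm θ₁ θ₂ T₀ mu₁ mu₂ s₁ s₂ / 2) : ℝ) : ℂ) := by
    have hAC : (A : ℂ) ≠ 0 := by exact_mod_cast hA0.ne'
    have : covForm θ₁ θ₂ T₀ mu₁ mu₂ s₁ s₂ = Q + B ^ 2 / A := rfl
    rw [this, mul_pow, Complex.I_sq]
    push_cast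
    field_simp
    ring
  rw [hval] at hgauss
  rw [← hgauss]
  have hsqrt : Tendsto (fun n : ℕ => √(n : ℝ)) atTop atTop :=
    Real.tendsto_sqrt_atTop.comp tendsto_natCast_atTop_atTop
  have hTτ : ∀ mu : ℝ, Tendsto (fun n => T n + 1 / mu) atTop (𝓝 (T₀ + 1 / mu)) :=
    fun mu => hT.add_const _
  have hσ : ∀ s : ℝ, Tendsto (fun n : ℕ => √(n : ℝ) * (s / √(n : ℝ))) atTop (𝓝 s) := by
    intro s
    refine tendsto_const_nhds.congr' ?_
    filter_upwards [hsqrt.eventually_gt_atTop 0] with n hn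
    field_simp
  have hTpos : ∀ᶠ n in atTop, 0 < T n := hT.eventually_const_lt hT₀
  have hTlt : ∀ᶠ n in atTop, T n < T₀ + 1 := hT.eventually_lt_const (by linarith)
  have hc : ∀ᶠ n : ℕ in atTop, θ₁ / 2 * n ≤ ((a n - 1 : ℕ) : ℝ) := by
    filter_upwards [(tendsto_natCast_sub_div ha 1).eventually_const_lt (half_lt_self hθ₁),
      eventually_gt_atTop 0] with n h1 hn
    have : (0 : ℝ) < n := by exact_mod_cast hn
    rw [lt_div_iff₀ this] at h1
    exact h1.le
  -- The first pool alone supplies the exponential decay in `v`. The factor of the second pool is at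
  -- most `1`, and the last exponential at most `exp (1 + k)`, because the relative deviations are
  -- at least `-1`.
  refine tendsto_integral_filter_of_dominated_convergence
    (fun v => Real.exp (θ₁ / 2) * Real.exp (1 + k) *
      Real.exp (-(θ₁ / 4 / (T₀ + 1 + 1 / mu₁) * |v|)))
    (Eventually.of_forall fun n => (measurable_scaledIntegrand _ _ _ _ _ _ _).aestronglyMeasurable)
    ?_ ((integrable_exp_neg_mul_abs (by positivity)).const_mul _) (ae_of_all _ fun v => ?_)
  · filter_upwards [hTpos, hTlt, hc, eventually_gt_atTop 0] with n hT1 hT2 hc hn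
    refine ae_of_all _ fun v => ?_
    rw [scaledIntegrand]
    split_ifs with hv
    swap
    · rw [norm_zero]
      positivity
    have hs : 0 < √(n : ℝ) := Real.sqrt_pos.mpr (by exact_mod_cast hn)
    have hq : ∀ mu : ℝ, 0 < mu → T n / (T n + 1 / mu) ≤ 1 := by
      intro mu hmu
      rw [div_le_one (by positivity)]
      have : 0 < 1 / mu := by positivity
      linarith
    have hx : ∀ mu : ℝ, 0 < mu →
        0 ≤ T n / (T n + 1 / mu) + v / √(n : ℝ) / (T n + 1 / mu) := by
      intro mu hmu
      rw [← add_div]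
      have : 0 < T n + v / √(n : ℝ) := by linarith
      positivity
    have hx₁ := hx mu₁ hmu₁
    have hx₂ := hx mu₂ hmu₂
    have hq₁ := hq mu₁ hmu₁
    have hq₂ := hq mu₂ hmu₂
    have b1 := norm_idleFactor_pow_le (σ := s₁ / √(n : ℝ)) (y := v / (T n + 1 / mu₁)) hn
      (by positivity) hq₁ hx₁ hc (by field_simp)
    have b2 : ‖idleFactor (T n / (T n + 1 / mu₂)) (v / √(n : ℝ) / (T n + 1 / mu₂))
        (s₂ / √(n : ℝ)) ^ (b n - k)‖ ≤ 1 := by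
      rw [norm_pow]
      exact pow_le_one₀ (norm_nonneg _) (norm_idleFactor_le_one hq₂ hx₂)
    have b3 : ‖Complex.exp ((-(v / √(n : ℝ) / (T n + 1 / mu₁) +
        k * (v / √(n : ℝ) / (T n + 1 / mu₂))) : ℝ) : ℂ)‖ ≤ Real.exp (1 + k) := by
      rw [Complex.norm_exp_ofReal]
      refine Real.exp_le_exp.mpr ?_
      have : -(k : ℝ) ≤ k * (v / √(n : ℝ) / (T n + 1 / mu₂)) := by
        have h := mul_le_mul_of_nonneg_left (show (-1 : ℝ) ≤ v / √(n : ℝ) / (T n + 1 / mu₂) by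
          linarith) (Nat.cast_nonneg (α := ℝ) k)
        linarith
      linarith
    have b4 : Real.exp (θ₁ / 2 - θ₁ / 2 / 2 * |v / (T n + 1 / mu₁)|) ≤
        Real.exp (θ₁ / 2) * Real.exp (-(θ₁ / 4 / (T₀ + 1 + 1 / mu₁) * |v|)) := by
      rw [← Real.exp_add]
      refine Real.exp_le_exp.mpr ?_
      rw [abs_div, abs_of_pos (show 0 < T n + 1 / mu₁ by positivity)]
      have : |v| / (T₀ + 1 + 1 / mu₁) ≤ |v| / (T n + 1 / mu₁) := by gcongr
      have := mul_le_mul_of_nonneg_left this (show 0 ≤ θ₁ / 4 by positivity)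
      calc _ = θ₁ / 2 + -(θ₁ / 4 * (|v| / (T n + 1 / mu₁))) := by ring
        _ ≤ θ₁ / 2 + -(θ₁ / 4 * (|v| / (T₀ + 1 + 1 / mu₁))) := by linarith
        _ = _ := by ring
    rw [norm_mul, norm_mul]
    calc _ ≤ Real.exp (θ₁ / 2) * Real.exp (-(θ₁ / 4 / (T₀ + 1 + 1 / mu₁) * |v|)) * 1 *
          Real.exp (1 + k) := by gcongr; exact b1.trans b4
      _ = _ := by ring
  · have hxs : ∀ mu : ℝ, 0 < mu → Tendsto (fun n : ℕ => √(n : ℝ) *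
        (v / √(n : ℝ) / (T n + 1 / mu))) atTop (𝓝 (v / (T₀ + 1 / mu))) := by
      intro mu hmu
      refine (tendsto_const_nhds.div (hTτ mu) (by positivity)).congr' ?_
      filter_upwards [hsqrt.eventually_gt_atTop 0] with n hn
      simp only [Pi.div_apply]
      field_simp
    have hq : ∀ mu : ℝ, 0 < mu → Tendsto (fun n => T n / (T n + 1 / mu)) atTop
        (𝓝 (T₀ / (T₀ + 1 / mu))) := fun mu hmu => hT.div (hTτ mu) (by positivity)
    have hv0 : Tendsto (fun n : ℕ => v / √(n : ℝ)) atTop (𝓝 0) := hsqrt.const_div_atTop v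
    have hx0 : ∀ mu : ℝ, 0 < mu → Tendsto (fun n : ℕ => v / √(n : ℝ) / (T n + 1 / mu)) atTop
        (𝓝 0) := by
      intro mu hmu
      have h := hv0.div (hTτ mu) (by positivity)
      rw [zero_div] at h
      exact h
    have hexp : Tendsto (fun n : ℕ => Complex.exp ((-(v / √(n : ℝ) / (T n + 1 / mu₁) +
        k * (v / √(n : ℝ) / (T n + 1 / mu₂))) : ℝ) : ℂ)) atTop (𝓝 1) := by
      have h := ((hx0 mu₁ hmu₁).add ((hx0 mu₂ hmu₂).const_mul (k : ℝ))).neg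
      have h' := (Complex.continuous_exp.tendsto _).comp ((Complex.continuous_ofReal.tendsto _).comp h)
      simpa [Function.comp_def] using h'
    have hmain := ((tendsto_idleFactor_pow (hq mu₁ hmu₁) (hxs mu₁ hmu₁) (hσ s₁)
      (tendsto_natCast_sub_div ha 1)).mul (tendsto_idleFactor_pow (hq mu₂ hmu₂) (hxs mu₂ hmu₂)
      (hσ s₂) (tendsto_natCast_sub_div hb k))).mul hexp
    rw [mul_one, ← Complex.exp_add] at hmain
    have hexponent : (θ₁ : ℂ) * (-(((T₀ / (T₀ + 1 / mu₁) : ℝ) : ℂ) *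
          (1 - ((T₀ / (T₀ + 1 / mu₁) : ℝ) : ℂ)) * s₁ ^ 2 / 2) + I * s₁ *
          ((v / (T₀ + 1 / mu₁) : ℝ) : ℂ) * (1 - ((T₀ / (T₀ + 1 / mu₁) : ℝ) : ℂ)) -
          ((v / (T₀ + 1 / mu₁) : ℝ) : ℂ) ^ 2 / 2) +
        (θ₂ : ℂ) * (-(((T₀ / (T₀ + 1 / mu₂) : ℝ) : ℂ) *
          (1 - ((T₀ / (T₀ + 1 / mu₂) : ℝ) : ℂ)) * s₂ ^ 2 / 2) + I * s₂ *
          ((v / (T₀ + 1 / mu₂) : ℝ) : ℂ) * (1 - ((T₀ / (T₀ + 1 / mu₂) : ℝ) : ℂ)) -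
          ((v / (T₀ + 1 / mu₂) : ℝ) : ℂ) ^ 2 / 2) =
        ((-(A / 2) : ℝ) : ℂ) * (v : ℂ) ^ 2 + I * B * v + ((-(Q / 2) : ℝ) : ℂ) := by
      rw [hA, hB, hQ]
      push_cast
      simp only [div_eq_mul_inv, ← inv_pow]
      ring
    rw [hexponent] at hmain
    refine hmain.congr' ?_
    filter_upwards [(hv0.add hT).eventually_const_lt (by simpa using hT₀)] with n hn
    rw [scaledIntegrand, if_pos hn]

end Laplace

end NSystem
namespace NSystem

/-! ### Load condition -/

/-- If `R` is empty the whole arrival rate must be covered by all servers. If `R` is a nonempty list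
of `s₂` servers, only type `c2` remains unserved, and the servers outside `R` include the whole
first pool. -/
theorem loadLE_of_le {n₁ n₂ : ℕ} {lam₁ lam₂ mu₁ mu₂ ρ : ℝ} (h2 : 0 ≤ lam₂)
    (hmu₂ : 0 ≤ mu₂) (hρ : 0 ≤ ρ) (hle₂ : lam₂ ≤ ρ * (n₁ * mu₁))
    (hle : lam₁ + lam₂ ≤ ρ * (n₁ * mu₁ + n₂ * mu₂)) :
    LoadLE (n₁ := n₁) (n₂ := n₂) (custRate lam₁ lam₂) (serviceRate mu₁ mu₂) ρ := by
  intro R hR hRr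
  have hsum : ∑ v : Server n₁ n₂, serviceRate mu₁ mu₂ v = n₁ * mu₁ + n₂ * mu₂ := by
    rw [Fintype.sum_sum_type]
    simp [serviceRate]
  have hmap : (R.map (serviceRate mu₁ mu₂)).sum = R.length * mu₂ := by
    have : R.map (serviceRate mu₁ mu₂) = R.map fun _ => mu₂ :=
      List.map_congr_left fun w hw => by
        rcases w with w | w
        · simpa using hRr _ hw
        · rfl
    rw [this, List.map_const', List.sum_replicate, nsmul_eq_mul]
  have hlen : R.length ≤ n₂ := by
    rw [← List.toFinset_card_of_nodup hR]
    refine (Finset.card_le_card (t := rights n₁ n₂) fun w hw => ?_).trans_eq card_rights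
    simpa [rights] using hRr w (List.mem_toFinset.mp hw)
  rw [hsum, hmap]
  rcases R with _ | ⟨y, R⟩
  · simpa [unmetRate, custRate] using hle
  · have h3 : unmetRate (custRate lam₁ lam₂) (y :: R) ≤ lam₂ := by
      rw [unmetRate, if_neg (fun h => by simpa [compat_c1] using h y (by simp)), zero_add]
      split_ifs
      exacts [le_rfl, h2]
    refine h3.trans (hle₂.trans (mul_le_mul_of_nonneg_left ?_ hρ))
    have : ((y :: R).length : ℝ) * mu₂ ≤ n₂ * mu₂ := by gcongr
    linarith

/-! ### The fluid idle time -/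

section IdleTime

variable {x₁ x₂ l mu₁ mu₂ : ℝ}

/-- With `s = x₁/l`, `t = x₂/l`, `p = 1/mu₁`, `q = 1/mu₂` the equation is `(T + p)(T + q) = s (T +
q) + t (T + p)`. The load condition says `p q < s q + t p`: the constant term is negative, and
`idleTime` is the positive root. -/
theorem idleTime_pos_and_eq (hx₁ : 0 < x₁) (hx₂ : 0 < x₂) (hl : 0 < l) (hmu₁ : 0 < mu₁)
    (hmu₂ : 0 < mu₂) (hload : l < x₁ * mu₁ + x₂ * mu₂) :
    0 < idleTime x₁ x₂ l mu₁ mu₂ ∧ l = x₁ / (idleTime x₁ x₂ l mu₁ mu₂ + 1 / mu₁) +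
      x₂ / (idleTime x₁ x₂ l mu₁ mu₂ + 1 / mu₂) := by
  set p := 1 / mu₁ with hp
  set q := 1 / mu₂ with hq
  set s := x₁ / l with hs
  set t := x₂ / l with ht
  have hp0 : 0 < p := by positivity
  have hq0 : 0 < q := by positivity
  have hs0 : 0 < s := by positivity
  have ht0 : 0 < t := by positivity
  have hpq : p * q < s * q + t * p := by
    have h1 : l * (p * q) < (x₁ * mu₁ + x₂ * mu₂) * (p * q) := by gcongr
    have h2 : (x₁ * mu₁ + x₂ * mu₂) * (p * q) = l * (s * q + t * p) := by
      rw [hp, hq, hs, ht]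
      field_simp
    rw [h2] at h1
    exact lt_of_mul_lt_mul_left h1 hl.le
  set Δ := ((x₁ + x₂) / l) ^ 2 - 2 * ((x₁ - x₂) / l) * (p - q) + (p - q) ^ 2 with hΔ
  have hΔ' : Δ = (s + t - p - q) ^ 2 + 4 * (s * q + t * p - p * q) := by
    rw [hΔ, add_div, sub_div, ← hs, ← ht]
    ring
  have hΔ0 : 0 ≤ Δ := by
    rw [hΔ']
    have := sq_nonneg (s + t - p - q)
    linarith
  have hT : idleTime x₁ x₂ l mu₁ mu₂ = (s + t - p - q + √Δ) / 2 := by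
    rw [idleTime, ← hp, ← hq, ← hΔ, add_div x₁ x₂ l, ← hs, ← ht]
  have hsqrt : |s + t - p - q| < √Δ := by
    rw [← Real.sqrt_sq_eq_abs]
    exact Real.sqrt_lt_sqrt (sq_nonneg _) (by rw [hΔ']; linarith)
  set T := idleTime x₁ x₂ l mu₁ mu₂
  have hT0 : 0 < T := by
    rw [hT]
    have := (abs_lt.mp hsqrt).1
    linarith [neg_abs_le (s + t - p - q)]
  refine ⟨hT0, ?_⟩
  have hsq := Real.sq_sqrt hΔ0
  have hquad : (T + p) * (T + q) = s * (T + q) + t * (T + p) := by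
    have : √Δ = 2 * T - (s + t - p - q) := by rw [hT]; ring
    rw [this, hΔ'] at hsq
    nlinarith
  have h1 : x₁ = l * s := by rw [hs]; field_simp
  have h2 : x₂ = l * t := by rw [ht]; field_simp
  have h3 : (T + p) ≠ 0 := by positivity
  have h4 : (T + q) ≠ 0 := by positivity
  rw [h1, h2]
  field_simp
  linarith

theorem tendsto_idleTime {x₁ x₂ l : ℕ → ℝ} {θ₁ θ₂ r : ℝ} (hr : 0 < r)
    (h₁ : Tendsto (fun n : ℕ => x₁ n / n) atTop (𝓝 θ₁))
    (h₂ : Tendsto (fun n : ℕ => x₂ n / n) atTop (𝓝 θ₂))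
    (hl : Tendsto (fun n : ℕ => l n / n) atTop (𝓝 r)) (mu₁ mu₂ : ℝ) :
    Tendsto (fun n => idleTime (x₁ n) (x₂ n) (l n) mu₁ mu₂) atTop
      (𝓝 (idleTime θ₁ θ₂ r mu₁ mu₂)) := by
  have hdiv : ∀ y : ℕ → ℝ, ∀ θ : ℝ, Tendsto (fun n : ℕ => y n / n) atTop (𝓝 θ) →
      Tendsto (fun n => y n / l n) atTop (𝓝 (θ / r)) := by
    intro y θ hy
    refine (hy.div hl hr.ne').congr' ?_
    filter_upwards [eventually_gt_atTop 0] with n hn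
    have : (n : ℝ) ≠ 0 := by exact_mod_cast hn.ne'
    exact div_div_div_cancel_right₀ this _ _
  have hadd := hdiv (fun n => x₁ n + x₂ n) (θ₁ + θ₂) ((h₁.add h₂).congr fun n => by ring)
  have hsub := hdiv (fun n => x₁ n - x₂ n) (θ₁ - θ₂) ((h₁.sub h₂).congr fun n => by ring)
  unfold idleTime
  exact (((hadd.sub_const _).sub_const _).add ((((hadd.pow 2).sub
    ((hsub.const_mul 2).mul_const _)).add_const _).sqrt)).div_const 2

end IdleTime

/-! ### The pool sizes -/

theorem pool₁_le {θ : ℝ} (hθ : θ ≤ 1) (n : ℕ) : pool₁ θ n ≤ n := by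
  rw [pool₁, Nat.ceil_le]
  exact mul_le_of_le_one_left (Nat.cast_nonneg n) hθ

theorem tendsto_pool₁ {θ : ℝ} (hθ : 0 ≤ θ) :
    Tendsto (fun n : ℕ => (pool₁ θ n : ℝ) / n) atTop (𝓝 θ) :=
  (tendsto_nat_ceil_mul_div_atTop hθ).comp tendsto_natCast_atTop_atTop

theorem tendsto_pool₂ {θ : ℝ} (hθ : 0 ≤ θ) (hθ' : θ ≤ 1) :
    Tendsto (fun n : ℕ => (pool₂ θ n : ℝ) / n) atTop (𝓝 (1 - θ)) := by
  refine (tendsto_const_nhds.sub (tendsto_pool₁ hθ)).congr' ?_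
  filter_upwards [eventually_gt_atTop 0] with n hn
  have : (n : ℝ) ≠ 0 := by exact_mod_cast hn.ne'
  rw [pool₂, Nat.cast_sub (pool₁_le hθ' n), sub_div, div_self this]

/-- Since the fluid idle time is positive, `beta < θ mu₁ / r`, so resource pooling gives `(1 - α) r
< θ mu₁`: the first pool alone can carry type `c2`. A `ρ < 1` strictly above both limiting loads
works for all large `n`. -/
theorem eventually_load {θ α r mu₁ mu₂ : ℝ} {lam : ℕ → ℝ}
    (hθ₀ : 0 < θ) (hθ₁ : θ < 1) (hα₁ : α < 1)
    (hmu₁ : 0 < mu₁) (hmu₂ : 0 < mu₂) (hr : 0 < r)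
    (hlam : Tendsto (fun n : ℕ => lam n / n) atTop (𝓝 r))
    (hload : r / (θ * mu₁ + (1 - θ) * mu₂) < 1)
    (hpool : 1 < α + beta θ (1 - θ) r mu₁ mu₂) :
    ∃ ρ : ℝ, 0 ≤ ρ ∧ ρ < 1 ∧ ∀ᶠ n : ℕ in atTop,
      (1 - α) * lam n ≤ ρ * (pool₁ θ n * mu₁) ∧
      lam n ≤ ρ * (pool₁ θ n * mu₁ + pool₂ θ n * mu₂) := by
  have hθ₂ : 0 < 1 - θ := by linarith
  have hM : 0 < θ * mu₁ + (1 - θ) * mu₂ := by positivity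
  have hl : r < θ * mu₁ + (1 - θ) * mu₂ := by rwa [div_lt_one hM] at hload
  obtain ⟨hT, -⟩ := idleTime_pos_and_eq hθ₀ hθ₂ hr hmu₁ hmu₂ hl
  have hc : (1 - α) * r / (θ * mu₁) < 1 := by
    rw [div_lt_one (by positivity)]
    have h1 : 0 < r * idleTime θ (1 - θ) r mu₁ mu₂ + r / mu₁ := by positivity
    have h2 : (1 - α) < θ / (r * idleTime θ (1 - θ) r mu₁ mu₂ + r / mu₁) := by
      rw [beta] at hpool
      linarith
    rw [lt_div_iff₀ h1] at h2
    have h3 : 0 ≤ (1 - α) * (r * idleTime θ (1 - θ) r mu₁ mu₂) :=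
      mul_nonneg (by linarith) (by positivity)
    have h4 : (1 - α) * (r / mu₁) < θ := by linarith
    calc (1 - α) * r = (1 - α) * (r / mu₁) * mu₁ := by field_simp
      _ < θ * mu₁ := by gcongr
  obtain ⟨ρ, h1, h2⟩ := exists_between (max_lt hc hload)
  have hρ1 := (le_max_left _ _).trans_lt h1
  have hρ2 := (le_max_right _ _).trans_lt h1
  have hρ0 : 0 < ρ := lt_trans (by positivity) hρ2
  refine ⟨ρ, hρ0.le, h2, ?_⟩
  have hp₁ := tendsto_pool₁ hθ₀.le
  have hp₂ := tendsto_pool₂ hθ₀.le hθ₁.le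
  have e1 := (hlam.const_mul (1 - α)).eventually_lt ((hp₁.mul_const mu₁).const_mul ρ)
    (by rwa [div_lt_iff₀ (by positivity)] at hρ1)
  have e2 := hlam.eventually_lt (((hp₁.mul_const mu₁).add (hp₂.mul_const mu₂)).const_mul ρ)
    (by rwa [div_lt_iff₀ hM] at hρ2)
  filter_upwards [e1, e2, eventually_gt_atTop 0] with n h1 h2 hn
  have hn' : (0 : ℝ) < n := by exact_mod_cast hn
  constructor
  · have := mul_lt_mul_of_pos_right h1 hn'
    field_simp at this
    linarith
  · have := mul_lt_mul_of_pos_right h2 hn'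
    field_simp at this
    linarith

/-! ### The covariance matrix -/

section Cov

variable {θ T mu₁ mu₂ : ℝ}

theorem covMatrix_apply {f₁ f₂ : ℝ} (hf₁ : 0 < f₁) (hf₁' : f₁ < θ) (hf₂ : 0 < f₂)
    (hf₂' : f₂ < 1 - θ) (hθ₀ : 0 < θ) (hθ₁ : θ < 1) :
    covMatrix θ f₁ f₂ = (θ * f₂ ^ 2 + (1 - θ) * f₁ ^ 2)⁻¹ •
      !![(θ - f₁) * f₁ * ((1 - θ) * f₁ + f₂ ^ 2), (θ - f₁) * (1 - θ - f₂) * f₁ * f₂;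
        (θ - f₁) * (1 - θ - f₂) * f₁ * f₂, (1 - θ - f₂) * f₂ * (θ * f₂ + f₁ ^ 2)] := by
  have h1 : 0 < θ - f₁ := by linarith
  have h2 : 0 < 1 - θ - f₂ := by linarith
  have h3 : 0 < 1 - θ := by linarith
  have e1 : sigma₁ θ f₁ f₂ ^ 2 =
      (θ - f₁) * f₁ * ((1 - θ) * f₁ + f₂ ^ 2) / (θ * f₂ ^ 2 + (1 - θ) * f₁ ^ 2) :=
    Real.sq_sqrt (by positivity)
  have e2 : sigma₂ θ f₁ f₂ ^ 2 =
      (1 - θ - f₂) * f₂ * (θ * f₂ + f₁ ^ 2) / (θ * f₂ ^ 2 + (1 - θ) * f₁ ^ 2) :=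
    Real.sq_sqrt (by positivity)
  have e3 : corr θ f₁ f₂ * sigma₁ θ f₁ f₂ * sigma₂ θ f₁ f₂ =
      (θ - f₁) * (1 - θ - f₂) * f₁ * f₂ / (θ * f₂ ^ 2 + (1 - θ) * f₁ ^ 2) := by
    rw [corr, sigma₁, sigma₂, ← Real.sqrt_mul (by positivity), ← Real.sqrt_mul (by positivity)]
    refine (Real.sqrt_eq_iff_mul_self_eq (by positivity) (by positivity)).mpr ?_
    field_simp
  rw [covMatrix, e1, e2, e3]
  ext i j
  fin_cases i <;> fin_cases j <;> simp [div_eq_inv_mul]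

/-- A rational identity once everything is expressed by the idle probabilities: `f₁ = θ q₁`, `f₂ =
(1 - θ) q₂` and `T + 1/muᵢ = T / qᵢ`. -/
theorem dotProduct_covMatrix (hθ₀ : 0 < θ) (hθ₁ : θ < 1) (hT : 0 < T) (hmu₁ : 0 < mu₁)
    (hmu₂ : 0 < mu₂) {f₁ f₂ : ℝ} (hf₁ : f₁ = T * θ / (T + 1 / mu₁))
    (hf₂ : f₂ = T * (1 - θ) / (T + 1 / mu₂)) (x : Fin 2 → ℝ) :
    x ⬝ᵥ (covMatrix θ f₁ f₂).mulVec x = covForm θ (1 - θ) T mu₁ mu₂ (x 0) (x 1) := by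
  have hθ₂ : 0 < 1 - θ := by linarith
  set q₁ := T / (T + 1 / mu₁) with hq₁
  set q₂ := T / (T + 1 / mu₂) with hq₂
  have hq : ∀ mu : ℝ, 0 < mu → 0 < T / (T + 1 / mu) ∧ T / (T + 1 / mu) < 1 := by
    intro mu hmu
    have : 0 < 1 / mu := by positivity
    refine ⟨by positivity, ?_⟩
    rw [div_lt_one (by positivity)]
    linarith
  obtain ⟨h1, h2⟩ : 0 < q₁ ∧ q₁ < 1 := hq mu₁ hmu₁
  obtain ⟨h3, h4⟩ : 0 < q₂ ∧ q₂ < 1 := hq mu₂ hmu₂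
  have e1 : f₁ = θ * q₁ := by rw [hf₁, hq₁]; ring
  have e2 : f₂ = (1 - θ) * q₂ := by rw [hf₂, hq₂]; ring
  have t1 : T + 1 / mu₁ = T / q₁ := by rw [hq₁]; field_simp
  have t2 : T + 1 / mu₂ = T / q₂ := by rw [hq₂]; field_simp
  rw [covMatrix_apply (by rw [e1]; positivity) (by rw [e1]; nlinarith) (by rw [e2]; positivity)
    (by rw [e2]; nlinarith) hθ₀ hθ₁, covForm, ← hq₁, ← hq₂, t1, t2, e1, e2]
  simp only [Matrix.smul_apply, Matrix.mulVec, dotProduct, Fin.sum_univ_two,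
    Matrix.of_apply, Matrix.cons_val', Matrix.cons_val_zero, Matrix.cons_val_one,
    Matrix.cons_val_fin_one, smul_eq_mul]
  have hD : θ * ((1 - θ) * q₂) ^ 2 + (1 - θ) * (θ * q₁) ^ 2 ≠ 0 := by positivity
  have hD' : θ / (T / q₁) ^ 2 + (1 - θ) / (T / q₂) ^ 2 ≠ 0 := by positivity
  have hS : θ * q₁ ^ 2 + (1 - θ) * q₂ ^ 2 ≠ 0 := by positivity
  have r1 : θ * ((1 - θ) * q₂) ^ 2 + (1 - θ) * (θ * q₁) ^ 2 =
      θ * (1 - θ) * (θ * q₁ ^ 2 + (1 - θ) * q₂ ^ 2) := by ring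
  have r2 : θ / (T / q₁) ^ 2 + (1 - θ) / (T / q₂) ^ 2 =
      (θ * q₁ ^ 2 + (1 - θ) * q₂ ^ 2) / T ^ 2 := by field_simp
  rw [r1, r2]
  field_simp
  ring

/-- In the form `covForm` the binomial variances are already positive definite, and the fluctuation
of `u` adds a nonnegative square. -/
theorem covMatrix_posDef (hθ₀ : 0 < θ) (hθ₁ : θ < 1) (hT : 0 < T) (hmu₁ : 0 < mu₁)
    (hmu₂ : 0 < mu₂) {f₁ f₂ : ℝ} (hf₁ : f₁ = T * θ / (T + 1 / mu₁))
    (hf₂ : f₂ = T * (1 - θ) / (T + 1 / mu₂)) : (covMatrix θ f₁ f₂).PosDef := by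
  refine Matrix.PosDef.of_dotProduct_mulVec_pos ?_ fun x hx => ?_
  · ext i j
    fin_cases i <;> fin_cases j <;> simp [covMatrix]
  · rw [star_trivial, dotProduct_covMatrix hθ₀ hθ₁ hT hmu₁ hmu₂ hf₁ hf₂, covForm]
    have hθ₂ : 0 < 1 - θ := by linarith
    have hq : ∀ mu : ℝ, 0 < mu → 0 < T / (T + 1 / mu) * (1 - T / (T + 1 / mu)) := by
      intro mu hmu
      have : 0 < 1 / mu := by positivity
      refine mul_pos (by positivity) (sub_pos.mpr ?_)
      rw [div_lt_one (by positivity)]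
      linarith
    have h1 := mul_pos hθ₀ (hq mu₁ hmu₁)
    have h2 := mul_pos hθ₂ (hq mu₂ hmu₂)
    have h3 : x 0 ≠ 0 ∨ x 1 ≠ 0 := by
      by_contra! h
      refine hx ?_
      ext i
      fin_cases i
      exacts [h.1, h.2]
    refine add_pos_of_pos_of_nonneg ?_ (by positivity)
    rcases h3 with h3 | h3
    · exact add_pos_of_pos_of_nonneg (by positivity) (by positivity)
    · exact add_pos_of_nonneg_of_pos (by positivity) (by positivity)

end Cov

end NSystem
namespace NSystem

/-! ### Limit of the generating function on `K = k` -/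

section Limit

open Complex (I)

theorem defect_nonneg {n₁ n₂ k : ℕ} {lam₁ mu₁ mu₂ κ : ℝ} (h1 : 0 ≤ lam₁) (hmu₁ : 0 ≤ mu₁)
    (hmu₂ : 0 ≤ mu₂) (hκ : 0 ≤ κ) : 0 ≤ defect n₁ n₂ k lam₁ mu₁ mu₂ κ := by
  unfold defect
  positivity

/-- All `k`-th powers in `defect` balance, as `n₂` and `lam₁` both grow like `n`; the factor `n₁` in
the denominator remains, so `defect` is `O(1/n)`. -/
theorem tendsto_sqrt_mul_defect {a b : ℕ → ℕ} {lam₁ : ℕ → ℝ} {mu₁ mu₂ θ₁ θ₂ r₁ κ : ℝ}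
    (hmu₁ : 0 < mu₁) (hmu₂ : 0 < mu₂) (hθ₁ : 0 < θ₁) (hθ₂ : 0 < θ₂) (hr₁ : 0 < r₁) (hκ : 0 ≤ κ)
    (ha : Tendsto (fun n : ℕ => (a n : ℝ) / n) atTop (𝓝 θ₁))
    (hb : Tendsto (fun n : ℕ => (b n : ℝ) / n) atTop (𝓝 θ₂))
    (hlam : Tendsto (fun n : ℕ => lam₁ n / n) atTop (𝓝 r₁)) (k : ℕ) :
    Tendsto (fun n : ℕ => √(n : ℝ) * defect (a n) (b n) k (lam₁ n) mu₁ mu₂ κ) atTop (𝓝 0) := by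
  have hbk := tendsto_natCast_sub_div hb k
  have hs : Tendsto (fun n : ℕ => ((√(n : ℝ))⁻¹ : ℝ)) atTop (𝓝 0) :=
    (Real.tendsto_sqrt_atTop.comp tendsto_natCast_atTop_atTop).inv_tendsto_atTop
  have hx : Tendsto (fun n : ℕ => mu₂ / (lam₁ n / n)) atTop (𝓝 (mu₂ / r₁)) :=
    tendsto_const_nhds.div hlam hr₁.ne'
  have hmain : Tendsto (fun n : ℕ => (√(n : ℝ))⁻¹ * (κ ^ (k + 1) *
      (1 + (b n : ℝ) / n * (mu₂ / (lam₁ n / n))) ^ k / ((a n : ℝ) / n *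
        (((b n - k : ℕ) : ℝ) / n) ^ k * (mu₁ * (mu₂ / (lam₁ n / n)) ^ k)))) atTop
      (𝓝 (0 * (κ ^ (k + 1) * (1 + θ₂ * (mu₂ / r₁)) ^ k /
        (θ₁ * θ₂ ^ k * (mu₁ * (mu₂ / r₁) ^ k))))) :=
    hs.mul (((((hb.mul hx).const_add 1).pow k).const_mul _).div
      ((ha.mul (hbk.pow k)).mul ((hx.pow k).const_mul mu₁)) (by positivity))
  rw [zero_mul] at hmain
  refine squeeze_zero' ?_ ?_ hmain
  · filter_upwards [hlam.eventually_const_lt hr₁, eventually_gt_atTop 0] with n h1 hn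
    have hn' : (0 : ℝ) < n := by exact_mod_cast hn
    have : 0 < lam₁ n := by
      have := mul_pos h1 hn'
      rwa [div_mul_cancel₀ _ hn'.ne'] at this
    exact mul_nonneg (Real.sqrt_nonneg _) (defect_nonneg this.le hmu₁.le hmu₂.le hκ)
  · filter_upwards [hlam.eventually_const_lt hr₁, eventually_gt_atTop 0,
      ha.eventually_const_lt hθ₁, hbk.eventually_const_lt hθ₂] with n h1 hn h2 h3
    have hn' : (0 : ℝ) < n := by exact_mod_cast hn
    have hl : 0 < lam₁ n := by
      have := mul_pos h1 hn'
      rwa [div_mul_cancel₀ _ hn'.ne'] at this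
    have ha' : (0 : ℝ) < a n := by
      have := mul_pos h2 hn'
      rwa [div_mul_cancel₀ _ hn'.ne'] at this
    have hb' : (0 : ℝ) < ((b n - k : ℕ) : ℝ) := by
      have := mul_pos h3 hn'
      rwa [div_mul_cancel₀ _ hn'.ne'] at this
    have hdesc : (((b n - k : ℕ) : ℝ)) ^ k ≤ ((b n).descFactorial k : ℝ) := by
      have h := Nat.pow_sub_le_descFactorial (b n) k
      have h' : (b n - k) ^ k ≤ (b n + 1 - k) ^ k := Nat.pow_le_pow_left (by omega) k
      exact_mod_cast h'.trans h
    have hden : 0 < (b n - k : ℕ) := by exact_mod_cast hb'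
    have hsq : √(n : ℝ) = (√(n : ℝ))⁻¹ * n := by
      have : 0 < √(n : ℝ) := Real.sqrt_pos.mpr hn'
      field_simp
      exact Real.sq_sqrt hn'.le
    calc √(n : ℝ) * defect (a n) (b n) k (lam₁ n) mu₁ mu₂ κ
        ≤ √(n : ℝ) * (κ ^ (k + 1) * (1 + b n * (mu₂ / lam₁ n)) ^ k /
          (a n * ((b n - k : ℕ) : ℝ) ^ k * (mu₁ * (mu₂ / lam₁ n) ^ k))) := by
          unfold defect
          gcongr
      _ = _ := by
          have e1 : (b n : ℝ) / n * (mu₂ / (lam₁ n / n)) = b n * (mu₂ / lam₁ n) := by field_simp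
          have e2 : mu₂ / (lam₁ n / n) = n * (mu₂ / lam₁ n) := by field_simp
          conv_lhs => rw [hsq]
          rw [e1, e2, mul_assoc, mul_pow (n : ℝ), div_pow ((b n - k : ℕ) : ℝ)]
          congr 1
          field_simp

/-- The normalization `w` is the inverse of `D` times the peak times the width `n^(-1/2)`. It does
not depend on `s₁`, `s₂`, so the case `s₁ = s₂ = 0` of the same limit serves to eliminate it. -/
theorem tendsto_generating {a b : ℕ → ℕ} {l lam₁ T : ℕ → ℝ} {mu₁ mu₂ T₀ θ₁ θ₂ r₁ κ : ℝ}
    (hmu₁ : 0 < mu₁) (hmu₂ : 0 < mu₂) (hθ₁ : 0 < θ₁) (hθ₂ : 0 < θ₂) (hr₁ : 0 < r₁) (hκ : 0 ≤ κ)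
    (ha : Tendsto (fun n : ℕ => (a n : ℝ) / n) atTop (𝓝 θ₁))
    (hb : Tendsto (fun n : ℕ => (b n : ℝ) / n) atTop (𝓝 θ₂))
    (hlam : Tendsto (fun n : ℕ => lam₁ n / n) atTop (𝓝 r₁))
    (hT₀ : 0 < T₀) (hT : Tendsto T atTop (𝓝 T₀))
    (hl : ∀ᶠ n in atTop, l n = a n / (T n + 1 / mu₁) + b n / (T n + 1 / mu₂))
    (k : ℕ) {N : ℕ → ℂ → ℂ → ℂ}
    (hN : ∀ᶠ n in atTop, ∃ D : ℝ, 0 < D ∧ ∀ z₁ z₂ : ℂ, ‖z₁‖ = 1 → ‖z₂‖ = 1 →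
      ‖N n z₁ z₂ - D * (z₁ * z₂ ^ k * idleIntegral (l n) mu₁ mu₂ (a n - 1) (b n - k) z₁ z₂)‖ ≤
        D * defect (a n) (b n) k (lam₁ n) mu₁ mu₂ κ) :
    ∃ w : ℕ → ℝ, ∃ C : ℂ, C ≠ 0 ∧ ∀ s₁ s₂ : ℝ, Tendsto (fun n : ℕ => w n *
      (Complex.exp ((-(s₁ / √(n : ℝ) * (T n * a n / (T n + 1 / mu₁)) +
        s₂ / √(n : ℝ) * (T n * b n / (T n + 1 / mu₂))) : ℝ) * I) *
        N n (Complex.exp ((s₁ / √(n : ℝ) : ℝ) * I)) (Complex.exp ((s₂ / √(n : ℝ) : ℝ) * I)))) atTop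
      (𝓝 (C * Complex.exp ((-(covForm θ₁ θ₂ T₀ mu₁ mu₂ s₁ s₂ / 2) : ℝ) : ℂ))) := by
  obtain ⟨D, hD⟩ := hN.choice
  obtain ⟨C, hC, hlim⟩ := tendsto_integral_scaledIntegrand hmu₁ hmu₂ hT₀ hT hθ₁ hθ₂ ha hb k
  set P : ℕ → ℝ := fun n => peak mu₁ mu₂ (T n) (l n) (a n) (b n) k with hP
  refine ⟨fun n => √(n : ℝ) / (D n * P n), C, hC, fun s₁ s₂ => ?_⟩
  have hsqrt : Tendsto (fun n : ℕ => √(n : ℝ)) atTop atTop :=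
    Real.tendsto_sqrt_atTop.comp tendsto_natCast_atTop_atTop
  have hTpos : ∀ᶠ n in atTop, 0 < T n := hT.eventually_const_lt hT₀
  have ha1 : ∀ᶠ n in atTop, 1 ≤ a n := by
    filter_upwards [ha.eventually_const_lt hθ₁] with n h
    refine Nat.one_le_iff_ne_zero.mpr fun h0 => ?_
    simp [h0] at h
  have hbk : ∀ᶠ n in atTop, k ≤ b n := by
    filter_upwards [(tendsto_natCast_sub_div hb k).eventually_const_lt hθ₂] with n h
    by_contra h0
    rw [Nat.sub_eq_zero_of_le (by omega)] at h
    simp at h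
  have hq : ∀ mu : ℝ, 0 < mu → Tendsto (fun n => T n / (T n + 1 / mu)) atTop
        (𝓝 (T₀ / (T₀ + 1 / mu))) := fun mu hmu => hT.div (hT.add_const _) (by positivity)
  have hs0 : ∀ s : ℝ, Tendsto (fun n : ℕ => s / √(n : ℝ)) atTop (𝓝 0) :=
    fun s => hsqrt.const_div_atTop s
  set E : ℕ → ℂ := fun n => Complex.exp ((-(s₁ / √(n : ℝ) * (T n * a n / (T n + 1 / mu₁)) +
        s₂ / √(n : ℝ) * (T n * b n / (T n + 1 / mu₂))) : ℝ) * I) with hE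
  have hEnorm : ∀ n, ‖E n‖ = 1 := fun n => Complex.norm_exp_ofReal_mul_I _
  set z₁ : ℕ → ℂ := fun n => Complex.exp ((s₁ / √(n : ℝ) : ℝ) * I) with hz₁
  set z₂ : ℕ → ℂ := fun n => Complex.exp ((s₂ / √(n : ℝ) : ℝ) * I) with hz₂
  have hz₁n : ∀ n, ‖z₁ n‖ = 1 := fun n => Complex.norm_exp_ofReal_mul_I _
  have hz₂n : ∀ n, ‖z₂ n‖ = 1 := fun n => Complex.norm_exp_ofReal_mul_I _
  set J : ℕ → ℂ := fun n => z₁ n * z₂ n ^ k *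
    idleIntegral (l n) mu₁ mu₂ (a n - 1) (b n - k) (z₁ n) (z₂ n) with hJ
  have hPlow : ∀ᶠ n in atTop, ((1 + T n * mu₁) * (1 + T n * mu₂) ^ k)⁻¹ ≤ P n := by
    filter_upwards [hTpos, ha1, hbk, hl] with n h1 h2 h3 h4
    exact peak_ge hmu₁ hmu₂ h1 h2 h3 h4
  have herr : Tendsto (fun n : ℕ => ((√(n : ℝ) / (D n * P n) : ℝ) : ℂ) *
      (E n * (N n (z₁ n) (z₂ n) - D n * J n))) atTop (𝓝 0) := by
    have hbd : Tendsto (fun n => ((1 + T n * mu₁) * (1 + T n * mu₂) ^ k) *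
        (√(n : ℝ) * defect (a n) (b n) k (lam₁ n) mu₁ mu₂ κ)) atTop
        (𝓝 (((1 + T₀ * mu₁) * (1 + T₀ * mu₂) ^ k) * 0)) :=
      (((hT.mul_const _).const_add 1).mul (((hT.mul_const _).const_add 1).pow k)).mul
        (tendsto_sqrt_mul_defect hmu₁ hmu₂ hθ₁ hθ₂ hr₁ hκ ha hb hlam k)
    rw [mul_zero] at hbd
    refine squeeze_zero_norm' ?_ hbd
    filter_upwards [hTpos, hPlow, hD, hlam.eventually_const_lt hr₁, eventually_gt_atTop 0]
      with n h1 h2 h3 h4 hn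
    have hn' : (0 : ℝ) < n := by exact_mod_cast hn
    have hl1 : 0 < lam₁ n := by
      have := mul_pos h4 hn'
      rwa [div_mul_cancel₀ _ hn'.ne'] at this
    have hd := defect_nonneg (n₁ := a n) (n₂ := b n) (k := k) hl1.le hmu₁.le hmu₂.le hκ
    have hpos : 0 < (1 + T n * mu₁) * (1 + T n * mu₂) ^ k := by positivity
    have hP0 : 0 < P n := lt_of_lt_of_le (by positivity) h2
    have hinv : (P n)⁻¹ ≤ (1 + T n * mu₁) * (1 + T n * mu₂) ^ k :=
      inv_le_of_inv_le₀ hpos h2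
    rw [norm_mul, norm_mul, hEnorm, one_mul, Complex.norm_real, Real.norm_of_nonneg (by
      have := h3.1; positivity)]
    calc √(n : ℝ) / (D n * P n) * ‖N n (z₁ n) (z₂ n) - D n * J n‖
        ≤ √(n : ℝ) / (D n * P n) * (D n * defect (a n) (b n) k (lam₁ n) mu₁ mu₂ κ) := by
          have := h3.1
          gcongr
          exact h3.2 _ _ (hz₁n n) (hz₂n n)
      _ = (P n)⁻¹ * (√(n : ℝ) * defect (a n) (b n) k (lam₁ n) mu₁ mu₂ κ) := by
          have := h3.1.ne'
          field_simp
      _ ≤ _ := by gcongr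
  -- The centring by the fluid means uses `a` and `b` servers, the integral `a - 1` and `b - k`;
  -- together with `z₁ z₂ᵏ` this leaves a phase that tends to `1`.
  have hunit : Tendsto (fun n : ℕ => Complex.exp ((s₁ / √(n : ℝ) * (1 - T n / (T n + 1 / mu₁)) +
      k * (s₂ / √(n : ℝ) * (1 - T n / (T n + 1 / mu₂))) : ℝ) * I)) atTop (𝓝 1) := by
    have h := ((hs0 s₁).mul ((hq mu₁ hmu₁).const_sub 1)).add
      (((hs0 s₂).mul ((hq mu₂ hmu₂).const_sub 1)).const_mul (k : ℝ))
    have h' := (Complex.continuous_exp.tendsto _).comp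
      (((Complex.continuous_ofReal.tendsto _).comp h).mul_const I)
    simpa [Function.comp_def] using h'
  have hmain := herr.add (hunit.mul (hlim s₁ s₂))
  rw [zero_add, one_mul] at hmain
  refine hmain.congr' ?_
  filter_upwards [hTpos, hPlow, hD, ha1, hbk, hl, eventually_gt_atTop 0]
    with n h1 h2 h3 h4 h5 h6 hn
  have hn' : (0 : ℝ) < n := by exact_mod_cast hn
  have hsn : 0 < √(n : ℝ) := Real.sqrt_pos.mpr hn'
  have hpos : 0 < (1 + T n * mu₁) * (1 + T n * mu₂) ^ k := by positivity
  have hP0 : 0 < P n := lt_of_lt_of_le (by positivity) h2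
  have hJn : J n = z₁ n * z₂ n ^ k * (P n *
        Complex.exp (((a n - 1) * (T n / (T n + 1 / mu₁) * (s₁ / √(n : ℝ))) +
          (b n - k) * (T n / (T n + 1 / mu₂) * (s₂ / √(n : ℝ))) : ℝ) * I) *
        (((√(n : ℝ))⁻¹ : ℝ) * ∫ v : ℝ, scaledIntegrand mu₁ mu₂ (T n) (a n) (b n) k
          (s₁ / √(n : ℝ)) (s₂ / √(n : ℝ)) (√(n : ℝ)) v)) := by
    rw [← idleIntegral_eq hmu₁ hmu₂ h1 hsn h4 h5 h6]
  have hphase : E n * (z₁ n * z₂ n ^ k *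
      Complex.exp (((a n - 1) * (T n / (T n + 1 / mu₁) * (s₁ / √(n : ℝ))) +
          (b n - k) * (T n / (T n + 1 / mu₂) * (s₂ / √(n : ℝ))) : ℝ) * I)) =
      Complex.exp ((s₁ / √(n : ℝ) * (1 - T n / (T n + 1 / mu₁)) +
        k * (s₂ / √(n : ℝ) * (1 - T n / (T n + 1 / mu₂))) : ℝ) * I) := by
    simp only [hE, hz₁, hz₂]
    rw [← Complex.exp_nat_mul, ← Complex.exp_add, ← Complex.exp_add, ← Complex.exp_add]
    congr 1
    push_cast
    ring
  have hPC : (P n : ℂ) ≠ 0 := by exact_mod_cast hP0.ne'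
  have hDC : (D n : ℂ) ≠ 0 := by exact_mod_cast h3.1.ne'
  have hsC : (√(n : ℝ) : ℂ) ≠ 0 := by exact_mod_cast hsn.ne'
  have hsecond : ((√(n : ℝ) / (D n * P n) : ℝ) : ℂ) * (E n * (D n * J n)) =
      Complex.exp ((s₁ / √(n : ℝ) * (1 - T n / (T n + 1 / mu₁)) +
        k * (s₂ / √(n : ℝ) * (1 - T n / (T n + 1 / mu₂))) : ℝ) * I) *
      ∫ v : ℝ, scaledIntegrand mu₁ mu₂ (T n) (a n) (b n) k
          (s₁ / √(n : ℝ)) (s₂ / √(n : ℝ)) (√(n : ℝ)) v := by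
    rw [← hphase, hJn, Complex.ofReal_div, Complex.ofReal_mul, Complex.ofReal_inv]
    field_simp
  rw [← hsecond]
  ring

end Limit

/-! ### The conditional law -/

section CondLaw

open Complex (I)

theorem charFun_scaledIdleLaw {n₁ n₂ : ℕ} (p : PMF (State n₁ n₂)) (k n : ℕ) (a₁ a₂ : ℝ)
    (t : EuclideanSpace ℝ (Fin 2)) :
    charFun (scaledIdleLaw p k n a₁ a₂ : Measure (EuclideanSpace ℝ (Fin 2))) t =
      (p.toMeasure.real {s | s.K = k} : ℂ)⁻¹ *
        (Complex.exp ((-(t 0 / √(n : ℝ) * a₁ + t 1 / √(n : ℝ) * a₂) : ℝ) * I) *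
        ∫ s in {s : State n₁ n₂ | s.K = k},
          Complex.exp ((t 0 / √(n : ℝ) : ℝ) * I) ^ s.I₁ *
          Complex.exp ((t 1 / √(n : ℝ) : ℝ) * I) ^ s.I₂ ∂p.toMeasure) := by
  have h1 : (scaledIdleLaw p k n a₁ a₂ : Measure (EuclideanSpace ℝ (Fin 2))) =
      (p.toMeasure[|{s | s.K = k}]).map
      (fun s => !₂[((s.I₁ : ℝ) - a₁) / √(n : ℝ), ((s.I₂ : ℝ) - a₂) / √(n : ℝ)]) := rfl
  rw [h1, charFun_apply, integral_map Measurable.of_discrete.aemeasurable (by fun_prop), ProbabilityTheory.cond,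
    integral_smul_measure, Complex.real_smul, ENNReal.toReal_inv, Complex.ofReal_inv, Measure.real]
  congr 1
  rw [← integral_const_mul]
  congr 1
  funext s
  rw [← Complex.exp_nat_mul, ← Complex.exp_nat_mul, ← Complex.exp_add, ← Complex.exp_add]
  congr 1
  simp only [PiLp.inner_apply, Fin.sum_univ_two, RCLike.inner_apply, conj_trivial]
  simp
  ring

end CondLaw

end NSystem
-- Assembly: regularity for large `n` and convergence of the conditional laws.
namespace NSystem

theorem eventually_regular {θ α r mu₁ mu₂ : ℝ} {lam : ℕ → ℝ}
    (hθ₀ : 0 < θ) (hθ₁ : θ < 1) (hα₀ : 0 < α) (hα₁ : α < 1)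
    (hmu₁ : 0 < mu₁) (hmu₂ : 0 < mu₂) (hr : 0 < r)
    (hlam : Tendsto (fun n : ℕ => lam n / n) atTop (𝓝 r))
    (hload : r / (θ * mu₁ + (1 - θ) * mu₂) < 1)
    (hpool : 1 < α + beta θ (1 - θ) r mu₁ mu₂) :
    ∃ ρ κ : ℝ, 0 ≤ ρ ∧ 1 ≤ κ ∧ 1 + ρ * κ ≤ κ ∧ ∀ᶠ n : ℕ in atTop,
      0 < pool₁ θ n ∧ 0 < α * lam n ∧ 0 < (1 - α) * lam n ∧
      LoadLE (n₁ := pool₁ θ n) (n₂ := pool₂ θ n) (custRate (α * lam n) ((1 - α) * lam n))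
        (serviceRate mu₁ mu₂) ρ ∧
      lam n = pool₁ θ n / (idleTime (pool₁ θ n) (pool₂ θ n) (lam n) mu₁ mu₂ + 1 / mu₁) +
        pool₂ θ n / (idleTime (pool₁ θ n) (pool₂ θ n) (lam n) mu₁ mu₂ + 1 / mu₂) := by
  obtain ⟨ρ, hρ0, hρ1, hev⟩ := eventually_load hθ₀ hθ₁ hα₁ hmu₁ hmu₂ hr hlam hload hpool
  have hρ' : 0 < 1 - ρ := by linarith
  -- The sum of the geometric series of ratio `ρ`, for which `1 + ρ κ = κ`.
  refine ⟨ρ, (1 - ρ)⁻¹, hρ0, ?_, ?_, ?_⟩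
  · exact (one_le_inv₀ hρ').mpr (by linarith)
  · field_simp
    linarith
  filter_upwards [hev, hlam.eventually_const_lt hr,
    (tendsto_pool₁ hθ₀.le).eventually_const_lt hθ₀,
    (tendsto_pool₂ hθ₀.le hθ₁.le).eventually_const_lt (show 0 < 1 - θ by linarith),
    eventually_gt_atTop 0] with n h1 h2 h3 h4 hn
  have hn' : (0 : ℝ) < n := by exact_mod_cast hn
  have hl : 0 < lam n := (div_pos_iff_of_pos_right hn').mp h2
  have hp₁ : (0 : ℝ) < pool₁ θ n := (div_pos_iff_of_pos_right hn').mp h3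
  have hp₂ : (0 : ℝ) < pool₂ θ n := (div_pos_iff_of_pos_right hn').mp h4
  have hα' : 0 < 1 - α := by linarith
  refine ⟨by exact_mod_cast hp₁, by positivity, by positivity,
    loadLE_of_le (by positivity) hmu₂.le hρ0 h1.1 (by linarith [h1.2]), ?_⟩
  refine (idleTime_pos_and_eq hp₁ hp₂ hl hmu₁ hmu₂ (h1.2.trans_lt ?_)).2
  have : 0 < pool₁ θ n * mu₁ + pool₂ θ n * mu₂ := by positivity
  exact mul_lt_of_lt_one_left this hρ1

/-- Where `K = k` has probability zero the conditional law is the zero measure. Replacing it there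
by the limit gives a sequence of probability measures, to which the continuity theorem for
characteristic functions applies. -/
theorem tendsto_scaledIdleLaw {n₁ n₂ : ℕ → ℕ} (p : ∀ n, PMF (State (n₁ n) (n₂ n))) (k : ℕ)
    (a₁ a₂ : ℕ → ℝ) {ν : Measure (EuclideanSpace ℝ (Fin 2))} [IsProbabilityMeasure ν]
    (hpos : ∀ᶠ n in atTop, 0 < (p n).toMeasure {s | s.K = k})
    (hchar : ∀ t, Tendsto (fun n : ℕ => charFun
      (scaledIdleLaw (p n) k n (a₁ n) (a₂ n) : Measure (EuclideanSpace ℝ (Fin 2))) t) atTop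
      (𝓝 (charFun ν t))) :
    Tendsto (fun n : ℕ => scaledIdleLaw (p n) k n (a₁ n) (a₂ n)) atTop
      (𝓝 ⟨ν, inferInstance⟩) := by
  classical
  have hprob : ∀ n, 0 < (p n).toMeasure {s | s.K = k} → IsProbabilityMeasure
      (scaledIdleLaw (p n) k n (a₁ n) (a₂ n) : Measure (EuclideanSpace ℝ (Fin 2))) := by
    intro n hn
    have := cond_isProbabilityMeasure hn.ne'
    exact Measure.isProbabilityMeasure_map Measurable.of_discrete.aemeasurable
  let ν' : ProbabilityMeasure (EuclideanSpace ℝ (Fin 2)) := ⟨ν, inferInstance⟩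
  let Q : ℕ → ProbabilityMeasure (EuclideanSpace ℝ (Fin 2)) := fun n =>
    if h : 0 < (p n).toMeasure {s | s.K = k} then
      (⟨scaledIdleLaw (p n) k n (a₁ n) (a₂ n), hprob n h⟩ : ProbabilityMeasure _) else ν'
  have hQ' : ∀ n (h : 0 < (p n).toMeasure {s | s.K = k}), Q n =
      (⟨scaledIdleLaw (p n) k n (a₁ n) (a₂ n), hprob n h⟩ : ProbabilityMeasure _) :=
    fun n h => dif_pos h
  have hQ : ∀ᶠ n in atTop, (Q n).toFiniteMeasure = scaledIdleLaw (p n) k n (a₁ n) (a₂ n) := by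
    filter_upwards [hpos] with n hn
    rw [hQ' n hn]
    rfl
  have hlim : Tendsto Q atTop (𝓝 ν') := by
    refine ProbabilityMeasure.tendsto_of_tendsto_charFun fun t => (hchar t).congr' ?_
    filter_upwards [hpos] with n hn
    rw [hQ' n hn]
    rfl
  rw [ProbabilityMeasure.tendsto_nhds_iff_toFiniteMeasure_tendsto_nhds] at hlim
  exact hlim.congr' hQ

end NSystem

theorem mainTheorem1
    (θ α r mu₁ mu₂ : ℝ) (lam : ℕ → ℝ)
    (hθ₀ : 0 < θ) (hθ₁ : θ < 1) (hα₀ : 0 < α) (hα₁ : α < 1)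
    (hmu₁ : 0 < mu₁) (hmu₂ : 0 < mu₂) (hr : 0 < r)
    -- the total arrival rate grows linearly in the number of servers
    (hlam : Tendsto (fun n : ℕ => lam n / n) atTop (𝓝 r))
    -- traffic intensity below one
    (hload : r / (θ * mu₁ + (1 - θ) * mu₂) < 1)
    -- complete resource pooling
    (hpool : 1 < α + NSystem.beta θ (1 - θ) r mu₁ mu₂)
    (f₁ f₂ : ℝ) (hf₁ : f₁ = NSystem.meanIdle₁ θ (1 - θ) r mu₁ mu₂)
    (hf₂ : f₂ = NSystem.meanIdle₂ θ (1 - θ) r mu₁ mu₂) :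
    -- the stationary distribution exists and is unique for large `n`
    (∀ᶠ n : ℕ in atTop,
      ∃! p : PMF (NSystem.State (NSystem.pool₁ θ n) (NSystem.pool₂ θ n)),
        NSystem.IsStationary (α * lam n) ((1 - α) * lam n) mu₁ mu₂ p) ∧
    (NSystem.covMatrix θ f₁ f₂).PosDef ∧
    ∀ p : ∀ n : ℕ, PMF (NSystem.State (NSystem.pool₁ θ n) (NSystem.pool₂ θ n)),
      (∀ᶠ n : ℕ in atTop,
        NSystem.IsStationary (α * lam n) ((1 - α) * lam n) mu₁ mu₂ (p n)) →
      ∀ k : ℕ,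
        (∀ᶠ n : ℕ in atTop, 0 < (p n).toMeasure {s | s.K = k}) ∧
        Tendsto
          (fun n : ℕ => NSystem.scaledIdleLaw (p n) k n
            (NSystem.meanIdle₁ (NSystem.pool₁ θ n) (NSystem.pool₂ θ n) (lam n) mu₁ mu₂)
            (NSystem.meanIdle₂ (NSystem.pool₁ θ n) (NSystem.pool₂ θ n) (lam n) mu₁ mu₂))
          atTop (𝓝 (NSystem.limitLaw θ f₁ f₂)) := by
  have hθ₂ : 0 < 1 - θ := by linarith
  obtain ⟨ρ, κ, hρ, hκ, hρκ, hreg⟩ :=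
    NSystem.eventually_regular hθ₀ hθ₁ hα₀ hα₁ hmu₁ hmu₂ hr hlam hload hpool
  have hM : 0 < θ * mu₁ + (1 - θ) * mu₂ := by positivity
  obtain ⟨hT, -⟩ := NSystem.idleTime_pos_and_eq hθ₀ hθ₂ hr hmu₁ hmu₂ ((div_lt_one hM).mp hload)
  have hpd := NSystem.covMatrix_posDef hθ₀ hθ₁ hT hmu₁ hmu₂ hf₁ hf₂
  refine ⟨?_, hpd, fun p hp k => ?_⟩
  · filter_upwards [hreg] with n ⟨h1, h2, h3, h4, _⟩
    obtain ⟨p, hp, -⟩ := NSystem.exists_isStationary h1 h2 h3 hmu₁ hmu₂ hρ hκ hρκ h4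
    exact ⟨p, hp, fun p' hp' => NSystem.isStationary_unique h1 h2 hmu₁ hmu₂ hp' hp⟩
  have hN : ∀ᶠ n in atTop, ∃ D : ℝ, 0 < D ∧ ∀ z₁ z₂ : ℂ, ‖z₁‖ = 1 → ‖z₂‖ = 1 →
      ‖(∫ s in {s | s.K = k}, z₁ ^ s.I₁ * z₂ ^ s.I₂ ∂(p n).toMeasure) -
        D * (z₁ * z₂ ^ k * NSystem.idleIntegral (lam n) mu₁ mu₂ (NSystem.pool₁ θ n - 1)
          (NSystem.pool₂ θ n - k) z₁ z₂)‖ ≤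
        D * NSystem.defect (NSystem.pool₁ θ n) (NSystem.pool₂ θ n) k (α * lam n) mu₁ mu₂ κ := by
    filter_upwards [hreg, hp, (NSystem.tendsto_natCast_sub_div (NSystem.tendsto_pool₂ hθ₀.le hθ₁.le)
      k).eventually_const_lt hθ₂] with n ⟨h1, h2, h3, h4, _⟩ hpn h5
    have hk : k ≤ NSystem.pool₂ θ n := by
      by_contra h0
      rw [Nat.sub_eq_zero_of_le (by omega)] at h5
      simp at h5
    obtain ⟨p', hp', z, hz0, hz, hpz⟩ :=
      NSystem.exists_isStationary h1 h2 h3 hmu₁ hmu₂ hρ hκ hρκ h4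
    -- By uniqueness the given stationary distribution is the normalized product form.
    obtain rfl := NSystem.isStationary_unique h1 h2 hmu₁ hmu₂ hpn hp'
    have h := NSystem.exists_setIntegral_K h1 h2 h3 hmu₁ hmu₂ hρ hκ hρκ h4 hz0 hz hpz hk
    rwa [show α * lam n + (1 - α) * lam n = lam n by ring] at h
  have hlam₁ : Tendsto (fun n : ℕ => α * lam n / n) atTop (𝓝 (α * r)) :=
    (hlam.const_mul α).congr fun n => by ring
  have hTn := NSystem.tendsto_idleTime hr (NSystem.tendsto_pool₁ hθ₀.le)
    (NSystem.tendsto_pool₂ hθ₀.le hθ₁.le) hlam mu₁ mu₂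
  obtain ⟨w, C, hC, hlim⟩ := NSystem.tendsto_generating hmu₁ hmu₂ hθ₀ hθ₂ (mul_pos hα₀ hr)
    (zero_le_one.trans hκ) (NSystem.tendsto_pool₁ hθ₀.le) (NSystem.tendsto_pool₂ hθ₀.le hθ₁.le)
    hlam₁ hT hTn (hreg.mono fun n h => h.2.2.2.2) k hN
  -- At `s = 0` the generating function is the probability of `K = k`. As the limit `C` is nonzero,
  -- this probability is positive for large `n`.
  have hzero : Tendsto (fun n => (w n : ℂ) * (p n).toMeasure.real {s | s.K = k}) atTop (𝓝 C) := by
    have h := hlim 0 0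
    have h0 : NSystem.covForm θ (1 - θ) (NSystem.idleTime θ (1 - θ) r mu₁ mu₂) mu₁ mu₂ 0 0 = 0 := by
      simp [NSystem.covForm]
    simpa [h0] using h
  have hne := hzero.eventually_ne hC
  have hpos : ∀ᶠ n : ℕ in atTop, 0 < (p n).toMeasure {s | s.K = k} := by
    filter_upwards [hne] with n hn
    refine pos_iff_ne_zero.mpr fun h => hn ?_
    simp [Measure.real, h]
  refine ⟨hpos, ?_⟩
  refine NSystem.tendsto_scaledIdleLaw p k _ _ hpos fun t => ?_
  -- The quotient is the conditional characteristic function; both `w n` and `C` cancel.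
  have hquot := (hlim (t 0) (t 1)).div hzero hC
  rw [mul_div_cancel_left₀ _ hC] at hquot
  have hcf : charFun (multivariateGaussian 0 (NSystem.covMatrix θ f₁ f₂)) t =
      Complex.exp ((-(NSystem.covForm θ (1 - θ) (NSystem.idleTime θ (1 - θ) r mu₁ mu₂) mu₁ mu₂
        (t 0) (t 1) / 2) : ℝ) : ℂ) := by
    rw [charFun_multivariateGaussian hpd.posSemidef,
      NSystem.dotProduct_covMatrix hθ₀ hθ₁ hT hmu₁ hmu₂ hf₁ hf₂]
    simp
  rw [hcf]
  refine hquot.congr' ?_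
  filter_upwards [hne] with n hn
  have hw : (w n : ℂ) ≠ 0 := left_ne_zero_of_mul hn
  rw [NSystem.charFun_scaledIdleLaw, Pi.div_apply, mul_div_mul_left _ _ hw, div_eq_inv_mul]
  rfl
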